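/- Conventions. $\widehat f(\xi)=\int f(x)e^{-2\pi i x\xi}\,dx$ is the Fourier transform and $\check f$ the inverse Fourier transform (also on $L^2(\mathbb R)$ and on tempered distributions). Let $d\ge 2$ be an integer and fix: - a smooth function $\rho_1:\mathbb R\to\mathbb R$ supported on $[1/2,2]$, and put $\rho(t)=\rho_1(t)\mathbf 1_{t>0}-\rho_1(-t)\mathbf 1_{t<0}$; - a Schwartz function $\Phi_1$ with $\widehat{\Phi_1}=1$ on $3/8\le|\xi|\le 17/8$ and $\widehat{\Phi_1}$ supported on $1/8\le|\xi|\le 19/8$; $R_{\Phi_1}f$ is defined by $\widehat{R_{\Phi_1}f}=\widehat f\,\widehat{\Phi_1}$; - a nonnegative Schwartz function $\phi$ with $\widehat\phi$ supported in $[-1/100,1/100]$ and $\widehat\phi(0)=1$; put $\phi_k(x)=2^{-k}\phi(2^{-k}x)$, $I_{k,n}=[2^kn,2^k(n+1)]$ and $\mathbf 1^*_{k,n}=\mathbf 1_{I_{k,n}}*\phi_k$. For integers $j>0$, $m\ge 0$, $n\in\mathbb Z$ and $f,g\in L^2(\mathbb R)$ let $$\mathcal B_{j,m,n}(f,g)(x)=2^{-(d-1)j/2}\int_{\mathbb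 R}R_{\Phi_1}f\big(2^{-(d-1)j}x-2^mt\big)\,R_{\Phi_1}g\big(x-2^mt^d\big)\,\rho(t)\,dt\;\mathbf 1^*_{(d-1)j+m,n}(x),$$ and for $f_1,f_2\in L^2(\mathbb R)$ and a tempered distribution $f_3$ with $\widehat{f_3}\in L^\infty(\mathbb R)$ let $$\Lambda_{j,m,n}(f_1,f_2,f_3)=\big\langle \mathcal B_{j,m,n}(\check f_1,\check f_2),\check f_3\big\rangle=\int_{\mathbb R}\mathcal B_{j,m,n}(\check f_1,\check f_2)(x)\,\overline{\check f_3(x)}\,dx .$$ Let each of $\mathbf I_1,\mathbf I_2$ be one of the intervals $[1/16,39/16]$, $[-39/16,-1/16]$. Let $\mathcal Q_1$ be the set of functions $q_1(\xi)=a|\xi|^{d/(d-1)}+b\xi$ with $a,b\in\mathbb R$ and $2^{m-100}\le|a|\le 2^{m+100}$. Regard $e^{iq_1}$ as an element of $L^2(\mathbf I_1)$, i.e. as the function $\mathbf 1_{\mathbf I_1}e^{iq_1}$. For $\varepsilon>0$ let $\mathfrak D(\ell)=1/(2\ell)$ if $\ell\ge2$ and $\mathfrak D(1)=1/(2+\varepsilon)$.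 Proposition. For every $\varepsilon>0$ there is a constant $C$, depending only on $d,\varepsilon,\rho_1,\Phi_1,\phi$ (so independent of $j,m,n$), such that $$\big|\Lambda_{j,m,n}(e^{iq_1},f_2,f_3)\big|\le C\,2^{-\mathfrak D(d-1)m/2}\,\|f_2\|_{L^2(\mathbf I_2)}\,\|\widehat{f_3}\|_\infty$$ for all integers $j>0$, $m\ge0$, $n\in\mathbb Z$, all $q_1\in\mathcal Q_1$, all $f_2\in L^2(\mathbf I_2)$ and all $f_3$ with $\widehat{f_3}\in L^\infty(\mathbb R)$. -/

import Mathlib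

open MeasureTheory Set
open scoped FourierTransform SchwartzMap ENNReal ContDiff ComplexConjugate

noncomputable section

namespace CurveBHT

/-- The odd extension `ρ(t) = ρ₁(t) 1_{t>0} - ρ₁(-t) 1_{t<0}` of a bump function `ρ₁`. -/
def oddBump (ρ₁ : ℝ → ℝ) (t : ℝ) : ℝ :=
  if 0 < t then ρ₁ t else if t < 0 then -ρ₁ (-t) else 0

/-- `ρ₁` is a smooth bump function supported on `[1/2, 2]`. -/
def IsBump (ρ₁ : ℝ → ℝ) : Prop :=
  ContDiff ℝ ∞ ρ₁ ∧ Function.support ρ₁ ⊆ Icc (1 / 2) 2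

/-- The Schwartz function `Φ₁` satisfies `Φ₁^ = 1` on `3/8 ≤ |ξ| ≤ 17/8`, and `Φ₁^` is supported
on `1/8 ≤ |ξ| ≤ 19/8`. -/
def IsFreqCutoff (Φ₁ : 𝓢(ℝ, ℂ)) : Prop :=
  (∀ ξ : ℝ, 3 / 8 ≤ |ξ| → |ξ| ≤ 17 / 8 → 𝓕 Φ₁ ξ = 1) ∧
  (∀ ξ : ℝ, 𝓕 Φ₁ ξ ≠ 0 → 1 / 8 ≤ |ξ| ∧ |ξ| ≤ 19 / 8)

/-- `φ` is a nonnegative Schwartz function, `φ^` is supported in `[-1/100, 1/100]`, `φ^(0) = 1`. -/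
def IsSpaceCutoff (φ : 𝓢(ℝ, ℝ)) : Prop :=
  (∀ x, 0 ≤ φ x) ∧
  (∀ ξ : ℝ, 𝓕 (fun x : ℝ => (φ x : ℂ)) ξ ≠ 0 → |ξ| ≤ 1 / 100) ∧
  𝓕 (fun x : ℝ => (φ x : ℂ)) 0 = 1

/-- `φ_k(x) = 2^{-k} φ(2^{-k} x)`. -/
def dilate (φ : 𝓢(ℝ, ℝ)) (k : ℤ) (x : ℝ) : ℝ :=
  (2 : ℝ) ^ (-k) * φ ((2 : ℝ) ^ (-k) * x)

/-- The smooth truncation `1*_{k,n} = 1_{I_{k,n}} * φ_k`, where `I_{k,n} = [2^k n, 2^k (n+1)]`. -/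
def smoothInd (φ : 𝓢(ℝ, ℝ)) (k n : ℤ) (x : ℝ) : ℝ :=
  ∫ y in Icc ((2 : ℝ) ^ k * n) ((2 : ℝ) ^ k * (n + 1)), dilate φ k (x - y)

/-- The smooth Fourier restriction `R_Φ f` of `f ∈ L²`, given by `(R_Φ f)^ = f^ Φ^`. Here `𝓕 f` is
the Fourier transform on `L²`; the product with `𝓕 Φ` is integrable, so that the outer inverse
Fourier transform is the usual integral. -/
def fourierRestrict (Φ : 𝓢(ℝ, ℂ)) (f : Lp (α := ℝ) ℂ 2) : ℝ → ℂ :=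
  𝓕⁻ (fun ξ : ℝ => 𝓕 f ξ * 𝓕 Φ ξ)

/-- The bilinear operator `B_{j,m,n}(f, g)` for `j > 0`. -/
def bilinB (d : ℕ) (ρ₁ : ℝ → ℝ) (Φ₁ : 𝓢(ℝ, ℂ)) (φ : 𝓢(ℝ, ℝ)) (j m : ℕ) (n : ℤ)
    (f g : Lp (α := ℝ) ℂ 2) (x : ℝ) : ℂ :=
  (((2 : ℝ) ^ (-(((d : ℝ) - 1) * j / 2)) : ℝ) : ℂ) *
    (∫ t : ℝ, fourierRestrict Φ₁ f ((2 : ℝ) ^ (-(((d : ℤ) - 1) * j)) * x - 2 ^ m * t) *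
      fourierRestrict Φ₁ g (x - 2 ^ m * t ^ d) * (oddBump ρ₁ t : ℂ)) *
    (smoothInd φ (((d : ℤ) - 1) * j + m) n x : ℂ)

open Classical in
/-- The function in `L^∞(ℝ)` that represents the tempered distribution `u`, if there is one (it is
then unique up to null sets). -/
def linftyRep (u : 𝓢'(ℝ, ℂ)) : ℝ → ℂ :=
  if h : ∃ g : Lp (α := ℝ) ℂ ∞, (g : 𝓢'(ℝ, ℂ)) = u then (h.choose : ℝ → ℂ) else 0

/-- The trilinear form `Λ_{j,m,n}(f₁, f₂, f₃) = ⟨B_{j,m,n}(f₁ˇ, f₂ˇ), f₃ˇ⟩` for `j > 0`, where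
`f₁, f₂ ∈ L²` and `f₃` is a tempered distribution with `f₃ˇ ∈ L^∞` (equivalently `f₃^ ∈ L^∞`). -/
def trilinΛ (d : ℕ) (ρ₁ : ℝ → ℝ) (Φ₁ : 𝓢(ℝ, ℂ)) (φ : 𝓢(ℝ, ℝ)) (j m : ℕ) (n : ℤ)
    (f₁ f₂ : Lp (α := ℝ) ℂ 2) (f₃ : 𝓢'(ℝ, ℂ)) : ℂ :=
  ∫ x : ℝ, bilinB d ρ₁ Φ₁ φ j m n (𝓕⁻ f₁) (𝓕⁻ f₂) x * conj (linftyRep (𝓕⁻ f₃) x)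

/-- The set `Q₁` of the functions `a ξ^{d/(d-1)} + b ξ` with real `a, b` and
`2^{m-100} ≤ |a| ≤ 2^{m+100}`; for `ξ < 0` the power is read as `|ξ|^{d/(d-1)}`. -/
def phasesQ₁ (d m : ℕ) : Set (ℝ → ℝ) :=
  {q | ∃ a b : ℝ, (2 : ℝ) ^ ((m : ℤ) - 100) ≤ |a| ∧ |a| ≤ (2 : ℝ) ^ ((m : ℤ) + 100) ∧
    q = fun ξ => a * |ξ| ^ ((d : ℝ) / ((d : ℝ) - 1)) + b * ξ}

/-- The exponent `𝔇(ℓ)`: `1/(2ℓ)` if `ℓ ≥ 2` and `1/(2+ε)` if `ℓ = 1`. -/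
def decayExp (ε : ℝ) (ℓ : ℕ) : ℝ :=
  if ℓ = 1 then 1 / (2 + ε) else 1 / (2 * ℓ)

/-- `I` is one of the two intervals `[1/16, 39/16]` and `[-39/16, -1/16]`. -/
def IsFreqInterval (I : Set ℝ) : Prop :=
  I = Icc (1 / 16) (39 / 16) ∨ I = Icc (-(39 / 16)) (-(1 / 16))

end CurveBHT

end

noncomputable section

namespace CurveBHT

/-! ### A van der Corput estimate for factorised phase derivatives -/

/-! Write `n = d - 1`, `M = 2 ^ m`, `δ = 2 ^ (-n j)`. The substitution `ξ = σ r ^ n` turns the first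
input into an oscillatory integral (`waveFn`) with phase `c n r ^ (n + 1) + (B + e y) r ^ n`, where
`c = a / n` is comparable to `M`. Its stationary point `p` is affine in `y` and its critical value
is `-c p ^ (n + 1)`; this is what the special shape of `q₁` provides. Hence the first input is `exp
(-i c p ^ (n + 1))` times an amplitude `oscAmp` that is `O(|c| ^ (-1/2))`, together with its
derivative for `p` in a compact range (`waveFn_eq`, `oscAmp_norm_le`, `deriv_oscAmp_norm_le`).

After the scaling `x = M U` and the substitution `X = U - t ^ d`, each half of the form is `∫ H(U) ∫
k(X, U) G(X) dX dU`, where `G` carries the second input and `H` the truncation and the third. With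
the first input fixed this is linear in `G`, and Cauchy-Schwarz in `X` reduces matters to `J(U, V) =
∫ k(X, U) conj k(X, V) dX` (`sq_norm_integral_kernel_le`). The derivative of the phase of `J`
factors exactly (`deriv_phase_factor`): up to a positive factor it is `c κ² (V - U) D`, with `D = δ
E - α` and `α = δ U + β`, where `E` is a bounded function of `X` whose derivative is at most `-1`.
So `D` is monotone and `|D| + |D'|` is bounded below by a multiple of `|α|`. A van der Corput
estimate (`norm_integral_exp_le`) then yields `|J| ≲ |c| ^ (-3/2) (1 + (|V - U| |α|) ^ (-1/2))` in
`exists_integral_rootKernel_le`; the summand `1` accounts for stationary points outside the range of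
integration, where an amplitude is `O(1/|c|)`.

Both singularities are integrable. In the variable `U` the truncation has mass `1/δ`, and so, up to
a constant, has the singularity of `|δ U + β| ^ (-1/2)`; the double integral of `|H| |H| |J|` is
therefore `O(M ^ (-3/2) / δ)` (`exists_integral_prod_le`). When the scaling is undone the powers of
`δ` cancel and `M ^ (-1/4)` remains (`scaling_identity`). This suffices because the decay exponent
is at most `1/2`. -/

lemma integral_deriv_div_sq_add_le {x₁ x₂ μ : ℝ} (hx : x₁ ≤ x₂) (hμ : 0 < μ) {D D' : ℝ → ℝ}
    (hD : ∀ x ∈ Icc x₁ x₂, HasDerivAt D (D' x) x) (hD' : ContinuousOn D' (Icc x₁ x₂)) :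
    ∫ x in x₁..x₂, D' x / (D x ^ 2 + μ ^ 2) ≤ Real.pi / μ := by
  have hDc : ContinuousOn D (Icc x₁ x₂) := fun x h => (hD x h).continuousAt.continuousWithinAt
  have hpos : ∀ x, D x ^ 2 + μ ^ 2 ≠ 0 := fun x => by positivity
  have hc : ContinuousOn (fun x => D' x / (D x ^ 2 + μ ^ 2)) (uIcc x₁ x₂) := by
    rw [uIcc_of_le hx]
    exact hD'.div ((hDc.pow 2).add continuousOn_const) fun x _ => hpos x
  -- The primitive is an arctangent, so its total variation is bounded independently of `D`.
  have key := intervalIntegral.integral_eq_sub_of_hasDerivAt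
    (f := fun x => Real.arctan (D x / μ) / μ) (f' := fun x => D' x / (D x ^ 2 + μ ^ 2))
    (a := x₁) (b := x₂) (fun x h => by
      rw [uIcc_of_le hx] at h
      have h1 := (((hD x h).div_const μ).arctan).div_const μ
      refine h1.congr_deriv ?_
      have := hpos x
      have h2 : (1 + (D x / μ) ^ 2) ≠ 0 := by positivity
      rw [div_mul_div_comm, div_div, div_eq_div_iff (by positivity) this]
      field_simp
      ring) hc.intervalIntegrable
  rw [key, ← sub_div]
  gcongr
  linarith [Real.arctan_lt_pi_div_two (D x₂ / μ), Real.neg_pi_div_two_lt_arctan (D x₁ / μ)]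

/-- The amplitude is split with the weights `D² / (D² + μ²)` and `μ² / (D² + μ²)`. In the first
piece `hfac` exhibits a factor `θ'`, and one integration by parts against `q D / (D² + μ²)` gives
`O(1 / (|N| μ))`. In the second piece inserting `1 ≤ (|D| + D') / ℓ` gives `O(μ / ℓ)`. No division
by `θ'` occurs, so zeros of `D` are harmless and need not be located. -/
lemma norm_integral_exp_le_of_deriv_nonneg {x₁ x₂ N ℓ Q : ℝ} (hx : x₁ ≤ x₂) (hN : N ≠ 0)
    (hℓ : 0 < ℓ) (hQ : 0 ≤ Q) {θ θ' D D' : ℝ → ℝ} {a q q' : ℝ → ℂ}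
    (hθ : ∀ x ∈ Icc x₁ x₂, HasDerivAt θ (θ' x) x) (hθ' : ContinuousOn θ' (Icc x₁ x₂))
    (hD : ∀ x ∈ Icc x₁ x₂, HasDerivAt D (D' x) x) (hD' : ContinuousOn D' (Icc x₁ x₂))
    (hD0 : ∀ x ∈ Icc x₁ x₂, 0 ≤ D' x)
    (hq : ∀ x ∈ Icc x₁ x₂, HasDerivAt q (q' x) x)
    (hqm : AEStronglyMeasurable q' (volume.restrict (Icc x₁ x₂)))
    (ha : ContinuousOn a (Icc x₁ x₂))
    (hfac : ∀ x ∈ Icc x₁ x₂, (θ' x : ℂ) * q x = N * D x * a x)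
    (haQ : ∀ x ∈ Icc x₁ x₂, ‖a x‖ ≤ Q) (hqQ : ∀ x ∈ Icc x₁ x₂, ‖q x‖ ≤ Q)
    (hqQ' : ∀ x ∈ Icc x₁ x₂, ‖q' x‖ ≤ Q)
    (hlow : ∀ x ∈ Icc x₁ x₂, ℓ ≤ |D x| + |D' x|) :
    ‖∫ x in x₁..x₂, Complex.exp (Complex.I * θ x) * a x‖
      ≤ Q * (x₂ - x₁ + 8) / Real.sqrt (|N| * ℓ) := by
  have hN' : 0 < |N| := abs_pos.2 hN
  -- This choice balances `1 / (|N| μ)` against `μ / ℓ`.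
  set μ := Real.sqrt (ℓ / |N|) with hμdef
  have hμ : 0 < μ := Real.sqrt_pos.2 (by positivity)
  have hμ2 : μ ^ 2 = ℓ / |N| := Real.sq_sqrt (by positivity)
  have hpos : ∀ x, 0 < D x ^ 2 + μ ^ 2 := fun x => by positivity
  have huI : uIcc x₁ x₂ = Icc x₁ x₂ := uIcc_of_le hx
  have hcont : ∀ {f f' : ℝ → ℝ}, (∀ x ∈ Icc x₁ x₂, HasDerivAt f (f' x) x) →
    ContinuousOn f (Icc x₁ x₂) := fun h x hx => (h x hx).continuousAt.continuousWithinAt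
  have hDc := hcont hD
  have hθc := hcont hθ
  have hqc : ContinuousOn q (Icc x₁ x₂) := fun x h => (hq x h).continuousAt.continuousWithinAt
  have hqi : IntervalIntegrable q' volume x₁ x₂ := by
    rw [intervalIntegrable_iff_integrableOn_Icc_of_le hx]
    exact Integrable.of_bound hqm Q ((ae_restrict_iff' measurableSet_Icc).2 (Filter.Eventually.of_forall hqQ'))
  set G : ℝ → ℝ := fun x => D x / (D x ^ 2 + μ ^ 2) with hG
  set G' : ℝ → ℝ := fun x => D' x * (μ ^ 2 - D x ^ 2) / (D x ^ 2 + μ ^ 2) ^ 2 with hG'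
  have hGd : ∀ x ∈ Icc x₁ x₂, HasDerivAt G (G' x) x := fun x h => by
    refine ((hD x h).div (((hD x h).pow 2).add_const (μ ^ 2)) (hpos x).ne').congr_deriv ?_
    simp only [Pi.pow_apply, hG']
    congr 1
    push_cast
    ring
  have hGc := hcont hGd
  have hden : ContinuousOn (fun x => D x ^ 2 + μ ^ 2) (Icc x₁ x₂) :=
    (hDc.pow 2).add continuousOn_const
  have hGc' : ContinuousOn G' (Icc x₁ x₂) :=
    (hD'.mul (continuousOn_const.sub (hDc.pow 2))).div (hden.pow 2)
      fun x _ => pow_ne_zero _ (hpos x).ne'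
  set w : ℝ → ℝ := fun x => D' x / (D x ^ 2 + μ ^ 2) with hw
  have hwc : ContinuousOn w (Icc x₁ x₂) := hD'.div hden fun x _ => (hpos x).ne'
  have hwI : ∫ x in x₁..x₂, w x ≤ Real.pi / μ := integral_deriv_div_sq_add_le hx hμ hD hD'
  have hGb : ∀ x, |G x| ≤ 1 / (2 * μ) := fun x => by
    rw [hG]
    simp only
    rw [abs_div, abs_of_pos (hpos x), div_le_div_iff₀ (hpos x) (by positivity)]
    nlinarith [sq_nonneg (|D x| - μ), sq_abs (D x)]
  have hGb' : ∀ x ∈ Icc x₁ x₂, |G' x| ≤ w x := fun x h => by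
    rw [hG', hw]
    simp only
    rw [abs_div, abs_of_pos (pow_pos (hpos x) 2), abs_mul, abs_of_nonneg (hD0 x h),
      div_le_div_iff₀ (pow_pos (hpos x) 2) (hpos x)]
    have : |μ ^ 2 - D x ^ 2| ≤ D x ^ 2 + μ ^ 2 := by
      rw [abs_le]; constructor <;> nlinarith [sq_nonneg (D x), sq_nonneg μ]
    calc D' x * |μ ^ 2 - D x ^ 2| * (D x ^ 2 + μ ^ 2)
        ≤ D' x * (D x ^ 2 + μ ^ 2) * (D x ^ 2 + μ ^ 2) := by
          have := hD0 x h
          have := (hpos x).le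
          gcongr
      _ = _ := by ring
  -- splitting of the integrand
  set e : ℝ → ℂ := fun x => Complex.exp (Complex.I * θ x) with he
  have hen : ∀ x, ‖e x‖ = 1 := fun x => by
    rw [he]; simp only; rw [mul_comm]; exact Complex.norm_exp_ofReal_mul_I _
  have hed : ∀ x ∈ Icc x₁ x₂, HasDerivAt e (Complex.I * θ' x * e x) x := fun x h => by
    convert ((hθ x h).ofReal_comp.const_mul Complex.I).cexp using 1
    simp only [he]; ring
  have hec : ContinuousOn e (Icc x₁ x₂) := fun x h => (hed x h).continuousAt.continuousWithinAt
  set v : ℝ → ℂ := fun x => q x * G x with hv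
  set v' : ℝ → ℂ := fun x => q' x * G x + q x * G' x with hv'
  have hvd : ∀ x ∈ Icc x₁ x₂, HasDerivAt v (v' x) x := fun x h =>
    (hq x h).mul (hGd x h).ofReal_comp
  have ofR : ∀ {f : ℝ → ℝ}, ContinuousOn f (Icc x₁ x₂) →
      ContinuousOn (fun x => (f x : ℂ)) (Icc x₁ x₂) := fun h =>
    Complex.continuous_ofReal.comp_continuousOn h
  have hvi : IntervalIntegrable v' volume x₁ x₂ := by
    refine (hqi.mul_continuousOn ?_).add (ContinuousOn.intervalIntegrable ?_)
    · rw [huI]; exact ofR hGc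
    · rw [huI]; exact hqc.mul (ofR hGc')
  have hedi : IntervalIntegrable (fun x => Complex.I * θ' x * e x) volume x₁ x₂ := by
    apply ContinuousOn.intervalIntegrable
    rw [huI]; exact (continuousOn_const.mul (ofR hθ')).mul hec
  have ibp := intervalIntegral.integral_mul_deriv_eq_deriv_mul (u := e) (v := v)
    (by rw [huI]; exact hed) (by rw [huI]; exact hvd) hedi hvi
  have hNC : (N : ℂ) ≠ 0 := by exact_mod_cast hN
  have hsplit : ∫ x in x₁..x₂, e x * a x =
      (Complex.I * N)⁻¹ * (∫ x in x₁..x₂, Complex.I * θ' x * e x * v x) +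
        ∫ x in x₁..x₂, e x * a x * (μ ^ 2 / (D x ^ 2 + μ ^ 2) : ℝ) := by
    rw [← intervalIntegral.integral_const_mul, ← intervalIntegral.integral_add]
    · apply intervalIntegral.integral_congr
      intro x h
      rw [huI] at h
      have h1 := hfac x h
      have h2 : ((D x ^ 2 + μ ^ 2 : ℝ) : ℂ) ≠ 0 := by exact_mod_cast (hpos x).ne'
      have h3 : Complex.I * θ' x * e x * v x = (Complex.I * N) * (e x * a x * D x * G x) := by
        simp only [hv]
        linear_combination Complex.I * e x * G x * h1
      simp only [h3]
      rw [inv_mul_cancel_left₀ (mul_ne_zero Complex.I_ne_zero hNC)]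
      simp only [hG]
      push_cast at h2 ⊢
      field_simp
    · apply ContinuousOn.intervalIntegrable
      rw [huI]
      exact continuousOn_const.mul (((continuousOn_const.mul (ofR hθ')).mul hec).mul
        (hqc.mul (ofR hGc)))
    · apply ContinuousOn.intervalIntegrable
      rw [huI]
      exact (hec.mul ha).mul (ofR (continuousOn_const.div hden fun x _ => (hpos x).ne'))
  have hL : 0 ≤ x₂ - x₁ := sub_nonneg.2 hx
  have hlin : ∀ k m : ℝ, ∫ x in x₁..x₂, (k + m * w x) = k * (x₂ - x₁) + m * ∫ x in x₁..x₂, w x := by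
    intro k m
    rw [intervalIntegral.integral_add (by simp) ((ContinuousOn.intervalIntegrable (by
      rw [huI]; exact hwc)).const_mul m), intervalIntegral.integral_const_mul]
    simp [mul_comm]
  have hlinI : ∀ k m : ℝ, IntervalIntegrable (fun x => k + m * w x) volume x₁ x₂ := fun k m => by
    apply ContinuousOn.intervalIntegrable
    rw [huI]; exact continuousOn_const.add (continuousOn_const.mul hwc)
  have hb1 : ‖∫ x in x₁..x₂, e x * v' x‖ ≤
      Q / (2 * μ) * (x₂ - x₁) + Q * (Real.pi / μ) := by
    calc ‖∫ x in x₁..x₂, e x * v' x‖ ≤ ∫ x in x₁..x₂, (Q / (2 * μ) + Q * w x) := by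
          apply intervalIntegral.norm_integral_le_of_norm_le hx _ (hlinI _ _)
          refine Filter.Eventually.of_forall fun x h => ?_
          have h := Ioc_subset_Icc_self h
          rw [norm_mul, hen, one_mul, hv']
          refine (norm_add_le _ _).trans ?_
          rw [norm_mul, norm_mul, Complex.norm_real, Complex.norm_real, Real.norm_eq_abs,
            Real.norm_eq_abs]
          have := hGb x
          have := hGb' x h
          have := hqQ x h
          have := hqQ' x h
          calc _ ≤ Q * (1 / (2 * μ)) + Q * w x := by gcongr
            _ = _ := by ring
      _ = Q / (2 * μ) * (x₂ - x₁) + Q * ∫ x in x₁..x₂, w x := hlin _ _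
      _ ≤ _ := by gcongr
  have hvb : ∀ x ∈ Icc x₁ x₂, ‖e x * v x‖ ≤ Q * (1 / (2 * μ)) := fun x h => by
    rw [norm_mul, hen, one_mul, hv]
    simp only
    rw [norm_mul, Complex.norm_real, Real.norm_eq_abs]
    have := hGb x
    have := hqQ x h
    gcongr
  have hb2 : ‖∫ x in x₁..x₂, Complex.I * θ' x * e x * v x‖ ≤
      Q / μ + (Q / (2 * μ) * (x₂ - x₁) + Q * (Real.pi / μ)) := by
    have : ∫ x in x₁..x₂, Complex.I * θ' x * e x * v x =
        (e x₂ * v x₂ - e x₁ * v x₁) - ∫ x in x₁..x₂, e x * v' x := by rw [ibp]; ring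
    rw [this]
    refine (norm_sub_le _ _).trans (add_le_add ?_ hb1)
    refine (norm_sub_le _ _).trans ?_
    refine (add_le_add (hvb x₂ (right_mem_Icc.2 hx)) (hvb x₁ (left_mem_Icc.2 hx))).trans
      (le_of_eq ?_)
    field_simp
    norm_num
  have hb3 : ‖∫ x in x₁..x₂, e x * a x * (μ ^ 2 / (D x ^ 2 + μ ^ 2) : ℝ)‖ ≤
      Q * μ / (2 * ℓ) * (x₂ - x₁) + Q * μ ^ 2 / ℓ * (Real.pi / μ) := by
    calc _ ≤ ∫ x in x₁..x₂, (Q * μ / (2 * ℓ) + Q * μ ^ 2 / ℓ * w x) := by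
          apply intervalIntegral.norm_integral_le_of_norm_le hx _ (hlinI _ _)
          refine Filter.Eventually.of_forall fun x h => ?_
          have h := Ioc_subset_Icc_self h
          rw [norm_mul, norm_mul, hen, one_mul, Complex.norm_real, Real.norm_eq_abs,
            abs_of_nonneg (by positivity)]
          have h1 := haQ x h
          have h2 : 1 ≤ (|D x| + D' x) / ℓ := by
            rw [le_div_iff₀ hℓ, one_mul]
            simpa [abs_of_nonneg (hD0 x h)] using hlow x h
          -- The `|D|` part is bounded pointwise by `2 μ |D| ≤ D² + μ²`; the `D'` part is kept as
          -- `w`, whose integral is at most `π / μ`.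
          have h3 : μ ^ 2 / (D x ^ 2 + μ ^ 2) ≤ μ / (2 * ℓ) + μ ^ 2 / ℓ * w x := by
            have h5 := hGb x
            rw [hG] at h5
            simp only at h5
            rw [abs_div, abs_of_pos (hpos x)] at h5
            have h4 : μ ^ 2 / (D x ^ 2 + μ ^ 2) ≤
                μ ^ 2 / (D x ^ 2 + μ ^ 2) * ((|D x| + D' x) / ℓ) :=
              le_mul_of_one_le_right (by positivity) h2
            refine h4.trans ?_
            have : μ ^ 2 / (D x ^ 2 + μ ^ 2) * ((|D x| + D' x) / ℓ) =
              μ ^ 2 / ℓ * (|D x| / (D x ^ 2 + μ ^ 2)) + μ ^ 2 / ℓ * w x := by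
              simp only [hw]
              ring
            rw [this]
            gcongr
            calc μ ^ 2 / ℓ * (|D x| / (D x ^ 2 + μ ^ 2)) ≤ μ ^ 2 / ℓ * (1 / (2 * μ)) := by gcongr
              _ = μ / (2 * ℓ) := by field_simp
          calc ‖a x‖ * (μ ^ 2 / (D x ^ 2 + μ ^ 2)) ≤ Q * (μ / (2 * ℓ) + μ ^ 2 / ℓ * w x) := by
                gcongr
            _ = _ := by ring
      _ = Q * μ / (2 * ℓ) * (x₂ - x₁) + Q * μ ^ 2 / ℓ * ∫ x in x₁..x₂, w x := hlin _ _
      _ ≤ _ := by gcongr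
  rw [hsplit]
  refine (norm_add_le _ _).trans ?_
  rw [norm_mul, norm_inv, norm_mul, Complex.norm_I, one_mul, Complex.norm_real, Real.norm_eq_abs]
  have hs1 : Real.sqrt (|N| * ℓ) = |N| * μ := by
    rw [Real.sqrt_eq_iff_mul_self_eq (by positivity) (by positivity)]
    have : |N| * μ * (|N| * μ) = |N| ^ 2 * μ ^ 2 := by ring
    rw [this, hμ2]; field_simp
  have hs2 : ℓ = |N| * μ ^ 2 := by rw [hμ2]; field_simp
  calc _ ≤ |N|⁻¹ * (Q / μ + (Q / (2 * μ) * (x₂ - x₁) + Q * (Real.pi / μ))) +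
        (Q * μ / (2 * ℓ) * (x₂ - x₁) + Q * μ ^ 2 / ℓ * (Real.pi / μ)) := by gcongr
    _ = Q * ((x₂ - x₁) + (1 + 2 * Real.pi)) / (|N| * μ) := by
        rw [hs2]; field_simp; ring
    -- The constant `8` is a round bound for `1 + 2 π`.
    _ ≤ Q * (x₂ - x₁ + 8) / (|N| * μ) := by
        gcongr
        linarith [Real.pi_lt_d2]
    _ = _ := by rw [hs1]

/-- A van der Corput estimate. The derivative of the phase is `N D` up to the factor `q / a`, and
`D` and `D'` do not vanish simultaneously. -/
theorem norm_integral_exp_le {x₁ x₂ N ℓ Q : ℝ} (hx : x₁ ≤ x₂) (hN : N ≠ 0)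
    (hℓ : 0 < ℓ) (hQ : 0 ≤ Q) {θ θ' D D' : ℝ → ℝ} {a q q' : ℝ → ℂ}
    (hθ : ∀ x ∈ Icc x₁ x₂, HasDerivAt θ (θ' x) x) (hθ' : ContinuousOn θ' (Icc x₁ x₂))
    (hD : ∀ x ∈ Icc x₁ x₂, HasDerivAt D (D' x) x) (hD' : ContinuousOn D' (Icc x₁ x₂))
    (hD0 : (∀ x ∈ Icc x₁ x₂, 0 ≤ D' x) ∨ (∀ x ∈ Icc x₁ x₂, D' x ≤ 0))
    (hq : ∀ x ∈ Icc x₁ x₂, HasDerivAt q (q' x) x)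
    (hqm : AEStronglyMeasurable q' (volume.restrict (Icc x₁ x₂)))
    (ha : ContinuousOn a (Icc x₁ x₂))
    (hfac : ∀ x ∈ Icc x₁ x₂, (θ' x : ℂ) * q x = N * D x * a x)
    (haQ : ∀ x ∈ Icc x₁ x₂, ‖a x‖ ≤ Q) (hqQ : ∀ x ∈ Icc x₁ x₂, ‖q x‖ ≤ Q)
    (hqQ' : ∀ x ∈ Icc x₁ x₂, ‖q' x‖ ≤ Q)
    (hlow : ∀ x ∈ Icc x₁ x₂, ℓ ≤ |D x| + |D' x|) :
    ‖∫ x in x₁..x₂, Complex.exp (Complex.I * θ x) * a x‖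
      ≤ Q * (x₂ - x₁ + 8) / Real.sqrt (|N| * ℓ) := by
  rcases hD0 with h | h
  · exact norm_integral_exp_le_of_deriv_nonneg hx hN hℓ hQ hθ hθ' hD hD' h hq hqm ha hfac haQ hqQ
      hqQ' hlow
  · rw [← abs_neg N]
    refine norm_integral_exp_le_of_deriv_nonneg (D := fun x => -D x) (D' := fun x => -D' x) hx
      (neg_ne_zero.2 hN) hℓ hQ hθ hθ' (fun x hx => (hD x hx).neg) hD'.neg
      (fun x hx => neg_nonneg.2 (h x hx)) hq hqm ha (fun x hx => ?_) haQ hqQ hqQ'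
      (fun x hx => by simpa using hlow x hx)
    rw [hfac x hx]
    push_cast
    ring

/-! ### The oscillatory integral that represents the first function -/

lemma exists_bound_of_contDiffOn {E F : Type*} [NormedAddCommGroup E] [NormedSpace ℝ E]
    [NormedAddCommGroup F] [NormedSpace ℝ F] {f : E → F} {U K : Set E} (hU : IsOpen U)
    (hf : ContDiffOn ℝ 1 f U) (hK : IsCompact K) (hKU : K ⊆ U) :
    ∃ C : ℝ, 0 ≤ C ∧ ∀ p ∈ K, ‖f p‖ ≤ C ∧ ‖fderiv ℝ f p‖ ≤ C := by
  obtain ⟨C₁, h₁⟩ := hK.exists_bound_of_continuousOn (hf.continuousOn.mono hKU)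
  obtain ⟨C₂, h₂⟩ := hK.exists_bound_of_continuousOn
    ((hf.continuousOn_fderiv_of_isOpen hU le_rfl).mono hKU)
  exact ⟨max 0 (max C₁ C₂), le_max_left _ _, fun p hp =>
    ⟨(h₁ p hp).trans ((le_max_left _ _).trans (le_max_right _ _)),
      (h₂ p hp).trans ((le_max_right _ _).trans (le_max_right _ _))⟩⟩

/-- The polynomial phase, normalised to vanish to second order at `r = ρ`. -/
def monoPhase (n : ℕ) (r ρ : ℝ) : ℝ := n * r ^ (n + 1) - (n + 1) * ρ * r ^ n + ρ ^ (n + 1)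

/-- The amplitude `A(ρ)`. -/
def oscAmp (n : ℕ) (χ : ℝ → ℂ) (r₁ r₂ c ρ : ℝ) : ℂ :=
  ∫ r in r₁..r₂, Complex.exp (Complex.I * (c * monoPhase n r ρ : ℝ)) * (n * r ^ (n - 1) * χ r)

lemma hasDerivAt_monoPhase_left (n : ℕ) (r ρ : ℝ) :
    HasDerivAt (fun r => monoPhase n r ρ) (n * (n + 1) * r ^ (n - 1) * (r - ρ)) r := by
  unfold monoPhase
  have h := (((hasDerivAt_pow (n + 1) r).const_mul (n : ℝ)).sub
    ((hasDerivAt_pow n r).const_mul ((n + 1) * ρ))).add_const (ρ ^ (n + 1))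
  refine h.congr_deriv ?_
  rcases n with _ | n
  · simp
  · simp only [Nat.add_sub_cancel]; push_cast; ring

lemma hasDerivAt_monoPhase_right (n : ℕ) (r ρ : ℝ) :
    HasDerivAt (fun ρ => monoPhase n r ρ) ((n + 1) * (ρ ^ n - r ^ n)) ρ := by
  unfold monoPhase
  have h := (((hasDerivAt_id ρ).const_mul ((n : ℝ) + 1)).mul_const (r ^ n)).const_sub
    (n * r ^ (n + 1)) |>.add (hasDerivAt_pow (n + 1) ρ)
  refine h.congr_deriv ?_
  push_cast
  simp
  ring

lemma continuous_monoPhase (n : ℕ) : Continuous fun p : ℝ × ℝ => monoPhase n p.1 p.2 := by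
  unfold monoPhase; fun_prop

/-- Here `D = r - ρ` has derivative `1`, so van der Corput applies with `ℓ = 1` for every real `ρ`.
The Jacobian `n r ^ (n - 1)` of the amplitude also divides the derivative of the phase, which leaves
`q = χ / (n + 1)`. -/
lemma oscAmp_norm_le {n : ℕ} {χ : ℝ → ℂ} (hχ : ContDiff ℝ ∞ χ) {r₁ r₂ : ℝ} (hr : r₁ ≤ r₂) :
    ∃ K : ℝ, 0 ≤ K ∧ ∀ c : ℝ, c ≠ 0 → ∀ ρ, ‖oscAmp n χ r₁ r₂ c ρ‖ ≤ K / Real.sqrt |c| := by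
  have ha : ContDiff ℝ ∞ fun r : ℝ => (n * (r : ℂ) ^ (n - 1) * χ r : ℂ) := by
    have : ContDiff ℝ ∞ fun r : ℝ => (r : ℂ) := Complex.ofRealCLM.contDiff
    fun_prop
  have hq : ContDiff ℝ ∞ fun r : ℝ => (χ r / (n + 1) : ℂ) := hχ.div_const _
  obtain ⟨C₁, hC₁, h₁⟩ := exists_bound_of_contDiffOn isOpen_univ
    (ha.of_le (by simp)).contDiffOn (isCompact_Icc (a := r₁) (b := r₂)) (subset_univ _)
  obtain ⟨C₂, hC₂, h₂⟩ := exists_bound_of_contDiffOn isOpen_univ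
    (hq.of_le (by simp)).contDiffOn (isCompact_Icc (a := r₁) (b := r₂)) (subset_univ _)
  refine ⟨(C₁ + C₂) * (r₂ - r₁ + 8), by
    have := sub_nonneg.2 hr
    positivity, fun c hc ρ => ?_⟩
  have hpc := continuous_monoPhase n
  have hqd : Differentiable ℝ fun r : ℝ => (χ r / (n + 1) : ℂ) := hq.differentiable (by simp)
  have := norm_integral_exp_le (x₁ := r₁) (x₂ := r₂) (N := c) (ℓ := 1) (Q := C₁ + C₂)
    (θ := fun r => c * monoPhase n r ρ) (θ' := fun r => c * (n * (n + 1) * r ^ (n - 1) * (r - ρ)))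
    (D := fun r => r - ρ) (D' := fun _ => 1) (a := fun r => n * (r : ℂ) ^ (n - 1) * χ r)
    (q := fun r => χ r / (n + 1)) (q' := deriv fun r : ℝ => (χ r / (n + 1) : ℂ)) hr hc one_pos
    (by positivity) (fun r _ => (hasDerivAt_monoPhase_left n r ρ).const_mul c)
    (by fun_prop) (fun r _ => (hasDerivAt_id r).sub_const ρ) continuousOn_const
    (Or.inl fun _ _ => zero_le_one) (fun r _ => (hqd r).hasDerivAt)
    (measurable_deriv _).aestronglyMeasurable
    ha.continuous.continuousOn (fun r _ => ?_)
    (fun r h => (h₁ r h).1.trans (by linarith)) (fun r h => (h₂ r h).1.trans (by linarith))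
    (fun r h => ?_) (fun r _ => by simp)
  · simpa [oscAmp] using this
  · have : (n + 1 : ℂ) ≠ 0 := by exact_mod_cast Nat.succ_ne_zero n
    push_cast
    field_simp
  · rw [norm_deriv_eq_norm_fderiv]
    exact (h₂ r h).2.trans (by linarith)

/-- Without a stationary point one integration by parts gains a full factor `1 / |c|`; the boundary
terms vanish with `χ`. -/
lemma oscAmp_norm_le_of_notMem {n : ℕ} {χ : ℝ → ℂ} (hχ : ContDiff ℝ ∞ χ) {r₁ r₂ : ℝ}
    (h0 : 0 < r₁) (hr : r₁ ≤ r₂) (hχ₁ : χ r₁ = 0) (hχ₂ : χ r₂ = 0) :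
    ∃ K : ℝ, 0 ≤ K ∧ ∀ c : ℝ, c ≠ 0 → ∀ ρ, ρ ∉ Icc (r₁ / 2) (2 * r₂) →
      ‖oscAmp n χ r₁ r₂ c ρ‖ ≤ K / |c| := by
  obtain ⟨C, hC, h₁⟩ := exists_bound_of_contDiffOn isOpen_univ
    (hχ.of_le (by simp)).contDiffOn (isCompact_Icc (a := r₁) (b := r₂)) (subset_univ _)
  -- A lower bound for `|r - ρ|`, valid both for `ρ < r₁ / 2` and for `ρ > 2 r₂`.
  set η := r₁ / 2 with hη
  have hη0 : 0 < η := by positivity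
  have hL : 0 ≤ r₂ - r₁ := sub_nonneg.2 hr
  refine ⟨(C / η + C / η ^ 2) * (r₂ - r₁), by positivity, fun c hc ρ hρ => ?_⟩
  have hsep : ∀ r ∈ Icc r₁ r₂, η ≤ |r - ρ| := fun r h => by
    rw [mem_Icc, not_and_or, not_le, not_le] at hρ
    rw [le_abs]
    rcases hρ with h' | h'
    · left; linarith [h.1]
    · right; linarith [h.2]
  have hne : ∀ r ∈ Icc r₁ r₂, r - ρ ≠ 0 := fun r h => abs_pos.1 (hη0.trans_le (hsep r h))
  have hneC : ∀ r ∈ Icc r₁ r₂, ((r - ρ : ℝ) : ℂ) ≠ 0 := fun r h => by exact_mod_cast hne r h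
  have hn1 : (n + 1 : ℂ) ≠ 0 := by exact_mod_cast Nat.succ_ne_zero n
  have huI : uIcc r₁ r₂ = Icc r₁ r₂ := uIcc_of_le hr
  set e : ℝ → ℂ := fun r => Complex.exp (Complex.I * (c * monoPhase n r ρ : ℝ)) with he
  set p' : ℝ → ℝ := fun r => c * (n * (n + 1) * r ^ (n - 1) * (r - ρ)) with hp'
  set v : ℝ → ℂ := fun r => χ r / ((r - ρ : ℝ) * (n + 1)) with hv
  set v' : ℝ → ℂ := fun r => (deriv χ r * (r - ρ : ℝ) - χ r) / ((r - ρ : ℝ) ^ 2 * (n + 1)) with hv'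
  have hen : ∀ x, ‖e x‖ = 1 := fun x => by
    rw [he]; simp only; rw [mul_comm]; exact Complex.norm_exp_ofReal_mul_I _
  have hed : ∀ r, HasDerivAt e (Complex.I * p' r * e r) r := fun r => by
    have := ((((hasDerivAt_monoPhase_left n r ρ).const_mul c).ofReal_comp).const_mul
      Complex.I).cexp
    refine this.congr_deriv ?_
    simp only [he, hp']; ring
  have hχd : Differentiable ℝ χ := hχ.differentiable (by simp)
  have hχc : Continuous (deriv χ) := hχ.continuous_deriv (by simp)
  have hvd : ∀ r ∈ Icc r₁ r₂, HasDerivAt v (v' r) r := fun r h => by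
    have h1 := (hχd r).hasDerivAt.div ((((hasDerivAt_id r).sub_const ρ).ofReal_comp).mul_const
      (n + 1 : ℂ)) (mul_ne_zero (hneC r h) hn1)
    refine h1.congr_deriv ?_
    have := hneC r h
    simp only [id, hv']
    field_simp
    simp
  have hvc : ContinuousOn v' (Icc r₁ r₂) := by
    have hχ' := hχ.continuous
    refine ContinuousOn.div (Continuous.continuousOn (by fun_prop))
      (Continuous.continuousOn (by fun_prop)) fun r h => ?_
    exact mul_ne_zero (pow_ne_zero _ (hneC r h)) hn1
  have hvb : ∀ r ∈ Icc r₁ r₂, ‖v' r‖ ≤ C / η + C / η ^ 2 := fun r h => by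
    have h2 := hsep r h
    have h3 := (h₁ r h).1
    have h4 := (h₁ r h).2
    rw [← norm_deriv_eq_norm_fderiv] at h4
    have h5 : ‖((n : ℂ) + 1)‖ = n + 1 := by
      rw [← Nat.cast_succ, Complex.norm_natCast]; push_cast; rfl
    have h6 : 0 < |r - ρ| := hη0.trans_le h2
    have h7 : (1 : ℝ) ≤ n + 1 := by linarith [(Nat.cast_nonneg n : (0 : ℝ) ≤ n)]
    simp only [hv']
    rw [norm_div, norm_mul, norm_pow, Complex.norm_real, Real.norm_eq_abs, h5]
    calc _ ≤ (C * |r - ρ| + C) / (|r - ρ| ^ 2 * 1) := by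
          gcongr
          refine (norm_sub_le _ _).trans ?_
          rw [norm_mul, Complex.norm_real, Real.norm_eq_abs]
          gcongr
      _ = C / |r - ρ| + C / |r - ρ| ^ 2 := by field_simp
      _ ≤ _ := by gcongr
  have hei : IntervalIntegrable (fun r => Complex.I * p' r * e r) volume r₁ r₂ := by
    apply Continuous.intervalIntegrable
    have : Continuous e := continuous_iff_continuousAt.2 fun r => (hed r).continuousAt
    simp only [hp']
    fun_prop
  have ibp := intervalIntegral.integral_mul_deriv_eq_deriv_mul (u := e) (v := v)
    (fun r _ => hed r) (by rw [huI]; exact hvd) hei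
    (ContinuousOn.intervalIntegrable (by rw [huI]; exact hvc))
  have hcC : (c : ℂ) ≠ 0 := by exact_mod_cast hc
  have h1 : oscAmp n χ r₁ r₂ c ρ = (Complex.I * c)⁻¹ *
      ∫ r in r₁..r₂, Complex.I * p' r * e r * v r := by
    rw [← intervalIntegral.integral_const_mul]
    apply intervalIntegral.integral_congr
    intro r h
    rw [huI] at h
    have := hneC r h
    simp only [hv, hp', he]
    push_cast at this ⊢
    field_simp
  have h2 : ∫ r in r₁..r₂, Complex.I * p' r * e r * v r = -∫ r in r₁..r₂, e r * v' r := by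
    have hv1 : v r₁ = 0 := by simp [hv, hχ₁]
    have hv2 : v r₂ = 0 := by simp [hv, hχ₂]
    rw [ibp, hv1, hv2]; ring
  rw [h1, h2, norm_mul, norm_neg, norm_inv, norm_mul, Complex.norm_I, one_mul, Complex.norm_real,
    Real.norm_eq_abs, div_eq_inv_mul]
  gcongr
  have := intervalIntegral.norm_integral_le_of_norm_le_const (a := r₁) (b := r₂)
    (f := fun r => e r * v' r) (C := C / η + C / η ^ 2) (fun r h => by
      rw [uIoc_of_le hr] at h
      rw [norm_mul, hen, one_mul]; exact hvb r (Ioc_subset_Icc_self h))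
  rwa [abs_of_nonneg hL] at this

/-- The quotient `(r ^ n - ρ ^ n) / (r - ρ)`. -/
def geomQuot (n : ℕ) (r ρ : ℝ) : ℝ := ∑ i ∈ Finset.range n, r ^ i * ρ ^ (n - 1 - i)

lemma geomQuot_mul (n : ℕ) (r ρ : ℝ) : geomQuot n r ρ * (r - ρ) = r ^ n - ρ ^ n :=
  (Commute.all r ρ).geom_sum₂_mul n

lemma contDiff_geomQuot (n : ℕ) : ContDiff ℝ ∞ fun p : ℝ × ℝ => geomQuot n p.1 p.2 := by
  unfold geomQuot; fun_prop

lemma hasDerivAt_oscAmp_aux (n : ℕ) {χ : ℝ → ℂ} (hχ : ContDiff ℝ ∞ χ) (r₁ r₂ c ρ : ℝ) :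
    HasDerivAt (oscAmp n χ r₁ r₂ c)
      (∫ r in r₁..r₂, Complex.exp (Complex.I * (c * monoPhase n r ρ : ℝ)) *
        (Complex.I * (c * ((n + 1) * (ρ ^ n - r ^ n)) : ℝ)) * (n * r ^ (n - 1) * χ r)) ρ := by
  have hχc := hχ.continuous
  have hpc := continuous_monoPhase n
  set F' : ℝ → ℝ → ℂ := fun ρ r => Complex.exp (Complex.I * (c * monoPhase n r ρ : ℝ)) *
        (Complex.I * (c * ((n + 1) * (ρ ^ n - r ^ n)) : ℝ)) * (n * r ^ (n - 1) * χ r) with hF'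
  have hpc1 : ∀ ρ, Continuous fun r => monoPhase n r ρ := fun ρ =>
    hpc.comp (by fun_prop : Continuous fun r : ℝ => (r, ρ))
  have hcF' : Continuous fun p : ℝ × ℝ => F' p.1 p.2 := by
    have : Continuous fun p : ℝ × ℝ => monoPhase n p.2 p.1 := hpc.comp continuous_swap
    simp only [hF']
    fun_prop
  obtain ⟨B, hB⟩ := (isCompact_Icc (a := ρ - 1) (b := ρ + 1)).prod
    (isCompact_uIcc (a := r₁) (b := r₂)) |>.exists_bound_of_continuousOn hcF'.continuousOn
  refine (intervalIntegral.hasDerivAt_integral_of_dominated_loc_of_deriv_le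
    (F := fun ρ r => Complex.exp (Complex.I * (c * monoPhase n r ρ : ℝ)) * (n * r ^ (n - 1) * χ r))
    (F' := F') (s := Icc (ρ - 1) (ρ + 1)) (bound := fun _ => B)
    (Icc_mem_nhds (by linarith) (by linarith)) ?_ ?_ ?_ ?_ ?_ ?_).2
  · refine Filter.Eventually.of_forall fun ρ => Continuous.aestronglyMeasurable ?_
    have := hpc1 ρ
    fun_prop
  · apply Continuous.intervalIntegrable
    have := hpc1 ρ
    fun_prop
  · exact (hcF'.comp (by fun_prop : Continuous fun r : ℝ => (ρ, r))).aestronglyMeasurable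
  · exact Filter.Eventually.of_forall fun r hr x hx => hB (x, r) ⟨hx, uIoc_subset_uIcc hr⟩
  · simp
  · refine Filter.Eventually.of_forall fun r _ x _ => ?_
    have := (((((hasDerivAt_monoPhase_right n r x).const_mul c).ofReal_comp).const_mul
      Complex.I).cexp).mul_const ((n : ℂ) * r ^ (n - 1) * χ r)
    exact this

lemma differentiable_oscAmp (n : ℕ) {χ : ℝ → ℂ} (hχ : ContDiff ℝ ∞ χ) (r₁ r₂ c : ℝ) :
    Differentiable ℝ (oscAmp n χ r₁ r₂ c) :=
  fun ρ => (hasDerivAt_oscAmp_aux n hχ r₁ r₂ c ρ).differentiableAt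

/-- Differentiation in `ρ` brings down `c (n + 1) (ρ ^ n - r ^ n)`, which is of size `|c|` but
vanishes at `r = ρ` because the critical value has been removed from `monoPhase`. Together with the
Jacobian it is therefore a smooth multiple of the `r`-derivative of the phase. An integration by
parts absorbs the factor `c`, and van der Corput applies to what is left. -/
lemma deriv_oscAmp_norm_le {n : ℕ} (hn : 1 ≤ n) {χ : ℝ → ℂ} (hχ : ContDiff ℝ ∞ χ) {r₁ r₂ : ℝ}
    (h0 : 0 < r₁) (hr : r₁ ≤ r₂) (hχ₁ : χ r₁ = 0) (hχ₂ : χ r₂ = 0) (R₁ R₂ : ℝ) :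
    ∃ K : ℝ, 0 ≤ K ∧ ∀ c : ℝ, c ≠ 0 → ∀ ρ ∈ Icc R₁ R₂,
      ‖deriv (oscAmp n χ r₁ r₂ c) ρ‖ ≤ K / Real.sqrt |c| := by
  have huI : uIcc r₁ r₂ = Icc r₁ r₂ := uIcc_of_le hr
  have hχd : Differentiable ℝ χ := hχ.differentiable (by simp)
  have hn0 : (n : ℂ) ≠ 0 := by exact_mod_cast (by omega : n ≠ 0)
  have hn1 : (n + 1 : ℂ) ≠ 0 := by exact_mod_cast Nat.succ_ne_zero n
  -- the derivative in `r` of `S(r, ρ) χ(r)`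
  set f : ℝ × ℝ → ℂ := fun p => geomQuot n p.1 p.2 * χ p.1 with hf
  have hfs : ContDiff ℝ ∞ f := by
    have : ContDiff ℝ ∞ fun p : ℝ × ℝ => (geomQuot n p.1 p.2 : ℂ) :=
      Complex.ofRealCLM.contDiff.comp (contDiff_geomQuot n)
    exact this.mul (hχ.comp contDiff_fst)
  set g : ℝ × ℝ → ℂ := fun p => fderiv ℝ f p (1, 0) with hg
  have hgs : ContDiff ℝ ∞ g := (hfs.fderiv_right (m := ∞) (by simp)).clm_apply contDiff_const
  have hfg : ∀ r ρ, HasDerivAt (fun r => f (r, ρ)) (g (r, ρ)) r := fun r ρ =>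
    ((hfs.differentiable (by simp)) (r, ρ)).hasFDerivAt.comp_hasDerivAt (f := fun r : ℝ => (r, ρ)) r
      ((hasDerivAt_id r).prodMk (hasDerivAt_const r ρ))
  -- The new amplitude no longer contains the Jacobian, so it is divided out here; this is where `r
  -- > 0` is needed.
  set h : ℝ × ℝ → ℂ := fun p => g p / (n * (n + 1) * (p.1 : ℂ) ^ (n - 1)) with hh
  have hhs : ContDiffOn ℝ 1 h {p | 0 < p.1} := by
    have h1 : ContDiff ℝ 1 fun p : ℝ × ℝ => (p.1 : ℂ) :=
      Complex.ofRealCLM.contDiff.comp contDiff_fst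
    have hg1 : ContDiff ℝ 1 g := hgs.of_le (by simp)
    simp only [hh, div_eq_mul_inv]
    refine hg1.contDiffOn.mul (ContDiffOn.inv ?_ fun p hp => ?_)
    · exact (contDiff_const.mul (h1.pow _)).contDiffOn
    · exact mul_ne_zero (mul_ne_zero hn0 hn1)
        (pow_ne_zero _ (by exact_mod_cast (ne_of_gt hp : (p.1 : ℝ) ≠ 0)))
  have hUo : IsOpen {p : ℝ × ℝ | 0 < p.1} := isOpen_lt continuous_const continuous_fst
  have hKU : Icc r₁ r₂ ×ˢ Icc R₁ R₂ ⊆ {p : ℝ × ℝ | 0 < p.1} := fun p hp => h0.trans_le hp.1.1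
  have hK : IsCompact (Icc r₁ r₂ ×ˢ Icc R₁ R₂) := isCompact_Icc.prod isCompact_Icc
  obtain ⟨C₁, hC₁, h₁⟩ := exists_bound_of_contDiffOn isOpen_univ
    (hgs.of_le (by simp)).contDiffOn hK (subset_univ _)
  obtain ⟨C₂, hC₂, h₂⟩ := exists_bound_of_contDiffOn hUo hhs hK hKU
  refine ⟨(C₁ + C₂) * (r₂ - r₁ + 8), by
    have := sub_nonneg.2 hr
    positivity, fun c hc ρ hρ => ?_⟩
  set e : ℝ → ℂ := fun r => Complex.exp (Complex.I * (c * monoPhase n r ρ : ℝ)) with he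
  set p' : ℝ → ℝ := fun r => c * (n * (n + 1) * r ^ (n - 1) * (r - ρ)) with hp'
  have hed : ∀ r, HasDerivAt e (Complex.I * p' r * e r) r := fun r => by
    have := ((((hasDerivAt_monoPhase_left n r ρ).const_mul c).ofReal_comp).const_mul
      Complex.I).cexp
    refine this.congr_deriv ?_
    simp only [he, hp']; ring
  have hec : Continuous e := continuous_iff_continuousAt.2 fun r => (hed r).continuousAt
  have hgc : Continuous fun r => g (r, ρ) := hgs.continuous.comp (by fun_prop)
  have ibp := intervalIntegral.integral_mul_deriv_eq_deriv_mul (u := e) (v := fun r => f (r, ρ))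
    (a := r₁) (b := r₂) (fun r _ => hed r) (fun r _ => hfg r ρ)
    (Continuous.intervalIntegrable (by simp only [hp']; fun_prop) _ _)
    (hgc.intervalIntegrable _ _)
  have hA : deriv (oscAmp n χ r₁ r₂ c) ρ = ∫ r in r₁..r₂, e r * g (r, ρ) := by
    rw [(hasDerivAt_oscAmp_aux n hχ r₁ r₂ c ρ).deriv, ibp]
    have hv1 : f (r₁, ρ) = 0 := by simp [hf, hχ₁]
    have hv2 : f (r₂, ρ) = 0 := by simp [hf, hχ₂]
    rw [hv1, hv2, mul_zero, mul_zero, sub_zero, zero_sub, ← intervalIntegral.integral_neg]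
    apply intervalIntegral.integral_congr
    intro r _
    have hS : ((geomQuot n r ρ : ℝ) : ℂ) * (r - ρ) = r ^ n - ρ ^ n := by
      exact_mod_cast congrArg (fun x : ℝ => (x : ℂ)) (geomQuot_mul n r ρ)
    simp only [hp', hf, he]
    push_cast
    linear_combination (Complex.exp (Complex.I * (c * (monoPhase n r ρ : ℂ))) * Complex.I * c *
      n * (n + 1) * (r : ℂ) ^ (n - 1) * χ r) * hS
  rw [hA]
  have hd : ∀ r ∈ Icc r₁ r₂, HasDerivAt (fun r => h (r, ρ)) (fderiv ℝ h (r, ρ) (1, 0)) r :=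
    fun r hr' =>
      ((hhs.differentiableOn (by simp)).differentiableAt (hUo.mem_nhds
        (hKU (mk_mem_prod hr' hρ)))).hasFDerivAt.comp_hasDerivAt (f := fun r : ℝ => (r, ρ)) r
      ((hasDerivAt_id r).prodMk (hasDerivAt_const r ρ))
  have := norm_integral_exp_le (x₁ := r₁) (x₂ := r₂) (N := c) (ℓ := 1) (Q := C₁ + C₂)
    (θ := fun r => c * monoPhase n r ρ) (θ' := p')
    (D := fun r => r - ρ) (D' := fun _ => 1) (a := fun r => g (r, ρ))
    (q := fun r => h (r, ρ)) (q' := fun r => fderiv ℝ h (r, ρ) (1, 0)) hr hc one_pos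
    (by positivity) (fun r _ => (hasDerivAt_monoPhase_left n r ρ).const_mul c)
    (by simp only [hp']; fun_prop) (fun r _ => (hasDerivAt_id r).sub_const ρ) continuousOn_const
    (Or.inl fun _ _ => zero_le_one) hd
    (((measurable_fderiv_apply_const ℝ h (1, 0)).comp
      (by fun_prop : Measurable fun r : ℝ => (r, ρ))).aestronglyMeasurable)
    hgc.continuousOn (fun r hr' => ?_)
    (fun r hr' => (h₁ _ (mk_mem_prod hr' hρ)).1.trans (by linarith))
    (fun r hr' => (h₂ _ (mk_mem_prod hr' hρ)).1.trans (by linarith))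
    (fun r hr' => ?_) (fun r _ => by simp)
  · simpa [he] using this
  · have h3 : (r : ℂ) ≠ 0 := by exact_mod_cast (h0.trans_le hr'.1).ne'
    simp only [hh, hp']
    push_cast
    field_simp
  · refine (ContinuousLinearMap.le_opNorm _ _).trans ?_
    have h5 : ‖((1 : ℝ), (0 : ℝ))‖ = 1 := by simp
    rw [h5, mul_one]
    exact (h₂ _ (mk_mem_prod hr' hρ)).2.trans (by linarith)

/-! ### Oscillation of the kernel of `T T*` -/

lemma geomQuot_pos {n : ℕ} (hn : 1 ≤ n) {r ρ : ℝ} (hr : 0 < r) (hρ : 0 < ρ) :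
    0 < geomQuot n r ρ :=
  Finset.sum_pos (fun i _ => by positivity) ⟨0, Finset.mem_range.2 hn⟩

/-- The factor that turns the derivative of the phase into the amplitude. -/
def phaseQuot (n : ℕ) (b : ℝ → ℝ) (y : ℝ × ℝ × ℝ × ℝ) : ℝ :=
  b y.1 * b y.2.1 * (y.1 * y.2.1 * geomQuot (n + 1) y.2.1 y.1) *
    (geomQuot n (y.2.2.1 / y.1) (y.2.2.2 / y.2.1))⁻¹

/-- The open positive orthant. -/
def orthant : Set (ℝ × ℝ × ℝ × ℝ) := {y | 0 < y.1 ∧ 0 < y.2.1 ∧ 0 < y.2.2.1 ∧ 0 < y.2.2.2}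

lemma isOpen_orthant : IsOpen orthant := by
  unfold orthant
  have h : ∀ {f : ℝ × ℝ × ℝ × ℝ → ℝ}, Continuous f → IsOpen {y | 0 < f y} :=
    fun hf => isOpen_lt continuous_const hf
  exact (h (by fun_prop)).inter ((h (by fun_prop)).inter ((h (by fun_prop)).inter
    (h (by fun_prop))))

lemma contDiffOn_phaseQuot {n : ℕ} (hn : 1 ≤ n) {b : ℝ → ℝ} (hb : ContDiffOn ℝ 1 b (Ioi 0)) :
    ContDiffOn ℝ 1 (phaseQuot n b) orthant := by
  have h1 : ContDiffOn ℝ 1 (fun y : ℝ × ℝ × ℝ × ℝ => y.1) orthant := contDiff_fst.contDiffOn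
  have h2 : ContDiffOn ℝ 1 (fun y : ℝ × ℝ × ℝ × ℝ => y.2.1) orthant :=
    ContDiff.contDiffOn (by fun_prop)
  have h3 : ContDiffOn ℝ 1 (fun y : ℝ × ℝ × ℝ × ℝ => y.2.2.1) orthant :=
    ContDiff.contDiffOn (by fun_prop)
  have h4 : ContDiffOn ℝ 1 (fun y : ℝ × ℝ × ℝ × ℝ => y.2.2.2) orthant :=
    ContDiff.contDiffOn (by fun_prop)
  have hg : ∀ k, ContDiff ℝ 1 fun p : ℝ × ℝ => geomQuot k p.1 p.2 := fun k =>
    (contDiff_geomQuot k).of_le (by simp)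
  have hb1 : ContDiffOn ℝ 1 (fun y : ℝ × ℝ × ℝ × ℝ => b y.1) orthant :=
    hb.comp h1 fun y hy => hy.1
  have hb2 : ContDiffOn ℝ 1 (fun y : ℝ × ℝ × ℝ × ℝ => b y.2.1) orthant :=
    hb.comp h2 fun y hy => hy.2.1
  have hS : ContDiffOn ℝ 1 (fun y : ℝ × ℝ × ℝ × ℝ => geomQuot (n + 1) y.2.1 y.1) orthant :=
    (hg (n + 1)).comp_contDiffOn (h2.prodMk h1)
  have hR : ContDiffOn ℝ 1 (fun y : ℝ × ℝ × ℝ × ℝ =>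
      geomQuot n (y.2.2.1 / y.1) (y.2.2.2 / y.2.1)) orthant :=
    (hg n).comp_contDiffOn ((h3.div h1 fun y hy => hy.1.ne').prodMk
      (h4.div h2 fun y hy => hy.2.1.ne'))
  exact ((hb1.mul hb2).mul ((h1.mul h2).mul hS)).mul (hR.inv fun y hy =>
    (geomQuot_pos hn (div_pos hy.2.2.1 hy.1) (div_pos hy.2.2.2 hy.2.1)).ne')

/-- Along `s' = -1 / ((n + 1) s ^ n)` the derivative of `p ^ (n + 1)` is `-κ (p / s) ^ n`, so the
difference on the left is the phase derivative up to a constant. Factoring a difference of `n`-th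
powers leaves `p / s - p' / t`, whose numerator involves only `δ w s` and `α (t - s)`; since `t - s`
is `w` over a sum of monomials, `w` factors out. -/
lemma deriv_phase_factor {n : ℕ} {s t κ α δ w p p' : ℝ} (hs : 0 < s) (ht : 0 < t)
    (hw : t ^ (n + 1) - s ^ (n + 1) = w) (hp : p = κ * (s - α))
    (hp' : p' = κ * (t - (α + δ * w))) :
    ((p / s) ^ n - (p' / t) ^ n) * (s * t * geomQuot (n + 1) t s) =
      κ * w * (δ * (s * geomQuot (n + 1) t s) - α) * geomQuot n (p / s) (p' / t) := by
  have h1 := geomQuot_mul n (p / s) (p' / t)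
  have h2 := geomQuot_mul (n + 1) t s
  rw [hw] at h2
  have h3 : (p / s - p' / t) * (s * t) = κ * (δ * w * s - α * (t - s)) := by
    rw [hp, hp']; field_simp; ring
  rw [← h1]
  linear_combination (geomQuot n (p / s) (p' / t) * geomQuot (n + 1) t s) * h3 -
    geomQuot n (p / s) (p' / t) * κ * α * h2

/-- The sum `s (t^n + t^{n-1} s + ... + s^n)`. -/
lemma mul_geomQuot_eq (n : ℕ) (s t : ℝ) :
    s * geomQuot (n + 1) t s = ∑ i ∈ Finset.range (n + 1), t ^ i * s ^ (n + 1 - i) := by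
  rw [geomQuot, Finset.mul_sum]
  refine Finset.sum_congr rfl fun i hi => ?_
  have : n + 1 - i = (n + 1 - 1 - i) + 1 := by have := Finset.mem_range.1 hi; omega
  rw [this, pow_succ]; ring

lemma mul_geomQuot_le {n : ℕ} {s t : ℝ} (hs : s ∈ Icc (1 / 2 : ℝ) 2) (ht : t ∈ Icc (1 / 2 : ℝ) 2) :
    |s * geomQuot (n + 1) t s| ≤ (n + 1) * 2 ^ (n + 1) := by
  have hs0 : 0 < s := by linarith [hs.1]
  have ht0 : 0 < t := by linarith [ht.1]
  rw [abs_of_pos (mul_pos hs0 (geomQuot_pos (by omega) ht0 hs0)), mul_geomQuot_eq]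
  calc _ ≤ ∑ i ∈ Finset.range (n + 1), (2 : ℝ) ^ (n + 1) := by
        refine Finset.sum_le_sum fun i hi => ?_
        have h1 : t ^ i ≤ 2 ^ i := pow_le_pow_left₀ ht0.le ht.2 _
        have h2 : s ^ (n + 1 - i) ≤ 2 ^ (n + 1 - i) := pow_le_pow_left₀ hs0.le hs.2 _
        calc _ ≤ (2 : ℝ) ^ i * 2 ^ (n + 1 - i) := by gcongr
          _ = 2 ^ (n + 1) := by
            rw [← pow_add]; congr 1; have := Finset.mem_range.1 hi; omega
    _ = _ := by simp

/-- The expanded sum consists of monomials in the decreasing positive functions `s` and `t`, so no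
term increases. The term `i = 0` is `s ^ (n + 1)`, whose derivative is exactly `-1`. -/
lemma exists_hasDerivAt_mul_geomQuot {n : ℕ} {x₁ x₂ : ℝ} {s t : ℝ → ℝ}
    (hs : ∀ x ∈ Icc x₁ x₂, HasDerivAt s (-(1 / ((n + 1) * s x ^ n))) x)
    (ht : ∀ x ∈ Icc x₁ x₂, HasDerivAt t (-(1 / ((n + 1) * t x ^ n))) x)
    (hs0 : ∀ x ∈ Icc x₁ x₂, 0 < s x) (ht0 : ∀ x ∈ Icc x₁ x₂, 0 < t x) :
    ∃ m : ℝ → ℝ, ContinuousOn m (Icc x₁ x₂) ∧ (∀ x ∈ Icc x₁ x₂, m x ≤ -1) ∧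
      ∀ x ∈ Icc x₁ x₂, HasDerivAt (fun x => s x * geomQuot (n + 1) (t x) (s x)) (m x) x := by
  have hsc : ContinuousOn s (Icc x₁ x₂) := fun x h => (hs x h).continuousAt.continuousWithinAt
  have htc : ContinuousOn t (Icc x₁ x₂) := fun x h => (ht x h).continuousAt.continuousWithinAt
  have hn1 : (0 : ℝ) < n + 1 := by positivity
  have hinv : ∀ {f : ℝ → ℝ}, ContinuousOn f (Icc x₁ x₂) → (∀ x ∈ Icc x₁ x₂, 0 < f x) →
      ContinuousOn (fun x => -(1 / ((n + 1) * f x ^ n))) (Icc x₁ x₂) := fun hf hf0 =>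
    (continuousOn_const.div (continuousOn_const.mul (hf.pow n)) fun x hx =>
      mul_ne_zero hn1.ne' (pow_ne_zero _ (hf0 x hx).ne')).neg
  refine ⟨fun x => ∑ i ∈ Finset.range (n + 1),
    ((i * t x ^ (i - 1) * -(1 / ((n + 1) * t x ^ n))) * s x ^ (n + 1 - i) +
      t x ^ i * ((n + 1 - i : ℕ) * s x ^ (n + 1 - i - 1) * -(1 / ((n + 1) * s x ^ n)))),
    ?_, fun x hx => ?_, fun x hx => ?_⟩
  · refine continuousOn_finsetSum _ fun i _ => ?_
    exact (((continuousOn_const.mul (htc.pow _)).mul (hinv htc ht0)).mul (hsc.pow _)).add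
      ((htc.pow _).mul ((continuousOn_const.mul (hsc.pow _)).mul (hinv hsc hs0)))
  · have h1 := hs0 x hx
    have h2 := ht0 x hx
    beta_reduce
    rw [Finset.sum_range_succ']
    have h3 : ∀ i ∈ Finset.range n, (((i + 1 : ℕ) * t x ^ (i + 1 - 1) *
        -(1 / ((n + 1) * t x ^ n))) * s x ^ (n + 1 - (i + 1)) + t x ^ (i + 1) *
        ((n + 1 - (i + 1) : ℕ) * s x ^ (n + 1 - (i + 1) - 1) * -(1 / ((n + 1) * s x ^ n)))) ≤ 0 :=
      fun i _ => by
        rw [mul_neg, mul_neg, mul_neg, neg_mul, ← neg_add]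
        exact neg_nonpos.2 (by positivity)
    refine (add_le_add_left (Finset.sum_nonpos h3) _).trans (le_of_eq ?_)
    push_cast
    simp
    field_simp
  · simp only [mul_geomQuot_eq]
    exact HasDerivAt.fun_sum fun i _ => ((ht x hx).fun_pow i).mul ((hs x hx).fun_pow (n + 1 - i))

/-- Decay of the kernel of `T T*` on the region where the stationary points are admissible. -/
theorem exists_kernel_bound {n : ℕ} (hn : 1 ≤ n) {b : ℝ → ℝ} (hb : ContDiffOn ℝ 1 b (Ioi 0))
    {R₁ : ℝ} (hR₁ : 0 < R₁) (R₂ κ₀ : ℝ) (hκ₀ : 0 ≤ κ₀) :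
    ∃ K : ℝ, 0 ≤ K ∧ ∀ {x₁ x₂ κ c α δ w B : ℝ} {A₁ A₂ : ℝ → ℂ} {s t : ℝ → ℝ}, x₁ ≤ x₂ →
      κ ≠ 0 → |κ| ≤ κ₀ → c ≠ 0 → α ≠ 0 → w ≠ 0 → 0 ≤ B →
      Differentiable ℝ A₁ → Differentiable ℝ A₂ →
      (∀ p ∈ Icc R₁ R₂, ‖A₁ p‖ ≤ B ∧ ‖deriv A₁ p‖ ≤ B) →
      (∀ p ∈ Icc R₁ R₂, ‖A₂ p‖ ≤ B ∧ ‖deriv A₂ p‖ ≤ B) →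
      (∀ x ∈ Icc x₁ x₂, HasDerivAt s (-(1 / ((n + 1) * s x ^ n))) x) →
      (∀ x ∈ Icc x₁ x₂, HasDerivAt t (-(1 / ((n + 1) * t x ^ n))) x) →
      (∀ x ∈ Icc x₁ x₂, s x ∈ Icc (1 / 2 : ℝ) 2) → (∀ x ∈ Icc x₁ x₂, t x ∈ Icc (1 / 2 : ℝ) 2) →
      (∀ x ∈ Icc x₁ x₂, t x ^ (n + 1) - s x ^ (n + 1) = w) →
      (∀ x ∈ Icc x₁ x₂, κ * (s x - α) ∈ Icc R₁ R₂) →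
      (∀ x ∈ Icc x₁ x₂, κ * (t x - (α + δ * w)) ∈ Icc R₁ R₂) →
      ‖∫ x in x₁..x₂, Complex.exp (Complex.I * (-c * ((κ * (s x - α)) ^ (n + 1) -
          (κ * (t x - (α + δ * w))) ^ (n + 1)) : ℝ)) *
          (A₁ (κ * (s x - α)) * A₂ (κ * (t x - (α + δ * w))) * (b (s x) * b (t x) : ℝ))‖
        ≤ K * B ^ 2 * (x₂ - x₁ + 8) / Real.sqrt (|c * κ ^ 2 * w| * |α|) := by
  -- As `R₁ > 0`, this box lies in the region where `phaseQuot` is `C¹`, so its bounds there are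
  -- independent of all the parameters.
  have hK : IsCompact (Icc (1 / 2 : ℝ) 2 ×ˢ Icc (1 / 2 : ℝ) 2 ×ˢ Icc R₁ R₂ ×ˢ Icc R₁ R₂) :=
    isCompact_Icc.prod (isCompact_Icc.prod (isCompact_Icc.prod isCompact_Icc))
  have hKU : Icc (1 / 2 : ℝ) 2 ×ˢ Icc (1 / 2 : ℝ) 2 ×ˢ Icc R₁ R₂ ×ˢ Icc R₁ R₂ ⊆ orthant :=
    fun y hy => ⟨by linarith [hy.1.1], by linarith [hy.2.1.1], by linarith [hy.2.2.1.1],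
      by linarith [hy.2.2.2.1]⟩
  have hPd := contDiffOn_phaseQuot hn hb
  obtain ⟨C₁, hC₁, h₁⟩ := exists_bound_of_contDiffOn isOpen_orthant hPd hK hKU
  have hbK : ContinuousOn b (Icc (1 / 2 : ℝ) 2) :=
    hb.continuousOn.mono fun x hx => (by linarith [hx.1] : (0 : ℝ) < x)
  obtain ⟨C₀, hC₀⟩ := isCompact_Icc.exists_bound_of_continuousOn hbK
  have hC₀0 : 0 ≤ C₀ := (norm_nonneg _).trans (hC₀ 1 ⟨by norm_num, by norm_num⟩)
  -- A common bound for the derivatives of `s`, `t` (at most `2 ^ n`) and of `p`, `p'` (at most `κ₀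
  -- 2 ^ n`).
  set Γ : ℝ := 2 ^ n * (1 + κ₀) with hΓ
  have hΓ0 : 0 ≤ Γ := by positivity
  set C₂ : ℝ := (n + 1) * 2 ^ (n + 1) with hC₂
  have hC₂1 : 1 ≤ C₂ := by
    have h1 : (1 : ℝ) ≤ n + 1 := by linarith [(Nat.cast_nonneg n : (0 : ℝ) ≤ n)]
    exact one_le_mul_of_one_le_of_one_le h1 (one_le_pow₀ (by norm_num))
  have hC₂0 : 0 < C₂ := by linarith
  refine ⟨(C₀ ^ 2 + C₁ * (1 + 3 * Γ)) * Real.sqrt C₂, by positivity, ?_⟩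
  intro x₁ x₂ κ c α δ w B A₁ A₂ s t hx hκ hκκ hc hα hw hB hA₁ hA₂ hAb₁ hAb₂ hs ht hsI htI hst
    hpI hpI'
  have hs0 : ∀ x ∈ Icc x₁ x₂, 0 < s x := fun x h => by linarith [(hsI x h).1]
  have ht0 : ∀ x ∈ Icc x₁ x₂, 0 < t x := fun x h => by linarith [(htI x h).1]
  obtain ⟨m, hmc, hm1, hmd⟩ := exists_hasDerivAt_mul_geomQuot hs ht hs0 ht0
  set p : ℝ → ℝ := fun x => κ * (s x - α) with hp
  set p' : ℝ → ℝ := fun x => κ * (t x - (α + δ * w)) with hp'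
  set sd : ℝ → ℝ := fun x => -(1 / ((n + 1) * s x ^ n)) with hsd
  set td : ℝ → ℝ := fun x => -(1 / ((n + 1) * t x ^ n)) with htd
  have hpd : ∀ x ∈ Icc x₁ x₂, HasDerivAt p (κ * sd x) x := fun x h =>
    ((hs x h).sub_const α).const_mul κ
  have hpd' : ∀ x ∈ Icc x₁ x₂, HasDerivAt p' (κ * td x) x := fun x h =>
    ((ht x h).sub_const _).const_mul κ
  have hsc : ContinuousOn s (Icc x₁ x₂) := fun x h => (hs x h).continuousAt.continuousWithinAt
  have htc : ContinuousOn t (Icc x₁ x₂) := fun x h => (ht x h).continuousAt.continuousWithinAt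
  have hpc : ContinuousOn p (Icc x₁ x₂) := fun x h => (hpd x h).continuousAt.continuousWithinAt
  have hpc' : ContinuousOn p' (Icc x₁ x₂) := fun x h => (hpd' x h).continuousAt.continuousWithinAt
  have hrd : ∀ {r : ℝ}, r ∈ Icc (1 / 2 : ℝ) 2 → |-(1 / ((n + 1) * r ^ n))| ≤ 2 ^ n := by
    intro r hr
    have h0 : 0 < r := by linarith [hr.1]
    rw [abs_neg, abs_of_pos (by positivity), div_le_iff₀ (by positivity)]
    have h1 : (1 : ℝ) ≤ n + 1 := by linarith [(Nat.cast_nonneg n : (0 : ℝ) ≤ n)]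
    have h2 : 1 ≤ (2 * r) ^ n := one_le_pow₀ (by linarith [hr.1])
    calc (1 : ℝ) ≤ (n + 1) * (2 * r) ^ n := one_le_mul_of_one_le_of_one_le h1 h2
      _ = _ := by rw [mul_pow]; ring
  have hsdb : ∀ x ∈ Icc x₁ x₂, |sd x| ≤ Γ := fun x h => (hrd (hsI x h)).trans (by
    rw [hΓ]; nlinarith [pow_pos (two_pos : (0 : ℝ) < 2) n])
  have htdb : ∀ x ∈ Icc x₁ x₂, |td x| ≤ Γ := fun x h => (hrd (htI x h)).trans (by
    rw [hΓ]; nlinarith [pow_pos (two_pos : (0 : ℝ) < 2) n])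
  have hκΓ : ∀ {y : ℝ}, |y| ≤ 2 ^ n → |κ * y| ≤ Γ := fun {y} hy => by
    rw [abs_mul, hΓ]
    calc |κ| * |y| ≤ κ₀ * 2 ^ n := by gcongr
      _ ≤ _ := by nlinarith [pow_pos (two_pos : (0 : ℝ) < 2) n]
  have hpdb : ∀ x ∈ Icc x₁ x₂, |κ * sd x| ≤ Γ := fun x h => hκΓ (hrd (hsI x h))
  have hpdb' : ∀ x ∈ Icc x₁ x₂, |κ * td x| ≤ Γ := fun x h => hκΓ (hrd (htI x h))
  set y : ℝ → ℝ × ℝ × ℝ × ℝ := fun x => (s x, t x, p x, p' x) with hy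
  have hyK : ∀ x ∈ Icc x₁ x₂, y x ∈ Icc (1 / 2 : ℝ) 2 ×ˢ Icc (1 / 2 : ℝ) 2 ×ˢ Icc R₁ R₂ ×ˢ
      Icc R₁ R₂ := fun x h => ⟨hsI x h, htI x h, hpI x h, hpI' x h⟩
  set yd : ℝ → ℝ × ℝ × ℝ × ℝ := fun x => (sd x, td x, κ * sd x, κ * td x) with hyd
  have hyder : ∀ x ∈ Icc x₁ x₂, HasDerivAt y (yd x) x := fun x h =>
    (hs x h).prodMk ((ht x h).prodMk ((hpd x h).prodMk (hpd' x h)))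
  have hydb : ∀ x ∈ Icc x₁ x₂, ‖yd x‖ ≤ Γ := fun x h => by
    simp only [hyd, Prod.norm_def, Real.norm_eq_abs]
    exact max_le (hsdb x h) (max_le (htdb x h) (max_le (hpdb x h) (hpdb' x h)))
  set P : ℝ → ℝ := fun x => phaseQuot n b (y x) with hP
  set Pd : ℝ → ℝ := fun x => fderiv ℝ (phaseQuot n b) (y x) (yd x) with hPdd
  have hPder : ∀ x ∈ Icc x₁ x₂, HasDerivAt P (Pd x) x := fun x h =>
    ((hPd.differentiableOn (by simp)).differentiableAt
      (isOpen_orthant.mem_nhds (hKU (hyK x h)))).hasFDerivAt.comp_hasDerivAt x (hyder x h)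
  have hPb : ∀ x ∈ Icc x₁ x₂, |P x| ≤ C₁ := fun x h => (h₁ _ (hyK x h)).1
  have hPdb : ∀ x ∈ Icc x₁ x₂, |Pd x| ≤ C₁ * Γ := fun x h =>
    (ContinuousLinearMap.le_opNorm _ _).trans
      (mul_le_mul (h₁ _ (hyK x h)).2 (hydb x h) (norm_nonneg _) hC₁)
  set q : ℝ → ℂ := fun x => A₁ (p x) * A₂ (p' x) * (P x : ℝ) with hq
  set qd : ℝ → ℂ := fun x => ((κ * sd x) • deriv A₁ (p x) * A₂ (p' x) +
    A₁ (p x) * ((κ * td x) • deriv A₂ (p' x))) * (P x : ℝ) + A₁ (p x) * A₂ (p' x) * (Pd x : ℝ)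
    with hqd
  have hqder : ∀ x ∈ Icc x₁ x₂, HasDerivAt q (qd x) x := fun x h =>
    (((hA₁ (p x)).hasDerivAt.scomp x (hpd x h)).mul
      ((hA₂ (p' x)).hasDerivAt.scomp x (hpd' x h))).mul (hPder x h).ofReal_comp
  have hqdb : ∀ x ∈ Icc x₁ x₂, ‖qd x‖ ≤ B ^ 2 * (C₁ * (3 * Γ)) := fun x h => by
    obtain ⟨e1, e2⟩ := hAb₁ (p x) (hpI x h)
    obtain ⟨e3, e4⟩ := hAb₂ (p' x) (hpI' x h)
    have e5 := hPb x h
    have e6 := hPdb x h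
    have e7 := hpdb x h
    have e8 := hpdb' x h
    calc ‖qd x‖ ≤ (Γ * B * B + B * (Γ * B)) * C₁ + B * B * (C₁ * Γ) := by
          simp only [hqd]
          refine (norm_add_le _ _).trans ?_
          rw [norm_mul, norm_mul, norm_mul, Complex.norm_real, Complex.norm_real,
            Real.norm_eq_abs, Real.norm_eq_abs]
          have : ‖(κ * sd x) • deriv A₁ (p x) * A₂ (p' x) +
              A₁ (p x) * ((κ * td x) • deriv A₂ (p' x))‖ ≤ Γ * B * B + B * (Γ * B) := by
            refine (norm_add_le _ _).trans ?_
            rw [norm_mul, norm_mul, norm_smul, norm_smul, Real.norm_eq_abs, Real.norm_eq_abs]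
            gcongr
          gcongr
      _ = _ := by ring
  have hθd : ∀ x ∈ Icc x₁ x₂, HasDerivAt (fun x => -c * (p x ^ (n + 1) - p' x ^ (n + 1)))
      (c * κ * ((p x / s x) ^ n - (p' x / t x) ^ n)) x := fun x h => by
    have e1 := ((hpd x h).fun_pow (n + 1)).sub ((hpd' x h).fun_pow (n + 1)) |>.const_mul (-c)
    refine e1.congr_deriv ?_
    have e2 := hs0 x h
    have e3 := ht0 x h
    simp only [hsd, htd, Nat.add_sub_cancel, div_pow]
    push_cast
    field_simp
    ring
  -- `N` and `D` are read off from `deriv_phase_factor`. Whatever the sign of `δ`, `D' = δ m` has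
  -- constant sign because `m ≤ -1`.
  have key := norm_integral_exp_le (x₁ := x₁) (x₂ := x₂) (N := c * κ ^ 2 * w) (ℓ := |α| / C₂)
    (Q := B ^ 2 * (C₀ ^ 2 + C₁ * (1 + 3 * Γ)))
    (θ := fun x => -c * (p x ^ (n + 1) - p' x ^ (n + 1)))
    (θ' := fun x => c * κ * ((p x / s x) ^ n - (p' x / t x) ^ n))
    (D := fun x => δ * (s x * geomQuot (n + 1) (t x) (s x)) - α) (D' := fun x => δ * m x)
    (a := fun x => A₁ (p x) * A₂ (p' x) * (b (s x) * b (t x) : ℝ))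
    (q := q) (q' := deriv q) hx (mul_ne_zero (mul_ne_zero hc (pow_ne_zero _ hκ)) hw)
    (div_pos (abs_pos.2 hα) hC₂0) (by positivity) hθd
    (continuousOn_const.mul (((hpc.div hsc fun x h => (hs0 x h).ne').pow n).sub
      ((hpc'.div htc fun x h => (ht0 x h).ne').pow n)))
    (fun x h => ((hmd x h).const_mul δ).sub_const α) (continuousOn_const.mul hmc)
    (by
      rcases le_total 0 δ with h | h
      · exact Or.inr fun x hx => mul_nonpos_of_nonneg_of_nonpos h (by linarith [hm1 x hx])
      · exact Or.inl fun x hx => mul_nonneg_of_nonpos_of_nonpos h (by linarith [hm1 x hx]))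
    (fun x h => (hqder x h).differentiableAt.hasDerivAt)
    (measurable_deriv q).aestronglyMeasurable
    (((hA₁.continuous.comp_continuousOn hpc).mul (hA₂.continuous.comp_continuousOn hpc')).mul
      (Complex.continuous_ofReal.comp_continuousOn ((hbK.comp hsc hsI).mul (hbK.comp htc htI))))
    (fun x h => ?_) (fun x h => ?_) (fun x h => ?_) (fun x h => ?_) (fun x h => ?_)
  · refine key.trans (le_of_eq ?_)
    rw [← mul_div_assoc, Real.sqrt_div (by positivity), div_div_eq_mul_div]
    ring
  · have e2 := hs0 x h
    have e3 := ht0 x h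
    have e1 := deriv_phase_factor (n := n) e2 e3 (hst x h) (p := p x) (p' := p' x) rfl rfl
    have e4 : geomQuot n (p x / s x) (p' x / t x) ≠ 0 :=
      (geomQuot_pos hn (div_pos (hR₁.trans_le (hpI x h).1) e2)
        (div_pos (hR₁.trans_le (hpI' x h).1) e3)).ne'
    have e5 : c * κ * ((p x / s x) ^ n - (p' x / t x) ^ n) * P x = c * κ ^ 2 * w *
        (δ * (s x * geomQuot (n + 1) (t x) (s x)) - α) * (b (s x) * b (t x)) := by
      simp only [hP, phaseQuot, hy]
      calc _ = c * κ * b (s x) * b (t x) * (((p x / s x) ^ n - (p' x / t x) ^ n) *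
            (s x * t x * geomQuot (n + 1) (t x) (s x))) *
            (geomQuot n (p x / s x) (p' x / t x))⁻¹ := by ring
        _ = _ := by rw [e1]; field_simp
    have e6 := congrArg (fun x : ℝ => (x : ℂ)) e5
    simp only [hq]
    push_cast at e6 ⊢
    linear_combination (A₁ (p x) * A₂ (p' x)) * e6
  · obtain ⟨e1, -⟩ := hAb₁ (p x) (hpI x h)
    obtain ⟨e3, -⟩ := hAb₂ (p' x) (hpI' x h)
    have e5 := hC₀ (s x) (hsI x h)
    have e6 := hC₀ (t x) (htI x h)
    rw [norm_mul, norm_mul, Complex.norm_real, norm_mul]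
    calc _ ≤ B * B * (C₀ * C₀) := by gcongr
      _ = B ^ 2 * C₀ ^ 2 := by ring
      _ ≤ _ := by gcongr; nlinarith [mul_nonneg hC₁ hΓ0]
  · obtain ⟨e1, -⟩ := hAb₁ (p x) (hpI x h)
    obtain ⟨e3, -⟩ := hAb₂ (p' x) (hpI' x h)
    have e5 := hPb x h
    simp only [hq]
    rw [norm_mul, norm_mul, Complex.norm_real, Real.norm_eq_abs]
    calc _ ≤ B * B * C₁ := by gcongr
      _ = B ^ 2 * C₁ := by ring
      _ ≤ _ := by gcongr; nlinarith [mul_nonneg hC₁ hΓ0, sq_nonneg C₀]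
  · rw [(hqder x h).deriv]
    refine (hqdb x h).trans ?_
    gcongr
    nlinarith [mul_nonneg hC₁ hΓ0, sq_nonneg C₀]
  · rw [div_le_iff₀ hC₂0]
    have e1 := mul_geomQuot_le (n := n) (hsI x h) (htI x h)
    have e2 := hm1 x h
    set S := s x * geomQuot (n + 1) (t x) (s x) with hS
    -- If `D` is small then `|δ S|` is at least comparable to `|α|`; as `S` is bounded and `|m| ≥
    -- 1`, `D'` is then large.
    have e3 : |α| ≤ |δ * S - α| + |δ| * |S| := by
      rw [← abs_mul]
      have := abs_sub_abs_le_abs_sub α (δ * S)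
      rw [abs_sub_comm] at this
      linarith
    have e4 : |δ| ≤ |δ * m x| := by
      rw [abs_mul]
      exact le_mul_of_one_le_right (abs_nonneg _) (by rw [abs_of_nonpos (by linarith)]; linarith)
    calc |α| ≤ |δ * S - α| * C₂ + |δ * m x| * C₂ := by
          refine e3.trans (add_le_add (le_mul_of_one_le_right (abs_nonneg _) hC₂1) ?_)
          gcongr
      _ = _ := by ring

/-! ### The kernel of `T T*` -/

/-- The root `u ^ (1 / (n + 1))`. -/
def nthRoot (n : ℕ) (u : ℝ) : ℝ := u ^ (((n + 1 : ℕ) : ℝ)⁻¹)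

lemma nthRoot_pow {n : ℕ} {u : ℝ} (hu : 0 ≤ u) : nthRoot n u ^ (n + 1) = u :=
  Real.rpow_inv_natCast_pow hu (by omega)

lemma nthRoot_pos {n : ℕ} {u : ℝ} (hu : 0 < u) : 0 < nthRoot n u := Real.rpow_pos_of_pos hu _

lemma pow_nthRoot {n : ℕ} {s : ℝ} (hs : 0 ≤ s) : nthRoot n (s ^ (n + 1)) = s :=
  Real.pow_rpow_inv_natCast hs (by omega)

lemma continuous_nthRoot (n : ℕ) : Continuous (nthRoot n) :=
  Real.continuous_rpow_const (by positivity)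

lemma nthRoot_le_nthRoot {n : ℕ} {u v : ℝ} (hu : 0 ≤ u) (h : u ≤ v) :
    nthRoot n u ≤ nthRoot n v := Real.rpow_le_rpow hu h (by positivity)

lemma hasDerivAt_nthRoot {n : ℕ} {u : ℝ} (hu : 0 < u) :
    HasDerivAt (nthRoot n) (1 / ((n + 1) * nthRoot n u ^ n)) u := by
  have h := Real.hasDerivAt_rpow_const (x := u) (p := ((n + 1 : ℕ) : ℝ)⁻¹) (Or.inl hu.ne')
  refine h.congr_deriv ?_
  have h1 := nthRoot_pos (n := n) hu
  have h2 := nthRoot_pow (n := n) hu.le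
  have h3 : u ^ ((((n + 1 : ℕ) : ℝ)⁻¹) - 1) = nthRoot n u / u := by
    rw [Real.rpow_sub hu, Real.rpow_one, nthRoot]
  rw [h3]
  nth_rewrite 2 [← h2]
  push_cast
  rw [pow_succ]
  field_simp

lemma nthRoot_mem_Icc_iff {n : ℕ} {u : ℝ} (hu : 0 < u) :
    nthRoot n u ∈ Icc (1 / 2 : ℝ) 2 ↔ u ∈ Icc ((1 / 2 : ℝ) ^ (n + 1)) (2 ^ (n + 1)) := by
  have h1 := (nthRoot_pos (n := n) hu).le
  have h2 := nthRoot_pow (n := n) hu.le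
  constructor
  · rintro ⟨h, h'⟩
    rw [← h2]
    exact ⟨pow_le_pow_left₀ (by norm_num) h _, pow_le_pow_left₀ h1 h' _⟩
  · rintro ⟨h, h'⟩
    rw [← h2] at h h'
    exact ⟨le_of_pow_le_pow_left₀ (by omega) h1 h, le_of_pow_le_pow_left₀ (by omega) (by norm_num) h'⟩

/-- The kernel `k(X, U)`. -/
def rootKernel (n : ℕ) (b : ℝ → ℝ) (A : ℝ → ℂ) (c κ δ β X U : ℝ) : ℂ :=
  if X < U then
    Complex.exp (Complex.I * (-c * (κ * (nthRoot n (U - X) - (δ * U + β))) ^ (n + 1) : ℝ)) *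
      A (κ * (nthRoot n (U - X) - (δ * U + β))) * (b (nthRoot n (U - X)) : ℝ)
  else 0

lemma rootKernel_eq_zero {n : ℕ} {b : ℝ → ℝ} (hb : ∀ s, s ∉ Icc (1 / 2 : ℝ) 2 → b s = 0)
    (A : ℝ → ℂ) (c κ δ β : ℝ) {X U : ℝ}
    (h : X ∉ Icc (U - 2 ^ (n + 1)) (U - (1 / 2) ^ (n + 1))) :
    rootKernel n b A c κ δ β X U = 0 := by
  unfold rootKernel
  split_ifs with hX
  · rw [hb, Complex.ofReal_zero, mul_zero]
    rw [nthRoot_mem_Icc_iff (sub_pos.2 hX)]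
    exact fun h' => h ⟨by linarith [h'.2], by linarith [h'.1]⟩
  · rfl

lemma norm_rootKernel_le (n : ℕ) (b : ℝ → ℝ) (A : ℝ → ℂ) (c κ δ β X U : ℝ) :
    ‖rootKernel n b A c κ δ β X U‖ ≤
      ‖A (κ * (nthRoot n (U - X) - (δ * U + β)))‖ * |b (nthRoot n (U - X))| := by
  unfold rootKernel
  split_ifs with hX
  · rw [norm_mul, norm_mul, Complex.norm_real, mul_comm Complex.I,
      Complex.norm_exp_ofReal_mul_I, one_mul, Real.norm_eq_abs]
  · rw [norm_zero]; positivity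

lemma measurable_rootKernel {n : ℕ} {b : ℝ → ℝ} (hb : Measurable b) {A : ℝ → ℂ}
    (hA : Continuous A) (c κ δ β : ℝ) :
    Measurable fun p : ℝ × ℝ => rootKernel n b A c κ δ β p.1 p.2 := by
  unfold rootKernel
  refine Measurable.ite (measurableSet_lt measurable_fst measurable_snd) ?_ measurable_const
  have h1 := continuous_nthRoot n
  have h2 : Measurable fun p : ℝ × ℝ => (b (nthRoot n (p.2 - p.1)) : ℂ) :=
    Complex.measurable_ofReal.comp (hb.comp (by fun_prop))
  exact (Continuous.measurable (by fun_prop)).mul h2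

lemma measurable_of_continuousOn_Icc {b : ℝ → ℝ} {l u : ℝ} (hb : ContinuousOn b (Icc l u))
    (hb0 : ∀ s, s ∉ Icc l u → b s = 0) : Measurable b := by
  have h : b = (Icc l u).piecewise b 0 := by
    ext x
    by_cases hx : x ∈ Icc l u
    · rw [piecewise_eq_of_mem _ _ _ hx]
    · rw [piecewise_eq_of_notMem _ _ _ hx, hb0 x hx]; rfl
  rw [h]
  exact hb.measurable_piecewise continuousOn_const measurableSet_Icc

/-- Where both stationary points lie in `[r₁ / 2, 2 r₂]`, `exists_kernel_bound` applies with
amplitudes of size `|c| ^ (-1/2)`. Elsewhere one amplitude is `O(1 / |c|)` and absolute values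
suffice. The constant is uniform in `c`, `δ` and `β`; only `|κ|` is confined to a compact range. -/
theorem exists_integral_rootKernel_le {n : ℕ} (hn : 1 ≤ n) {χ : ℝ → ℂ} (hχ : ContDiff ℝ ∞ χ)
    {r₁ r₂ : ℝ} (h0 : 0 < r₁) (hr : r₁ ≤ r₂) (hχ₁ : χ r₁ = 0) (hχ₂ : χ r₂ = 0)
    {b : ℝ → ℝ} (hb : ContDiffOn ℝ 1 b (Ioi 0)) (hb0 : ∀ s, s ∉ Icc (1 / 2 : ℝ) 2 → b s = 0)
    {κ₁ : ℝ} (hκ₁ : 0 < κ₁) (κ₂ : ℝ) :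
    ∃ C : ℝ, 0 ≤ C ∧ ∀ c κ δ β U V : ℝ, c ≠ 0 → κ₁ ≤ |κ| → |κ| ≤ κ₂ → U ≠ V → δ * U + β ≠ 0 →
      ‖∫ X : ℝ, rootKernel n b (oscAmp n χ r₁ r₂ c) c κ δ β X U *
        conj (rootKernel n b (oscAmp n χ r₁ r₂ c) c κ δ β X V)‖ ≤
      C / (|c| * Real.sqrt |c|) * (1 + 1 / Real.sqrt (|V - U| * |δ * U + β|)) := by
  obtain ⟨Ka, hKa, ha⟩ := oscAmp_norm_le (n := n) hχ hr
  obtain ⟨Kb, hKb, hb'⟩ := oscAmp_norm_le_of_notMem (n := n) hχ h0 hr hχ₁ hχ₂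
  obtain ⟨Kd, hKd, hd⟩ := deriv_oscAmp_norm_le hn hχ h0 hr hχ₁ hχ₂ (r₁ / 2) (2 * r₂)
  obtain ⟨Kk, hKk, hk⟩ := exists_kernel_bound hn hb (R₁ := r₁ / 2) (by positivity) (2 * r₂)
    (max κ₂ 0) (le_max_right _ _)
  have hbK : ContinuousOn b (Icc (1 / 2 : ℝ) 2) :=
    hb.continuousOn.mono fun x hx => (by linarith [hx.1] : (0 : ℝ) < x)
  obtain ⟨C₀, hC₀⟩ := isCompact_Icc.exists_bound_of_continuousOn hbK
  have hC₀0 : 0 ≤ C₀ := (norm_nonneg _).trans (hC₀ 1 ⟨by norm_num, by norm_num⟩)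
  have hbC : ∀ s, |b s| ≤ C₀ := fun s => by
    by_cases h : s ∈ Icc (1 / 2 : ℝ) 2
    · exact hC₀ s h
    · rw [hb0 s h, abs_zero]; exact hC₀0
  set L : ℝ := 2 ^ (n + 1) with hL
  have hL0 : 0 < L := by positivity
  set ε₀ : ℝ := (1 / 2) ^ (n + 1) with hε₀
  have hε₀0 : 0 < ε₀ := by positivity
  refine ⟨Kk * (Ka + Kd) ^ 2 * (L + 8) / κ₁ + Ka * Kb * C₀ ^ 2 * L, by positivity, ?_⟩
  intro c κ δ β U V hc hκ1 hκ2 hUV hα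
  have hκ : κ ≠ 0 := abs_pos.1 (hκ₁.trans_le hκ1)
  have hc0 : 0 < |c| := abs_pos.2 hc
  have hsc : 0 < Real.sqrt |c| := Real.sqrt_pos.2 hc0
  set A := oscAmp n χ r₁ r₂ c with hA
  have hAd : Differentiable ℝ A := differentiable_oscAmp n hχ r₁ r₂ c
  set kU : ℝ → ℂ := fun X => rootKernel n b A c κ δ β X U with hkU
  set kV : ℝ → ℂ := fun X => rootKernel n b A c κ δ β X V with hkV
  set s : ℝ → ℝ := fun X => nthRoot n (U - X) with hs
  set t : ℝ → ℝ := fun X => nthRoot n (V - X) with ht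
  have hsc' : Continuous s := (continuous_nthRoot n).comp (by fun_prop)
  have htc' : Continuous t := (continuous_nthRoot n).comp (by fun_prop)
  set p : ℝ → ℝ := fun X => κ * (s X - (δ * U + β)) with hp
  set p' : ℝ → ℝ := fun X => κ * (t X - (δ * V + β)) with hp'
  have hpc : Continuous p := by fun_prop
  have hpc' : Continuous p' := by fun_prop
  set T₀ : Set ℝ := Icc (U - L) (U - ε₀) ∩ Icc (V - L) (V - ε₀) with hT₀
  set T : Set ℝ := T₀ ∩ (p ⁻¹' Icc (r₁ / 2) (2 * r₂) ∩ p' ⁻¹' Icc (r₁ / 2) (2 * r₂)) with hT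
  have hT₀c : IsCompact T₀ := isCompact_Icc.inter_right isClosed_Icc
  have hTc : IsCompact T := hT₀c.inter_right
    ((isClosed_Icc.preimage hpc).inter (isClosed_Icc.preimage hpc'))
  have hmono : ∀ {W x y : ℝ}, x ≤ y → y ≤ W - ε₀ → nthRoot n (W - y) ≤ nthRoot n (W - x) :=
    fun h1 h2 => nthRoot_le_nthRoot (by linarith) (by linarith)
  have hbetween : ∀ {α a b y l u : ℝ}, a ≤ y → y ≤ b → κ * (a - α) ∈ Icc l u →
      κ * (b - α) ∈ Icc l u → κ * (y - α) ∈ Icc l u := by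
    intro α a b y l u h1 h2 h3 h4
    rcases le_total 0 κ with h | h
    · exact ⟨h3.1.trans (by gcongr), le_trans (by gcongr) h4.2⟩
    · exact ⟨h4.1.trans (mul_le_mul_of_nonpos_left (by linarith) h),
        (mul_le_mul_of_nonpos_left (by linarith) h).trans h3.2⟩
  -- The roots decrease in `X`, so `p` and `p'` are monotone and `T` is an interval, as van der
  -- Corput requires.
  have hTo : T.OrdConnected := by
    refine ⟨fun x hx z hz y hy => ?_⟩
    have hy₀ : y ∈ T₀ := ⟨⟨hx.1.1.1.trans hy.1, hy.2.trans hz.1.1.2⟩,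
      ⟨hx.1.2.1.trans hy.1, hy.2.trans hz.1.2.2⟩⟩
    exact ⟨hy₀, hbetween (hmono hy.2 hz.1.1.2) (hmono hy.1 hy₀.1.2) hz.2.1 hx.2.1,
      hbetween (hmono hy.2 hz.1.2.2) (hmono hy.1 hy₀.2.2) hz.2.2 hx.2.2⟩
  have hzero : ∀ X, X ∉ T₀ → kU X * conj (kV X) = 0 := fun X hX => by
    rw [hT₀, mem_inter_iff, not_and_or] at hX
    rcases hX with h | h
    · rw [hkU]; simp only; rw [rootKernel_eq_zero hb0 _ _ _ _ _ h, zero_mul]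
    · rw [hkV]; simp only; rw [rootKernel_eq_zero hb0 _ _ _ _ _ h, map_zero, mul_zero]
  have hbm : Measurable b := measurable_of_continuousOn_Icc hbK hb0
  have hkm : ∀ W, Measurable fun X => rootKernel n b A c κ δ β X W := fun W =>
    (measurable_rootKernel hbm hAd.continuous c κ δ β).comp
      (by fun_prop : Measurable fun X : ℝ => (X, W))
  have hmeas : Measurable fun X => kU X * conj (kV X) :=
    (hkm U).mul (Complex.continuous_conj.measurable.comp (hkm V))
  have hnU : ∀ X, ‖kU X‖ ≤ Ka / Real.sqrt |c| * C₀ := fun X =>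
    (norm_rootKernel_le _ _ _ _ _ _ _ _ _).trans (by
      have := ha c hc (p X); have := hbC (s X); gcongr)
  have hnV : ∀ X, ‖kV X‖ ≤ Ka / Real.sqrt |c| * C₀ := fun X =>
    (norm_rootKernel_le _ _ _ _ _ _ _ _ _).trans (by
      have := ha c hc (p' X); have := hbC (t X); gcongr)
  have hT₀v : volume T₀ ≤ ENNReal.ofReal L := by
    refine (measure_mono inter_subset_left).trans ?_
    rw [Real.volume_Icc]
    exact ENNReal.ofReal_le_ofReal (by linarith)
  have hint : IntegrableOn (fun X => kU X * conj (kV X)) T₀ :=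
    Integrable.mono' (integrableOn_const (C := (Ka / Real.sqrt |c| * C₀) *
      (Ka / Real.sqrt |c| * C₀)) hT₀c.measure_lt_top.ne) hmeas.aestronglyMeasurable
      (Filter.Eventually.of_forall fun X => by
        rw [norm_mul, RCLike.norm_conj]
        exact mul_le_mul (hnU X) (hnV X) (norm_nonneg _) (by positivity))
  have hsplit : ∫ X, kU X * conj (kV X) = (∫ X in T, kU X * conj (kV X)) +
      ∫ X in T₀ \ T, kU X * conj (kV X) := by
    rw [← setIntegral_eq_integral_of_forall_compl_eq_zero hzero,
      ← integral_inter_add_sdiff hTc.measurableSet hint, inter_eq_self_of_subset_right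
      inter_subset_left]
  -- the part where one of the two amplitudes is small
  have hout : ‖∫ X in T₀ \ T, kU X * conj (kV X)‖ ≤
      Ka * Kb * C₀ ^ 2 * L / (|c| * Real.sqrt |c|) := by
    have hb1 : ∀ X ∈ T₀ \ T, ‖kU X * conj (kV X)‖ ≤ Ka * Kb * C₀ ^ 2 / (|c| * Real.sqrt |c|) := by
      intro X hX
      rw [norm_mul, RCLike.norm_conj]
      have h1 : p X ∉ Icc (r₁ / 2) (2 * r₂) ∨ p' X ∉ Icc (r₁ / 2) (2 * r₂) := by
        by_contra hcon
        push Not at hcon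
        exact hX.2 ⟨hX.1, hcon.1, hcon.2⟩
      rcases h1 with h1 | h1
      · have h2 : ‖kU X‖ ≤ Kb / |c| * C₀ := (norm_rootKernel_le _ _ _ _ _ _ _ _ _).trans (by
          have := hb' c hc (p X) h1; have := hbC (s X); gcongr)
        calc _ ≤ (Kb / |c| * C₀) * (Ka / Real.sqrt |c| * C₀) :=
              mul_le_mul h2 (hnV X) (norm_nonneg _) (by positivity)
          _ = _ := by field_simp
      · have h2 : ‖kV X‖ ≤ Kb / |c| * C₀ := (norm_rootKernel_le _ _ _ _ _ _ _ _ _).trans (by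
          have := hb' c hc (p' X) h1; have := hbC (t X); gcongr)
        calc _ ≤ (Ka / Real.sqrt |c| * C₀) * (Kb / |c| * C₀) :=
              mul_le_mul (hnU X) h2 (norm_nonneg _) (by positivity)
          _ = _ := by field_simp
    have hv : volume (T₀ \ T) < ⊤ := (measure_mono sdiff_subset).trans_lt hT₀c.measure_lt_top
    refine (norm_setIntegral_le_of_norm_le_const hv hb1).trans ?_
    have h3 : volume.real (T₀ \ T) ≤ L := by
      refine ENNReal.toReal_le_of_le_ofReal hL0.le ((measure_mono sdiff_subset).trans hT₀v)
    calc _ ≤ Ka * Kb * C₀ ^ 2 / (|c| * Real.sqrt |c|) * L := by gcongr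
      _ = _ := by ring
  -- the oscillatory part
  have hin : ‖∫ X in T, kU X * conj (kV X)‖ ≤ Kk * (Ka + Kd) ^ 2 * (L + 8) / κ₁ /
      (|c| * Real.sqrt |c|) * (1 / Real.sqrt (|V - U| * |δ * U + β|)) := by
    rcases T.eq_empty_or_nonempty with hE | hNe
    · rw [hE, setIntegral_empty, norm_zero]; positivity
    have hTI := eq_Icc_of_connected_compact ⟨hNe, hTo.isPreconnected⟩ hTc
    set x₁ := sInf T
    set x₂ := sSup T
    have hx : x₁ ≤ x₂ := by rw [hTI] at hNe; exact nonempty_Icc.1 hNe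
    have hx₁ : x₁ ∈ T := by rw [hTI]; exact left_mem_Icc.2 hx
    have hx₂ : x₂ ∈ T := by rw [hTI]; exact right_mem_Icc.2 hx
    have hlen : x₂ - x₁ ≤ L := by linarith [hx₁.1.1.1, hx₂.1.1.2]
    have hmem : ∀ x ∈ Icc x₁ x₂, x ∈ T := fun x h => by rw [hTI]; exact h
    have hU : ∀ x ∈ Icc x₁ x₂, 0 < U - x := fun x h => by linarith [(hmem x h).1.1.2]
    have hV : ∀ x ∈ Icc x₁ x₂, 0 < V - x := fun x h => by linarith [(hmem x h).1.2.2]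
    have hrd : ∀ {W x : ℝ}, 0 < W - x → HasDerivAt (fun X => nthRoot n (W - X))
        (-(1 / ((n + 1) * nthRoot n (W - x) ^ n))) x := fun {W x} h => by
      have := (hasDerivAt_nthRoot (n := n) h).comp x ((hasDerivAt_id x).const_sub W)
      exact this.congr_deriv (by ring)
    have hB : ∀ q ∈ Icc (r₁ / 2) (2 * r₂), ‖A q‖ ≤ (Ka + Kd) / Real.sqrt |c| ∧
        ‖deriv A q‖ ≤ (Ka + Kd) / Real.sqrt |c| := fun q hq =>
      ⟨(ha c hc q).trans (by gcongr; linarith), (hd c hc q hq).trans (by gcongr; linarith)⟩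
    have hconjd : ∀ q, HasDerivAt (fun q => conj (A q)) (conj (deriv A q)) q := fun q =>
      (hAd q).hasDerivAt.star
    have hw : δ * U + β + δ * (V - U) = δ * V + β := by ring
    have key := hk (x₁ := x₁) (x₂ := x₂) (κ := κ) (c := c) (α := δ * U + β) (δ := δ)
      (w := V - U) (B := (Ka + Kd) / Real.sqrt |c|) (A₁ := A) (A₂ := fun q => conj (A q))
      (s := s) (t := t) hx hκ (hκ2.trans (le_max_left _ _)) hc hα (sub_ne_zero.2 hUV.symm)
      (by positivity) hAd (fun q => (hconjd q).differentiableAt) hB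
      (fun q hq => by rw [(hconjd q).deriv, RCLike.norm_conj, RCLike.norm_conj]; exact hB q hq)
      (fun x h => hrd (hU x h)) (fun x h => hrd (hV x h))
      (fun x h => (nthRoot_mem_Icc_iff (hU x h)).2
        ⟨by linarith [(hmem x h).1.1.2], by linarith [(hmem x h).1.1.1]⟩)
      (fun x h => (nthRoot_mem_Icc_iff (hV x h)).2
        ⟨by linarith [(hmem x h).1.2.2], by linarith [(hmem x h).1.2.1]⟩)
      (fun x h => by
        simp only [hs, ht]
        rw [nthRoot_pow (hU x h).le, nthRoot_pow (hV x h).le]; ring)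
      (fun x h => (hmem x h).2.1) (fun x h => by rw [hw]; exact (hmem x h).2.2)
    rw [hw] at key
    have heq : ∫ X in T, kU X * conj (kV X) = ∫ x in x₁..x₂,
        Complex.exp (Complex.I * (-c * ((κ * (s x - (δ * U + β))) ^ (n + 1) -
          (κ * (t x - (δ * V + β))) ^ (n + 1)) : ℝ)) *
          (A (κ * (s x - (δ * U + β))) * conj (A (κ * (t x - (δ * V + β)))) *
            (b (s x) * b (t x) : ℝ)) := by
      rw [intervalIntegral.integral_of_le hx, ← integral_Icc_eq_integral_Ioc, ← hTI]
      refine setIntegral_congr_fun hTc.measurableSet fun x hx' => ?_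
      rw [hTI] at hx'
      simp only [hkU, hkV, rootKernel, if_pos (sub_pos.1 (hU x hx')),
        if_pos (sub_pos.1 (hV x hx')), map_mul, Complex.conj_ofReal, ← Complex.exp_conj,
        Complex.conj_I]
      rw [show Complex.exp (Complex.I * (-c * ((κ * (s x - (δ * U + β))) ^ (n + 1) -
          (κ * (t x - (δ * V + β))) ^ (n + 1)) : ℝ)) =
          Complex.exp (Complex.I * (-c * (κ * (s x - (δ * U + β))) ^ (n + 1) : ℝ)) *
          Complex.exp (-Complex.I * (-c * (κ * (t x - (δ * V + β))) ^ (n + 1) : ℝ)) by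
        rw [← Complex.exp_add]; congr 1; push_cast; ring]
      push_cast
      ring
    rw [heq]
    refine key.trans ?_
    have hsq : Real.sqrt (|c * κ ^ 2 * (V - U)| * |δ * U + β|) =
        Real.sqrt |c| * |κ| * Real.sqrt (|V - U| * |δ * U + β|) := by
      rw [abs_mul, abs_mul, abs_pow, mul_assoc, Real.sqrt_mul (by positivity),
        Real.sqrt_mul (by positivity), Real.sqrt_sq (abs_nonneg _)]
    have hpos : 0 < Real.sqrt (|V - U| * |δ * U + β|) := Real.sqrt_pos.2
      (mul_pos (abs_pos.2 (sub_ne_zero.2 hUV.symm)) (abs_pos.2 hα))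
    rw [hsq, div_pow, Real.sq_sqrt hc0.le]
    calc _ ≤ Kk * ((Ka + Kd) ^ 2 / |c|) * (L + 8) /
          (Real.sqrt |c| * κ₁ * Real.sqrt (|V - U| * |δ * U + β|)) := by gcongr
      _ = _ := by field_simp
  rw [hsplit]
  refine (norm_add_le _ _).trans ((add_le_add hin hout).trans ?_)
  have hz : 0 ≤ 1 / Real.sqrt (|V - U| * |δ * U + β|) := by positivity
  set z := 1 / Real.sqrt (|V - U| * |δ * U + β|)
  set P := Kk * (Ka + Kd) ^ 2 * (L + 8) / κ₁ with hP
  set R := Ka * Kb * C₀ ^ 2 * L with hR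
  have hP0 : 0 ≤ P := by positivity
  have hR0 : 0 ≤ R := by positivity
  have hd0 : 0 < |c| * Real.sqrt |c| := by positivity
  have : (P + R) / (|c| * Real.sqrt |c|) * (1 + z) - (P / (|c| * Real.sqrt |c|) * z +
      R / (|c| * Real.sqrt |c|)) = (P + R * z) / (|c| * Real.sqrt |c|) := by ring
  have h9 : 0 ≤ (P + R * z) / (|c| * Real.sqrt |c|) := by positivity
  linarith

/-! ### The `T T*` inequality -/

/-- A strip with fibres of fixed finite length; it supplies the majorant in both uses of Fubini
below. -/
lemma integrable_mul_indicator_sub {α : Type*} [MeasurableSpace α] {μ : Measure α} [SFinite μ]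
    {h : α → ℝ} (hh : Integrable h μ) {u : α → ℝ} (hu : Measurable u) (L : ℝ) :
    Integrable (fun q : α × ℝ => h q.1 * (Icc (-L) 0).indicator (fun _ => (1 : ℝ)) (q.2 - u q.1))
      (μ.prod volume) := by
  have h1 : Integrable ((Icc (-L) 0).indicator fun _ : ℝ => (1 : ℝ)) :=
    (integrable_indicator_iff measurableSet_Icc).2 (integrableOn_const (by simp))
  have hm : Measurable ((Icc (-L) 0).indicator fun _ : ℝ => (1 : ℝ)) :=
    measurable_const.indicator measurableSet_Icc
  have hmeas : AEStronglyMeasurable (fun q : α × ℝ => h q.1 *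
      (Icc (-L) 0).indicator (fun _ => (1 : ℝ)) (q.2 - u q.1)) (μ.prod volume) :=
    hh.1.comp_fst.mul (hm.comp (measurable_snd.sub (hu.comp measurable_fst))).aestronglyMeasurable
  rw [integrable_prod_iff hmeas]
  refine ⟨Filter.Eventually.of_forall fun a => (h1.comp_sub_right (u a)).const_mul (h a), ?_⟩
  have h2 : ∀ a, ∫ y, ‖h a * (Icc (-L) 0).indicator (fun _ => (1 : ℝ)) (y - u a)‖ =
      ‖h a‖ * ∫ y, ‖(Icc (-L) 0).indicator (fun _ : ℝ => (1 : ℝ)) y‖ := fun a => by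
    simp_rw [norm_mul]
    rw [integral_const_mul, integral_sub_right_eq_self
      (fun y => ‖(Icc (-L) 0).indicator (fun _ : ℝ => (1 : ℝ)) y‖) (u a)]
  simp only [h2]
  exact hh.norm.mul_const _

lemma sq_integral_mul_norm_le {G I : ℝ → ℂ} (hG : MemLp G 2) (hI : MemLp I 2) :
    (∫ x, ‖G x‖ * ‖I x‖) ^ 2 ≤ (∫ x, ‖G x‖ ^ 2) * ∫ x, ‖I x‖ ^ 2 := by
  have h := integral_mul_norm_le_Lp_mul_Lq (μ := volume) Real.HolderConjugate.two_two
    (f := G) (g := I) (by simpa using hG) (by simpa using hI)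
  simp only [Real.rpow_two] at h
  rw [← Real.sqrt_eq_rpow, ← Real.sqrt_eq_rpow] at h
  have h0 : 0 ≤ ∫ x, ‖G x‖ * ‖I x‖ := integral_nonneg fun x => by positivity
  calc _ ≤ (Real.sqrt (∫ x, ‖G x‖ ^ 2) * Real.sqrt (∫ x, ‖I x‖ ^ 2)) ^ 2 := by gcongr
    _ = _ := by
      rw [mul_pow, Real.sq_sqrt (integral_nonneg fun x => by positivity),
        Real.sq_sqrt (integral_nonneg fun x => by positivity)]

/-- Fubini isolates `G`, Cauchy-Schwarz in `X` removes it, and the remaining square is expanded into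
a double integral. The bounds `B`, `L` and `g` serve only absolute convergence and do not enter the
conclusion. -/
theorem sq_norm_integral_kernel_le {k : ℝ → ℝ → ℂ} {B L : ℝ} (hB : 0 ≤ B)
    (hk : Measurable fun p : ℝ × ℝ => k p.1 p.2) (hkB : ∀ X U, ‖k X U‖ ≤ B)
    (hk0 : ∀ X U, X ∉ Icc (U - L) U → k X U = 0) {H G : ℝ → ℂ} (hH : Integrable H)
    {g : ℝ} (hGc : Continuous G) (hGb : ∀ x, ‖G x‖ ≤ g) (hG : MemLp G 2) :
    ‖∫ U, H U * ∫ X, k X U * G X‖ ^ 2 ≤ (∫ X, ‖G X‖ ^ 2) *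
      ∫ p : ℝ × ℝ, ‖H p.1‖ * ‖H p.2‖ * ‖∫ X, k X p.1 * conj (k X p.2)‖
        ∂(volume.prod volume) := by
  have hkind : ∀ X U, ‖k X U‖ ≤ B * (Icc (-L) 0).indicator (fun _ => (1 : ℝ)) (X - U) := by
    intro X U
    by_cases h : X ∈ Icc (U - L) U
    · rw [indicator_of_mem (by constructor <;> linarith [h.1, h.2]), mul_one]; exact hkB X U
    · rw [hk0 X U h, norm_zero]
      exact mul_nonneg hB (indicator_nonneg (fun _ _ => zero_le_one) _)
  have hg : 0 ≤ g := (norm_nonneg _).trans (hGb 0)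
  set I : ℝ → ℂ := fun X => ∫ U, H U * k X U with hI
  -- first interchange
  have hint1 : Integrable (fun q : ℝ × ℝ => H q.1 * (k q.2 q.1 * G q.2)) (volume.prod volume) := by
    refine Integrable.mono' ((integrable_mul_indicator_sub hH.norm measurable_id L).const_mul
      (B * g)) ?_ (Filter.Eventually.of_forall fun q => ?_)
    · exact hH.1.comp_fst.mul ((hk.comp measurable_swap).mul
        (hGc.measurable.comp measurable_snd)).aestronglyMeasurable
    · rw [norm_mul, norm_mul]
      calc _ ≤ ‖H q.1‖ * ((B * (Icc (-L) 0).indicator (fun _ => (1 : ℝ)) (q.2 - q.1)) * g) := by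
            have := hkind q.2 q.1
            have := hGb q.2
            have h0 : 0 ≤ (Icc (-L) 0).indicator (fun _ => (1 : ℝ)) (q.2 - q.1) :=
              indicator_nonneg (fun _ _ => zero_le_one) _
            gcongr
        _ = _ := by simp only [id]; ring
  have hZ : ∫ U, H U * ∫ X, k X U * G X = ∫ X, G X * I X := by
    simp_rw [← integral_const_mul]
    rw [integral_integral_swap hint1]
    refine integral_congr_ae (Filter.Eventually.of_forall fun X => ?_)
    simp only [hI]
    rw [← integral_const_mul]
    refine integral_congr_ae (Filter.Eventually.of_forall fun U => ?_)
    simp only; ring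
  -- second interchange
  have hHH : Integrable (fun p : ℝ × ℝ => ‖H p.1‖ * ‖H p.2‖) (volume.prod volume) :=
    hH.norm.mul_prod hH.norm
  have hint2 : Integrable (fun q : (ℝ × ℝ) × ℝ => (H q.1.1 * k q.2 q.1.1) *
      (conj (H q.1.2) * conj (k q.2 q.1.2))) ((volume.prod volume).prod volume) := by
    refine Integrable.mono' ((integrable_mul_indicator_sub hHH measurable_fst L).const_mul
      (B * B)) ?_ (Filter.Eventually.of_forall fun q => ?_)
    · refine (AEStronglyMeasurable.mul (hH.1.comp_fst.comp_fst) ?_).mul (AEStronglyMeasurable.mul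
        (Complex.continuous_conj.comp_aestronglyMeasurable hH.1.comp_snd.comp_fst) ?_)
      · exact (hk.comp (by fun_prop : Measurable fun q : (ℝ × ℝ) × ℝ =>
          (q.2, q.1.1))).aestronglyMeasurable
      · exact (Complex.continuous_conj.measurable.comp (hk.comp (by fun_prop : Measurable
          fun q : (ℝ × ℝ) × ℝ => (q.2, q.1.2)))).aestronglyMeasurable
    · rw [norm_mul, norm_mul, norm_mul, RCLike.norm_conj, RCLike.norm_conj]
      have h1 := hkind q.2 q.1.1
      have h2 := hkB q.2 q.1.2
      have h0 : 0 ≤ (Icc (-L) 0).indicator (fun _ => (1 : ℝ)) (q.2 - q.1.1) :=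
        indicator_nonneg (fun _ _ => zero_le_one) _
      calc _ ≤ ‖H q.1.1‖ * (B * (Icc (-L) 0).indicator (fun _ => (1 : ℝ)) (q.2 - q.1.1)) *
            (‖H q.1.2‖ * B) := by gcongr
        _ = _ := by ring
  have hII : ∀ X, I X * conj (I X) = ∫ p : ℝ × ℝ, (H p.1 * k X p.1) *
      (conj (H p.2) * conj (k X p.2)) ∂(volume.prod volume) := fun X => by
    rw [integral_prod_mul (fun U => H U * k X U) fun V => conj (H V) * conj (k X V)]
    simp only [hI]
    rw [← integral_conj]
    simp only [map_mul]
  have hIIi : Integrable fun X => I X * conj (I X) := by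
    simp_rw [hII]
    exact hint2.integral_prod_right
  have hnsq : ∀ z : ℂ, ‖z * conj z‖ = ‖z‖ ^ 2 := fun z => by
    rw [norm_mul, RCLike.norm_conj, sq]
  have hIm : AEStronglyMeasurable I := by
    refine AEStronglyMeasurable.integral_prod_right' (f := fun q : ℝ × ℝ => H q.2 * k q.1 q.2) ?_
    exact hH.1.comp_snd.mul hk.aestronglyMeasurable
  have hI2 : MemLp I 2 := by
    rw [memLp_two_iff_integrable_sq_norm hIm]
    simpa only [hnsq] using hIIi.norm
  have hIsq : ∫ X, ‖I X‖ ^ 2 ≤ ∫ p : ℝ × ℝ, ‖H p.1‖ * ‖H p.2‖ *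
      ‖∫ X, k X p.1 * conj (k X p.2)‖ ∂(volume.prod volume) := by
    have h1 : ((∫ X, ‖I X‖ ^ 2 : ℝ) : ℂ) = ∫ X, I X * conj (I X) := by
      rw [← integral_complex_ofReal]
      refine integral_congr_ae (Filter.Eventually.of_forall fun X => ?_)
      simp only [Complex.mul_conj, Complex.normSq_eq_norm_sq]
    have h2 : ∫ X, I X * conj (I X) = ∫ p : ℝ × ℝ, H p.1 * conj (H p.2) *
        (∫ X, k X p.1 * conj (k X p.2)) ∂(volume.prod volume) := by
      simp_rw [hII]
      rw [← integral_integral_swap (f := fun (p : ℝ × ℝ) (X : ℝ) => (H p.1 * k X p.1) *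
        (conj (H p.2) * conj (k X p.2))) hint2]
      refine integral_congr_ae (Filter.Eventually.of_forall fun p => ?_)
      simp only
      rw [← integral_const_mul]
      refine integral_congr_ae (Filter.Eventually.of_forall fun X => ?_)
      simp only; ring
    have h3 : 0 ≤ ∫ X, ‖I X‖ ^ 2 := integral_nonneg fun X => by positivity
    rw [← Real.norm_of_nonneg h3, ← Complex.norm_real, h1, h2]
    refine (norm_integral_le_integral_norm _).trans (le_of_eq ?_)
    simp only [norm_mul, RCLike.norm_conj]
  rw [hZ]
  calc ‖∫ X, G X * I X‖ ^ 2 ≤ (∫ X, ‖G X‖ * ‖I X‖) ^ 2 := by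
        gcongr
        refine (norm_integral_le_integral_norm _).trans (le_of_eq ?_)
        simp only [norm_mul]
    _ ≤ (∫ x, ‖G x‖ ^ 2) * ∫ x, ‖I x‖ ^ 2 := sq_integral_mul_norm_le hG hI2
    _ ≤ _ := by gcongr

/-! ### Summation of the kernel bounds -/

/-- The shear `(x, y) ↦ (x, y - x)` preserves measure, so the two factors decouple. -/
lemma integrable_mul_comp_neg_add {f g : ℝ → ℝ} (hf : Integrable f) (hg : Integrable g) :
    Integrable (fun p : ℝ × ℝ => f p.1 * g (-p.1 + p.2)) (volume.prod volume) ∧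
      ∫ p : ℝ × ℝ, f p.1 * g (-p.1 + p.2) ∂(volume.prod volume) = (∫ x, f x) * ∫ x, g x := by
  have hmp := measurePreserving_prod_neg_add (volume : Measure ℝ) (volume : Measure ℝ)
  have hfg := hf.mul_prod hg
  refine ⟨hmp.integrable_comp_of_integrable hfg, ?_⟩
  rw [← integral_prod_mul f g]
  exact (integral_map (f := fun z : ℝ × ℝ => f z.1 * g z.2) hmp.measurable.aemeasurable
    (by rw [hmp.map_eq]; exact hfg.1)).symm.trans (by rw [hmp.map_eq])

/-- The truncated singularity `|z|^{-1/2} 1_{|z| ≤ L}`. -/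
def truncInvSqrt (L z : ℝ) : ℝ := (Icc (-L) L).indicator (fun z => 1 / Real.sqrt |z|) z

lemma truncInvSqrt_nonneg (L z : ℝ) : 0 ≤ truncInvSqrt L z :=
  indicator_nonneg (fun _ _ => by positivity) _

lemma integrable_truncInvSqrt (L : ℝ) : Integrable (truncInvSqrt L) := by
  have h0 : IntegrableOn (fun z : ℝ => 1 / Real.sqrt |z|) (Ioc 0 L) := by
    have h := (intervalIntegral.intervalIntegrable_rpow' (a := 0) (b := L)
      (by norm_num : (-1 : ℝ) < -(1 / 2))).1
    refine h.congr_fun (fun z hz => ?_) measurableSet_Ioc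
    simp only
    rw [abs_of_pos hz.1, Real.sqrt_eq_rpow, Real.rpow_neg hz.1.le, one_div, one_div]
  have h1 : IntegrableOn (fun z : ℝ => 1 / Real.sqrt |z|) (Ico (-L) 0) := by
    rw [← (Measure.measurePreserving_neg (volume : Measure ℝ)).integrableOn_comp_preimage
      (Homeomorph.neg ℝ).measurableEmbedding] at h0
    have h2 : (Neg.neg : ℝ → ℝ) ⁻¹' Ioc 0 L = Ico (-L) 0 := by simp
    rw [h2] at h0
    simpa [Function.comp_def] using h0
  have h3 : Integrable ((Ico (-L) 0 ∪ Ioc 0 L).indicator fun z : ℝ => 1 / Real.sqrt |z|) :=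
    (integrable_indicator_iff (measurableSet_Ico.union measurableSet_Ioc)).2 (h1.union h0)
  refine h3.congr (Filter.Eventually.of_forall fun z => ?_)
  unfold truncInvSqrt
  rcases eq_or_ne z 0 with rfl | hz
  · simp [indicator]
  · have : z ∈ Ico (-L) 0 ∪ Ioc 0 L ↔ z ∈ Icc (-L) L := by
      simp only [mem_union, mem_Ico, mem_Ioc, mem_Icc]
      constructor
      · rintro (h | h) <;> constructor <;> linarith [h.1, h.2]
      · rintro ⟨h, h'⟩
        rcases lt_or_gt_of_ne hz with h'' | h''
        · exact Or.inl ⟨h, h''⟩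
        · exact Or.inr ⟨h'', h'⟩
    by_cases h : z ∈ Icc (-L) L
    · rw [indicator_of_mem h, indicator_of_mem (this.2 h)]
    · rw [indicator_of_notMem h, indicator_of_notMem (fun h' => h (this.1 h'))]

lemma integral_comp_affine {f : ℝ → ℝ} (hf : Integrable f) {δ : ℝ} (hδ : δ ≠ 0) (β : ℝ) :
    Integrable (fun x => f (δ * x + β)) ∧ ∫ x, f (δ * x + β) = |δ|⁻¹ * ∫ x, f x := by
  refine ⟨(hf.comp_add_right β).comp_mul_left' hδ, ?_⟩
  rw [Measure.integral_comp_mul_left (fun y => f (y + β)) δ, integral_add_right_eq_self f β,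
    abs_inv, smul_eq_mul]

/-- One copy of `H` is bounded by `1` and the other by `W`. In the variables `U` and `V - U` the
majorant separates, and the singularity in `V - U` is integrable on `[-L, L]`. -/
theorem exists_integral_prod_le (L : ℝ) :
    ∃ C : ℝ, 0 ≤ C ∧ ∀ {δ β D : ℝ} {W : ℝ → ℝ} {H : ℝ → ℂ} {J : ℝ → ℝ → ℂ}, δ ≠ 0 → 0 ≤ D →
      Integrable W → (∀ x, W x ≤ 1) → (∀ x, ‖H x‖ ≤ W x) →
      (∀ U V, V - U ∉ Icc (-L) L → J U V = 0) →
      (∀ U V, U ≠ V → δ * U + β ≠ 0 →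
        ‖J U V‖ ≤ D * (1 + 1 / Real.sqrt (|V - U| * |δ * U + β|))) →
      ∫ p : ℝ × ℝ, ‖H p.1‖ * ‖H p.2‖ * ‖J p.1 p.2‖ ∂(volume.prod volume) ≤
        C * D * ((∫ x, W x) + |δ|⁻¹) := by
  set g₁ : ℝ → ℝ := (Icc (-L) L).indicator fun _ => 1 with hg₁
  have hg₁i : Integrable g₁ :=
    (integrable_indicator_iff measurableSet_Icc).2 (integrableOn_const (by simp))
  have hg₁0 : ∀ x, 0 ≤ g₁ x := fun x => indicator_nonneg (fun _ _ => zero_le_one) _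
  set g₂ := truncInvSqrt L with hg₂
  have hg₂i : Integrable g₂ := integrable_truncInvSqrt L
  have hI1 : 0 ≤ ∫ x, g₁ x := integral_nonneg hg₁0
  have hI2 : 0 ≤ ∫ x, g₂ x := integral_nonneg (truncInvSqrt_nonneg L)
  have hI3 : 0 ≤ ∫ x, truncInvSqrt 1 x := integral_nonneg (truncInvSqrt_nonneg 1)
  refine ⟨(∫ x, g₁ x) + (∫ x, g₂ x) * (1 + ∫ x, truncInvSqrt 1 x), by positivity, ?_⟩
  intro δ β D W H J hδ hD hW hW1 hHW hJ0 hJ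
  have hW0 : ∀ x, 0 ≤ W x := fun x => (norm_nonneg _).trans (hHW x)
  obtain ⟨hfi, hfI⟩ := integral_comp_affine (integrable_truncInvSqrt 1) hδ β
  -- This dominates `W x / √|δ x + β|`: near the singularity `W ≤ 1` is used, and away from it the
  -- inverse root is at most `1`. The second summand contributes the multiple of `|δ|⁻¹`.
  set f₂ : ℝ → ℝ := fun x => W x + truncInvSqrt 1 (δ * x + β) with hf₂
  have hf₂i : Integrable f₂ := hW.add hfi
  have hf₂0 : ∀ x, 0 ≤ f₂ x := fun x => add_nonneg (hW0 x) (truncInvSqrt_nonneg _ _)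
  obtain ⟨ha, ha'⟩ := integrable_mul_comp_neg_add hW hg₁i
  obtain ⟨hb, hb'⟩ := integrable_mul_comp_neg_add hf₂i hg₂i
  have hne1 : ∀ᵐ p : ℝ × ℝ ∂(volume.prod volume), p.1 ≠ p.2 := by
    have h0 : ∀ᵐ z : ℝ, z ≠ 0 := by simp [ae_iff]
    have hmp := measurePreserving_prod_neg_add (volume : Measure ℝ) (volume : Measure ℝ)
    have := (Measure.quasiMeasurePreserving_snd.comp hmp.quasiMeasurePreserving).ae h0
    filter_upwards [this] with p hp heq
    exact hp (by simp [heq])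
  have hne2 : ∀ᵐ p : ℝ × ℝ ∂(volume.prod volume), δ * p.1 + β ≠ 0 := by
    have h0 : ∀ᵐ z : ℝ, z ≠ -β / δ := by simp [ae_iff]
    have := Measure.quasiMeasurePreserving_fst (μ := (volume : Measure ℝ))
      (ν := (volume : Measure ℝ)) |>.ae h0
    filter_upwards [this] with p hp heq
    exact hp (by field_simp; linarith)
  have hle : ∫ p : ℝ × ℝ, ‖H p.1‖ * ‖H p.2‖ * ‖J p.1 p.2‖ ∂(volume.prod volume) ≤
      ∫ p : ℝ × ℝ, D * (W p.1 * g₁ (-p.1 + p.2) + f₂ p.1 * g₂ (-p.1 + p.2))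
        ∂(volume.prod volume) := by
    refine integral_mono_of_nonneg (Filter.Eventually.of_forall fun p => by positivity)
      ((ha.add hb).const_mul D) ?_
    filter_upwards [hne1, hne2] with p hp1 hp2
    by_cases hL : p.2 - p.1 ∈ Icc (-L) L
    · have hL' : -p.1 + p.2 ∈ Icc (-L) L := by rwa [neg_add_eq_sub]
      have e1 : g₁ (-p.1 + p.2) = 1 := indicator_of_mem hL' _
      have e2 : g₂ (-p.1 + p.2) = 1 / Real.sqrt |p.2 - p.1| := by
        rw [hg₂, truncInvSqrt, indicator_of_mem hL', neg_add_eq_sub]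
      rw [e1, e2, mul_one]
      have e3 : W p.1 * (1 / Real.sqrt |δ * p.1 + β|) ≤ f₂ p.1 := by
        simp only [hf₂]
        rcases le_or_gt |δ * p.1 + β| 1 with h | h
        · rw [truncInvSqrt, indicator_of_mem
            (show δ * p.1 + β ∈ Icc (-1 : ℝ) 1 from abs_le.1 h)]
          calc _ ≤ 1 * (1 / Real.sqrt |δ * p.1 + β|) := by
                have := hW1 p.1; gcongr
            _ ≤ _ := by linarith [hW0 p.1]
        · have h1 : 1 / Real.sqrt |δ * p.1 + β| ≤ 1 := by
            rw [div_le_one (Real.sqrt_pos.2 (by linarith))]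
            exact Real.one_le_sqrt.2 h.le
          calc _ ≤ W p.1 * 1 := by have := hW0 p.1; gcongr
            _ ≤ _ := by linarith [truncInvSqrt_nonneg 1 (δ * p.1 + β)]
      have e4 : 1 / Real.sqrt (|p.2 - p.1| * |δ * p.1 + β|) =
          (1 / Real.sqrt |δ * p.1 + β|) * (1 / Real.sqrt |p.2 - p.1|) := by
        rw [Real.sqrt_mul (abs_nonneg _)]; ring
      calc _ ≤ W p.1 * 1 * (D * (1 + 1 / Real.sqrt (|p.2 - p.1| * |δ * p.1 + β|))) := by
            have h1 := hHW p.1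
            have h2 := (hHW p.2).trans (hW1 p.2)
            have h3 := hJ p.1 p.2 hp1 hp2
            have h4 := hW0 p.1
            gcongr
        _ = D * (W p.1 + W p.1 * (1 / Real.sqrt |δ * p.1 + β|) *
            (1 / Real.sqrt |p.2 - p.1|)) := by rw [e4]; ring
        _ ≤ _ := by gcongr
    · rw [hJ0 p.1 p.2 hL, norm_zero, mul_zero]
      have := hW0 p.1
      have := hf₂0 p.1
      have := hg₁0 (-p.1 + p.2)
      have := truncInvSqrt_nonneg L (-p.1 + p.2)
      positivity
  refine hle.trans ?_
  rw [integral_const_mul, integral_add ha hb, ha', hb', integral_add hW hfi, hfI]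
  have hw : 0 ≤ ∫ x, W x := integral_nonneg hW0
  have hd : 0 ≤ |δ|⁻¹ := by positivity
  set w := ∫ x, W x
  set a := ∫ x, g₁ x
  set b := ∫ x, g₂ x
  set e := ∫ x, truncInvSqrt 1 x
  have : (a + b * (1 + e)) * D * (w + |δ|⁻¹) - D * (w * a + (w + |δ|⁻¹ * e) * b) =
    D * (a * |δ|⁻¹ + b * |δ|⁻¹ + b * e * w) := by ring
  have h9 : 0 ≤ D * (a * |δ|⁻¹ + b * |δ|⁻¹ + b * e * w) := by positivity
  linarith

/-! ### The bilinear estimate in scaled coordinates -/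

/-- The function with frequency profile `χ` and phase `c n r^{n+1} + B r^n`, `r = |ξ|^{1/n}`. -/
def waveFn (n : ℕ) (χ : ℝ → ℂ) (r₁ r₂ c B e y : ℝ) : ℂ :=
  ∫ r in r₁..r₂, Complex.exp (Complex.I * (c * n * r ^ (n + 1) + (B + e * y) * r ^ n : ℝ)) *
    (n * r ^ (n - 1) * χ r)

/-- The hypothesis makes `p` a critical point of the phase; splitting off the critical value `-c p ^
(n + 1)` leaves `c` times `monoPhase`. -/
lemma waveFn_eq {n : ℕ} {χ : ℝ → ℂ} {r₁ r₂ c B e y p : ℝ} (h : -(c * (n + 1) * p) = B + e * y) :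
    waveFn n χ r₁ r₂ c B e y =
      Complex.exp (Complex.I * (-c * p ^ (n + 1) : ℝ)) * oscAmp n χ r₁ r₂ c p := by
  unfold waveFn oscAmp
  rw [← intervalIntegral.integral_const_mul]
  congr 1
  ext r
  rw [← mul_assoc (Complex.exp _) (Complex.exp _), ← Complex.exp_add, ← mul_add, ← Complex.ofReal_add, monoPhase, ← h]
  congr 4
  ring

lemma continuous_waveFn (n : ℕ) {χ : ℝ → ℂ} (hχ : Continuous χ) (r₁ r₂ c B e : ℝ) :
    Continuous (waveFn n χ r₁ r₂ c B e) := by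
  unfold waveFn
  apply intervalIntegral.continuous_parametric_intervalIntegral_of_continuous'
  fun_prop

/-- The weight `ρ₁(s) / ((n + 1) s^n)` that comes from `τ = t^{n+1}`. -/
def bumpQuot (n : ℕ) (ρ₁ : ℝ → ℝ) (s : ℝ) : ℝ := ρ₁ s / ((n + 1) * s ^ n)

lemma contDiffOn_bumpQuot (n : ℕ) {ρ₁ : ℝ → ℝ} (hρ : ContDiff ℝ ∞ ρ₁) :
    ContDiffOn ℝ 1 (bumpQuot n ρ₁) (Ioi 0) := by
  have h1 : ContDiff ℝ 1 ρ₁ := hρ.of_le (by simp)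
  refine h1.contDiffOn.div (ContDiff.contDiffOn (by fun_prop)) fun s hs => ?_
  have : (0 : ℝ) < s := hs
  positivity

/-- The substitution is `X = U - t ^ (n + 1)`. Its Jacobian turns `ρ₁` into `bumpQuot`, and `κ`, `β`
are the values for which the stationary point at `y = M (δ U - t)` is `κ (t - (δ U + β))`. -/
lemma integral_wave_eq_integral_rootKernel {n : ℕ} {χ : ℝ → ℂ}
    {ρ₁ : ℝ → ℝ} (hρ0 : ∀ s, s ∉ Icc (1 / 2 : ℝ) 2 → ρ₁ s = 0) {r₁ r₂ c B e δ M : ℝ}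
    (hc : c ≠ 0) (he : e ≠ 0) (hM : M ≠ 0) (G : ℝ → ℂ) (U : ℝ) :
    ∫ t in (1 / 2 : ℝ)..2, waveFn n χ r₁ r₂ c B e (M * (δ * U - t)) * G (U - t ^ (n + 1)) *
        (ρ₁ t : ℂ) =
      ∫ X, rootKernel n (bumpQuot n ρ₁) (oscAmp n χ r₁ r₂ c) c (e * M / (c * (n + 1))) δ
        (B / (e * M)) X U * G X := by
  set κ := e * M / (c * (n + 1)) with hκ
  set β := B / (e * M) with hβ
  have hn1 : (0 : ℝ) < n + 1 := by positivity
  have hb0 : ∀ s, s ∉ Icc (1 / 2 : ℝ) 2 → bumpQuot n ρ₁ s = 0 := fun s hs => by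
    rw [bumpQuot, hρ0 s hs, zero_div]
  set g : ℝ → ℂ := fun X => rootKernel n (bumpQuot n ρ₁) (oscAmp n χ r₁ r₂ c) c κ δ β X U * G X
    with hg
  have hle : U - 2 ^ (n + 1) ≤ U - (1 / 2 : ℝ) ^ (n + 1) := by
    have : (1 / 2 : ℝ) ^ (n + 1) ≤ 2 ^ (n + 1) :=
      pow_le_pow_left₀ (by norm_num) (by norm_num) _
    linarith
  have h1 : ∫ X, g X = ∫ X in (U - 2 ^ (n + 1))..(U - (1 / 2) ^ (n + 1)), g X := by
    rw [intervalIntegral.integral_of_le hle, ← integral_Icc_eq_integral_Ioc,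
      setIntegral_eq_integral_of_forall_compl_eq_zero fun X hX => ?_]
    simp only [hg]
    rw [rootKernel_eq_zero hb0 _ _ _ _ _ hX, zero_mul]
  have h2 := intervalIntegral.integral_deriv_smul_comp_of_deriv_nonpos (a := (1 / 2 : ℝ)) (b := 2)
    (f := fun t => U - t ^ (n + 1)) (f' := fun t => -((n + 1 : ℕ) * t ^ n)) (g := g)
    (Continuous.continuousOn (by fun_prop))
    (fun t _ => by
      simpa using (hasDerivAt_pow (n + 1) t).const_sub U)
    (fun t ht => by
      have : 0 < t := by
        have := ht.1; norm_num at this; linarith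
      exact neg_nonpos.2 (by positivity))
  rw [h1, intervalIntegral.integral_symm (U - (1 / 2) ^ (n + 1)), ← h2, ← intervalIntegral.integral_neg]
  apply intervalIntegral.integral_congr
  intro t ht
  rw [uIcc_of_le (by norm_num)] at ht
  have ht0 : 0 < t := by linarith [ht.1]
  have hlt : U - t ^ (n + 1) < U := by have := pow_pos ht0 (n + 1); linarith
  simp only [Function.comp, hg, rootKernel, if_pos hlt, sub_sub_cancel, pow_nthRoot ht0.le]
  rw [waveFn_eq (p := κ * (t - (δ * U + β))) (by
    rw [hκ, hβ]; field_simp; ring)]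
  have h3 : ((n : ℂ) + 1) ≠ 0 := by exact_mod_cast Nat.succ_ne_zero n
  have h4 : (t : ℂ) ≠ 0 := by exact_mod_cast ht0.ne'
  rw [Complex.real_smul, bumpQuot]
  push_cast
  field_simp

/-- Since `|c|` is comparable to `M` and `|e| = 2 π`, the quantity `|κ|` stays between positive
constants, so the kernel bound is uniform and `|c| ^ (-3/2)` becomes `M ^ (-3/2)`. -/
theorem exists_scaled_estimate {n : ℕ} (hn : 1 ≤ n) {χ : ℝ → ℂ} (hχ : ContDiff ℝ ∞ χ)
    {r₁ r₂ : ℝ} (h0 : 0 < r₁) (hr : r₁ ≤ r₂) (hχ₁ : χ r₁ = 0) (hχ₂ : χ r₂ = 0)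
    {ρ₁ : ℝ → ℝ} (hρ : IsBump ρ₁) {c₁ c₂ : ℝ} (hc₁ : 0 < c₁) (hc₂ : 0 < c₂) :
    ∃ C : ℝ, 0 ≤ C ∧ ∀ {M c B e δ g : ℝ} {W : ℝ → ℝ} {H G : ℝ → ℂ}, 0 < M → c₁ * M ≤ |c| →
      |c| ≤ c₂ * M → |e| = 2 * Real.pi → δ ≠ 0 → Integrable W → (∀ x, W x ≤ 1) →
      AEStronglyMeasurable H → (∀ x, ‖H x‖ ≤ W x) → Continuous G → (∀ x, ‖G x‖ ≤ g) →
      MemLp G 2 →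
      ‖∫ U, H U * ∫ t in (1 / 2 : ℝ)..2, waveFn n χ r₁ r₂ c B e (M * (δ * U - t)) *
        G (U - t ^ (n + 1)) * (ρ₁ t : ℂ)‖ ^ 2 ≤
      C / (M * Real.sqrt M) * ((∫ x, W x) + |δ|⁻¹) * ∫ x, ‖G x‖ ^ 2 := by
  have hρ0 : ∀ s, s ∉ Icc (1 / 2 : ℝ) 2 → ρ₁ s = 0 := fun s hs => by
    by_contra h; exact hs (hρ.2 h)
  have hb := contDiffOn_bumpQuot n hρ.1
  have hb0 : ∀ s, s ∉ Icc (1 / 2 : ℝ) 2 → bumpQuot n ρ₁ s = 0 := fun s hs => by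
    rw [bumpQuot, hρ0 s hs, zero_div]
  have hbK : ContinuousOn (bumpQuot n ρ₁) (Icc (1 / 2 : ℝ) 2) :=
    hb.continuousOn.mono fun x hx => (by linarith [hx.1] : (0 : ℝ) < x)
  have hbm := measurable_of_continuousOn_Icc hbK hb0
  obtain ⟨C₀, hC₀⟩ := isCompact_Icc.exists_bound_of_continuousOn hbK
  have hC₀0 : 0 ≤ C₀ := (norm_nonneg _).trans (hC₀ 1 ⟨by norm_num, by norm_num⟩)
  have hbC : ∀ s, |bumpQuot n ρ₁ s| ≤ C₀ := fun s => by
    by_cases h : s ∈ Icc (1 / 2 : ℝ) 2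
    · exact hC₀ s h
    · rw [hb0 s h, abs_zero]; exact hC₀0
  have hn1 : (0 : ℝ) < n + 1 := by positivity
  have hπ := Real.pi_pos
  obtain ⟨Ka, hKa, ha⟩ := oscAmp_norm_le (n := n) hχ hr
  obtain ⟨CJ, hCJ, hJ⟩ := exists_integral_rootKernel_le hn hχ h0 hr hχ₁ hχ₂ hb hb0
    (κ₁ := 2 * Real.pi / (c₂ * (n + 1))) (by positivity) (2 * Real.pi / (c₁ * (n + 1)))
  obtain ⟨CS, hCS, hS⟩ := exists_integral_prod_le (2 ^ (n + 1))
  refine ⟨CS * (CJ / (c₁ * Real.sqrt c₁)), by positivity, ?_⟩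
  intro M c B e δ g W H G hM hcl hcu he hδ hW hW1 hHm hHW hGc hGb hG
  have hcM : 0 < |c| := (by positivity : 0 < c₁ * M).trans_le hcl
  have hc : c ≠ 0 := abs_pos.1 hcM
  have he0 : e ≠ 0 := abs_pos.1 (by rw [he]; positivity)
  have hH : Integrable H := hW.mono' hHm (Filter.Eventually.of_forall hHW)
  simp_rw [integral_wave_eq_integral_rootKernel hρ0 hc he0 hM.ne']
  set κ := e * M / (c * (n + 1)) with hκ
  set β := B / (e * M) with hβ
  set A := oscAmp n χ r₁ r₂ c with hA
  have hκa : |κ| = 2 * Real.pi * M / (|c| * (n + 1)) := by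
    rw [hκ, abs_div, abs_mul, abs_mul, he, abs_of_pos hM, abs_of_pos hn1]
  have hκ1 : 2 * Real.pi / (c₂ * (n + 1)) ≤ |κ| := by
    rw [hκa, div_le_div_iff₀ (by positivity) (by positivity)]
    calc _ = 2 * Real.pi * (n + 1) * |c| := by ring
      _ ≤ 2 * Real.pi * (n + 1) * (c₂ * M) := by gcongr
      _ = _ := by ring
  have hκ2 : |κ| ≤ 2 * Real.pi / (c₁ * (n + 1)) := by
    rw [hκa, div_le_div_iff₀ (by positivity) (by positivity)]
    calc _ = 2 * Real.pi * (n + 1) * (c₁ * M) := by ring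
      _ ≤ 2 * Real.pi * (n + 1) * |c| := by gcongr
      _ = _ := by ring
  have hAc : Continuous A := (differentiable_oscAmp n hχ r₁ r₂ c).continuous
  have hε₀ : (0 : ℝ) < (1 / 2) ^ (n + 1) := by positivity
  have htt := sq_norm_integral_kernel_le (k := rootKernel n (bumpQuot n ρ₁) A c κ δ β)
    (B := Ka / Real.sqrt |c| * C₀) (L := 2 ^ (n + 1)) (by positivity)
    (measurable_rootKernel hbm hAc c κ δ β)
    (fun X U => (norm_rootKernel_le _ _ _ _ _ _ _ _ _).trans (by
      have := ha c hc (κ * (nthRoot n (U - X) - (δ * U + β)))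
      have := hbC (nthRoot n (U - X))
      gcongr))
    (fun X U hX => rootKernel_eq_zero hb0 _ _ _ _ _ fun h => hX ⟨h.1, by linarith [h.2]⟩)
    hH hGc hGb hG
  refine htt.trans ?_
  -- For fixed `U` the kernel lives on a window of length less than `2 ^ (n + 1)` in `X`, so `J`
  -- vanishes when `|V - U|` exceeds that length.
  have hsum := hS (δ := δ) (β := β) (D := CJ / (|c| * Real.sqrt |c|)) (W := W) (H := H)
    (J := fun U V => ∫ X, rootKernel n (bumpQuot n ρ₁) A c κ δ β X U *
      conj (rootKernel n (bumpQuot n ρ₁) A c κ δ β X V)) hδ (by positivity) hW hW1 hHW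
    (fun U V hUV => by
      refine integral_eq_zero_of_ae (Filter.Eventually.of_forall fun X => ?_)
      by_contra hne
      have h1 : X ∈ Icc (U - 2 ^ (n + 1)) (U - (1 / 2) ^ (n + 1)) := by
        by_contra h; exact hne (by simp [rootKernel_eq_zero hb0 _ _ _ _ _ h])
      have h2 : X ∈ Icc (V - 2 ^ (n + 1)) (V - (1 / 2) ^ (n + 1)) := by
        by_contra h; exact hne (by simp [rootKernel_eq_zero hb0 _ _ _ _ _ h])
      exact hUV ⟨by linarith [h1.1, h1.2, h2.1, h2.2], by linarith [h1.1, h1.2, h2.1, h2.2]⟩)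
    (fun U V hUV hα => hJ c κ δ β U V hc hκ1 hκ2 hUV hα)
  have hw : 0 ≤ ∫ x, W x := integral_nonneg fun x => (norm_nonneg _).trans (hHW x)
  have hd : CJ / (|c| * Real.sqrt |c|) ≤ CJ / (c₁ * Real.sqrt c₁) / (M * Real.sqrt M) := by
    rw [div_div]
    have h1 : Real.sqrt c₁ * Real.sqrt M ≤ Real.sqrt |c| := by
      rw [← Real.sqrt_mul hc₁.le]; exact Real.sqrt_le_sqrt hcl
    have h2 : c₁ * Real.sqrt c₁ * (M * Real.sqrt M) ≤ |c| * Real.sqrt |c| := by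
      calc _ = (c₁ * M) * (Real.sqrt c₁ * Real.sqrt M) := by ring
        _ ≤ _ := by gcongr
    gcongr
  have hd0 : 0 ≤ |δ|⁻¹ := by positivity
  calc _ ≤ (∫ x, ‖G x‖ ^ 2) * (CS * (CJ / (c₁ * Real.sqrt c₁) / (M * Real.sqrt M)) *
        ((∫ x, W x) + |δ|⁻¹)) := by
        refine mul_le_mul_of_nonneg_left (hsum.trans ?_) (integral_nonneg fun x => by positivity)
        gcongr
    _ = _ := by ring

/-! ### The two halves of the odd weight -/

lemma oddBump_eq {ρ₁ : ℝ → ℝ} (hρ : IsBump ρ₁) (t : ℝ) : oddBump ρ₁ t = ρ₁ t - ρ₁ (-t) := by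
  have h0 : ∀ s, s ≤ 0 → ρ₁ s = 0 := fun s hs => by
    by_contra h; linarith [(hρ.2 h).1]
  unfold oddBump
  split_ifs with h1 h2
  · rw [h0 (-t) (by linarith), sub_zero]
  · rw [h0 t (by linarith), zero_sub]
  · have : t = 0 := le_antisymm (not_lt.1 h1) (not_lt.1 h2)
    simp [this]

lemma integral_mul_oddBump {ρ₁ : ℝ → ℝ} (hρ : IsBump ρ₁) {Z : ℝ → ℂ} (hZ : Continuous Z) :
    ∫ t, Z t * (oddBump ρ₁ t : ℂ) =
      (∫ t in (1 / 2 : ℝ)..2, Z t * (ρ₁ t : ℂ)) - ∫ t in (1 / 2 : ℝ)..2, Z (-t) * (ρ₁ t : ℂ) := by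
  have hρc : Continuous ρ₁ := hρ.1.continuous
  have hint : ∀ {Y : ℝ → ℂ}, Continuous Y → Integrable (fun t => Y t * (ρ₁ t : ℂ)) ∧
      ∫ t, Y t * (ρ₁ t : ℂ) = ∫ t in (1 / 2 : ℝ)..2, Y t * (ρ₁ t : ℂ) := by
    intro Y hY
    have hz : ∀ t, t ∉ Icc (1 / 2 : ℝ) 2 → Y t * (ρ₁ t : ℂ) = 0 := fun t ht => by
      have : ρ₁ t = 0 := by by_contra h; exact ht (hρ.2 h)
      rw [this, Complex.ofReal_zero, mul_zero]
    have hc : Continuous fun t => Y t * (ρ₁ t : ℂ) := by fun_prop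
    constructor
    · rw [← integrableOn_iff_integrable_of_support_subset (s := Icc (1 / 2 : ℝ) 2)
        (fun t ht => by by_contra h; exact ht (hz t h))]
      exact hc.continuousOn.integrableOn_compact isCompact_Icc
    · rw [intervalIntegral.integral_of_le (by norm_num), ← integral_Icc_eq_integral_Ioc,
        setIntegral_eq_integral_of_forall_compl_eq_zero hz]
  have h1 := hint hZ
  have hZn : Continuous fun t => Z (-t) := by fun_prop
  have h2 := hint hZn
  have h3 : Integrable fun t => Z t * (ρ₁ (-t) : ℂ) := by
    simpa using h2.1.comp_neg
  simp_rw [oddBump_eq hρ, Complex.ofReal_sub, mul_sub]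
  rw [integral_sub h1.1 h3, h1.2, ← h2.2, ← integral_neg_eq_self]
  simp

lemma waveFn_neg (n : ℕ) (χ : ℝ → ℂ) (r₁ r₂ c B e y : ℝ) :
    waveFn n χ r₁ r₂ c B (-e) (-y) = waveFn n χ r₁ r₂ c B e y := by
  unfold waveFn; simp

lemma exists_bound_waveFn (n : ℕ) {χ : ℝ → ℂ} (hχ : Continuous χ) (r₁ r₂ c B e : ℝ) :
    ∃ K : ℝ, ∀ y, ‖waveFn n χ r₁ r₂ c B e y‖ ≤ K := by
  have hc : Continuous fun r : ℝ => ((n : ℂ) * r ^ (n - 1) * χ r) := by fun_prop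
  obtain ⟨K, hK⟩ := (isCompact_uIcc (a := r₁) (b := r₂)).exists_bound_of_continuousOn
    hc.continuousOn
  refine ⟨K * |r₂ - r₁|, fun y => ?_⟩
  refine intervalIntegral.norm_integral_le_of_norm_le_const fun r hr => ?_
  rw [norm_mul, mul_comm Complex.I, Complex.norm_exp_ofReal_mul_I, one_mul]
  exact hK r (uIoc_subset_uIcc hr)

/-- The bilinear estimate with the odd weight, in scaled coordinates. -/
theorem exists_scaled_oddBump_estimate {n : ℕ} (hn : 1 ≤ n) {χ : ℝ → ℂ} (hχ : ContDiff ℝ ∞ χ)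
    {r₁ r₂ : ℝ} (h0 : 0 < r₁) (hr : r₁ ≤ r₂) (hχ₁ : χ r₁ = 0) (hχ₂ : χ r₂ = 0)
    {ρ₁ : ℝ → ℝ} (hρ : IsBump ρ₁) {c₁ c₂ : ℝ} (hc₁ : 0 < c₁) (hc₂ : 0 < c₂) :
    ∃ C : ℝ, 0 ≤ C ∧ ∀ {M c B e δ g : ℝ} {W : ℝ → ℝ} {H G : ℝ → ℂ}, 0 < M → c₁ * M ≤ |c| →
      |c| ≤ c₂ * M → |e| = 2 * Real.pi → δ ≠ 0 → Integrable W → (∀ x, W x ≤ 1) →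
      AEStronglyMeasurable H → (∀ x, ‖H x‖ ≤ W x) → Continuous G → (∀ x, ‖G x‖ ≤ g) →
      MemLp G 2 →
      ‖∫ U, H U * ∫ t, waveFn n χ r₁ r₂ c B e (M * (δ * U - t)) *
        G (U - t ^ (n + 1)) * (oddBump ρ₁ t : ℂ)‖ ≤
      C * Real.sqrt (1 / (M * Real.sqrt M) * ((∫ x, W x) + |δ|⁻¹) * ∫ x, ‖G x‖ ^ 2) := by
  obtain ⟨C, hC, hmain⟩ := exists_scaled_estimate hn hχ h0 hr hχ₁ hχ₂ hρ hc₁ hc₂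
  refine ⟨2 * Real.sqrt C, by positivity, ?_⟩
  intro M c B e δ g W H G hM hcl hcu he hδ hW hW1 hHm hHW hGc hGb hG
  set F := waveFn n χ r₁ r₂ c B e with hF
  have hFc : Continuous F := continuous_waveFn n hχ.continuous _ _ _ _ _
  obtain ⟨K, hK⟩ := exists_bound_waveFn n hχ.continuous r₁ r₂ c B e
  have hK0 : 0 ≤ K := (norm_nonneg _).trans (hK 0)
  have hg0 : 0 ≤ g := (norm_nonneg _).trans (hGb 0)
  have hρc : Continuous ρ₁ := hρ.1.continuous
  obtain ⟨R, hR⟩ := (isCompact_uIcc (a := (1 / 2 : ℝ)) (b := 2)).exists_bound_of_continuousOn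
    hρc.continuousOn
  set T₁ : ℝ → ℂ := fun U => ∫ t in (1 / 2 : ℝ)..2, F (M * (δ * U - t)) *
    G (U - t ^ (n + 1)) * (ρ₁ t : ℂ) with hT₁
  set T₂ : ℝ → ℂ := fun U => ∫ t in (1 / 2 : ℝ)..2, F (M * (δ * U - -t)) *
    G (U - (-t) ^ (n + 1)) * (ρ₁ t : ℂ) with hT₂
  have hH : Integrable H := hW.mono' hHm (Filter.Eventually.of_forall hHW)
  have hTb : ∀ {X Y : ℝ → ℝ → ℝ}, Continuous (fun p : ℝ × ℝ => X p.1 p.2) →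
      Continuous (fun p : ℝ × ℝ => Y p.1 p.2) → Integrable fun U => H U *
      ∫ t in (1 / 2 : ℝ)..2, F (X U t) * G (Y U t) * (ρ₁ t : ℂ) := by
    intro X Y hX hY
    refine hH.mul_bdd (c := K * g * R * |2 - 1 / 2|) (Continuous.aestronglyMeasurable ?_)
      (Filter.Eventually.of_forall fun U => ?_)
    · apply intervalIntegral.continuous_parametric_intervalIntegral_of_continuous'
      exact ((hFc.comp hX).mul (hGc.comp hY)).mul
        (Complex.continuous_ofReal.comp (hρc.comp continuous_snd))
    · refine intervalIntegral.norm_integral_le_of_norm_le_const fun t ht => ?_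
      rw [norm_mul, norm_mul, Complex.norm_real]
      have := hK (X U t)
      have := hGb (Y U t)
      have := hR t (uIoc_subset_uIcc ht)
      gcongr
  have hi₁ : Integrable fun U => H U * T₁ U := hTb (by fun_prop) (by fun_prop)
  have hi₂ : Integrable fun U => H U * T₂ U := hTb (by fun_prop) (by fun_prop)
  have hsplit : ∫ U, H U * ∫ t, F (M * (δ * U - t)) * G (U - t ^ (n + 1)) * (oddBump ρ₁ t : ℂ) =
      (∫ U, H U * T₁ U) - ∫ U, H U * T₂ U := by
    rw [← integral_sub hi₁ hi₂]
    refine integral_congr_ae (Filter.Eventually.of_forall fun U => ?_)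
    simp only
    rw [integral_mul_oddBump hρ (Z := fun t => F (M * (δ * U - t)) * G (U - t ^ (n + 1)))
      (by fun_prop), mul_sub]
  set E := 1 / (M * Real.sqrt M) * ((∫ x, W x) + |δ|⁻¹) * ∫ x, ‖G x‖ ^ 2 with hE
  have hEC : C / (M * Real.sqrt M) * ((∫ x, W x) + |δ|⁻¹) * ∫ x, ‖G x‖ ^ 2 = C * E := by
    rw [hE]; ring
  have hfin : ∀ z : ℂ, ‖z‖ ^ 2 ≤ C * E → ‖z‖ ≤ Real.sqrt C * Real.sqrt E := fun z hz => by
    rw [← Real.sqrt_mul hC]; exact Real.le_sqrt_of_sq_le hz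
  have hb₁ : ‖∫ U, H U * T₁ U‖ ≤ Real.sqrt C * Real.sqrt E :=
    hfin _ ((hmain hM hcl hcu he hδ hW hW1 hHm hHW hGc hGb hG).trans hEC.le)
  have hneg : ∀ y, F y = waveFn n χ r₁ r₂ c B (-e) (-y) := fun y => (waveFn_neg _ _ _ _ _ _ _ _).symm
  have hb₂ : ‖∫ U, H U * T₂ U‖ ≤ Real.sqrt C * Real.sqrt E := by
    apply hfin
    -- The half `t < 0` is reflected to `t > 0` and the sign is moved into `e`. For even `n + 1` the
    -- argument of `G` is unchanged and `δ` becomes `-δ`; for odd `n + 1` the variable `U` is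
    -- reflected as well, together with `W`, `H` and `G`. This is why both signs of `e` and `δ` are
    -- admitted in `exists_scaled_estimate`.
    rcases Nat.even_or_odd (n + 1) with hpar | hpar
    · have h1 : T₂ = fun U => ∫ t in (1 / 2 : ℝ)..2, waveFn n χ r₁ r₂ c B (-e)
          (M * (-δ * U - t)) * G (U - t ^ (n + 1)) * (ρ₁ t : ℂ) := by
        funext U
        simp only [hT₂, hpar.neg_pow, hneg]
        congr 1
        funext t
        ring_nf
      have h2 := hmain (B := B) hM hcl hcu (e := -e) (by rwa [abs_neg]) (neg_ne_zero.2 hδ) hW hW1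
        hHm hHW hGc hGb hG
      rw [h1]
      rw [abs_neg, hEC] at h2
      exact h2
    · have h1 : ∀ U, T₂ (-U) = ∫ t in (1 / 2 : ℝ)..2, waveFn n χ r₁ r₂ c B (-e)
          (M * (δ * U - t)) * G (-(U - t ^ (n + 1))) * (ρ₁ t : ℂ) := fun U => by
        simp only [hT₂, hpar.neg_pow, hneg]
        congr 1
        funext t
        ring_nf
      have hmp := Measure.measurePreserving_neg (volume : Measure ℝ)
      have h2 := hmain (B := B) (W := fun x => W (-x)) (H := fun x => H (-x))
        (G := fun x => G (-x)) (g := g) hM hcl hcu (e := -e) (by rwa [abs_neg]) hδ hW.comp_neg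
        (fun x => hW1 _) (hHm.comp_measurePreserving hmp) (fun x => hHW _) (by fun_prop)
        (fun x => hGb _) (hG.comp_measurePreserving hmp)
      rw [← integral_neg_eq_self]
      simp only [h1]
      rw [integral_neg_eq_self W, integral_neg_eq_self (fun x => ‖G x‖ ^ 2), hEC] at h2
      exact h2
  rw [hsplit]
  calc _ ≤ _ := norm_sub_le _ _
    _ ≤ Real.sqrt C * Real.sqrt E + Real.sqrt C * Real.sqrt E := add_le_add hb₁ hb₂
    _ = _ := by ring

/-! ### Fourier transforms of `L¹ ∩ L²` functions -/

lemma integral_smul_fourierInv_eq {u : ℝ → ℂ} (hu : Integrable u) (g : 𝓢(ℝ, ℂ)) :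
    ∫ x, g x • 𝓕⁻ u x = ∫ x, (𝓕⁻ g) x • u x := by
  have h1 : ∫ x, 𝓕 (fun y : ℝ => g (-y)) x • u x = ∫ x, g (-x) • 𝓕 u x := by
    have h := VectorFourier.integral_fourierIntegral_smul_eq_flip (μ := volume) (ν := volume)
      (e := Real.fourierChar) (L := innerₗ ℝ) (f := fun y : ℝ => g (-y)) (g := u)
      Real.continuous_fourierChar continuous_inner g.integrable.comp_neg hu
    rwa [flip_innerₗ] at h
  have h2 : ∀ x, (𝓕⁻ g) x = 𝓕 (fun y : ℝ => g (-y)) x := fun x => by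
    rw [SchwartzMap.fourierInv_coe, Real.fourierInv_eq_fourier_comp_neg]
  simp only [h2, h1]
  rw [← integral_neg_eq_self]
  simp [Real.fourierInv_eq_fourier_neg]

/-- Both sides have the same pairing with every test function: the left by duality of tempered
distributions, the right by the multiplication formula. This links the integral in `fourierRestrict`
to Plancherel on `L²`. -/
lemma fourierInv_ae_eq {u : ℝ → ℂ} (h1 : Integrable u) (h2 : MemLp u 2) :
    ∀ᵐ x, (𝓕⁻ (h2.toLp u) : Lp (α := ℝ) ℂ 2) x = 𝓕⁻ u x := by
  have hc : Continuous (𝓕⁻ u) := by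
    rw [← Real.Lp.fourierTransformInv_toLp (memLp_one_iff_integrable.2 h1)]
    exact (Real.Lp.fourierTransformInv _).continuous
  refine ae_eq_of_integral_contDiff_smul_eq
    ((Lp.memLp _).locallyIntegrable (by norm_num)) hc.locallyIntegrable fun g hg hgc => ?_
  have hg₁ : HasCompactSupport (Complex.ofRealCLM ∘ g) := hgc.comp_left rfl
  have hg₂ : ContDiff ℝ ∞ (Complex.ofRealCLM ∘ g) := Complex.ofRealCLM.contDiff.comp hg
  set s : 𝓢(ℝ, ℂ) := hg₁.toSchwartzMap hg₂ with hs
  have hsx : ∀ x, s x = (g x : ℂ) := fun x => rfl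
  have e1 := DFunLike.congr_fun (Lp.fourierInv_toTemperedDistribution_eq (h2.toLp u)) s
  rw [TemperedDistribution.fourierInv_apply, Lp.toTemperedDistribution_apply,
    Lp.toTemperedDistribution_apply] at e1
  have e2 : ∫ x, (𝓕⁻ s) x • (h2.toLp u) x = ∫ x, (𝓕⁻ s) x • u x := by
    refine integral_congr_ae ?_
    filter_upwards [h2.coeFn_toLp] with x hx
    rw [hx]
  rw [e2, ← integral_smul_fourierInv_eq h1] at e1
  simpa only [hsx, Complex.real_smul, smul_eq_mul] using e1.symm

lemma integral_norm_sq_Lp (v : Lp (α := ℝ) ℂ 2) : ∫ x, ‖v x‖ ^ 2 = ‖v‖ ^ 2 := by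
  have h := L2.inner_def (𝕜 := ℂ) v v
  simp_rw [inner_self_eq_norm_sq_to_K] at h
  have h2 : ((∫ x, ‖v x‖ ^ 2 : ℝ) : ℂ) = ((‖v‖ ^ 2 : ℝ) : ℂ) := by
    rw [← integral_complex_ofReal]
    push_cast
    exact h.symm
  exact_mod_cast h2

/-- Plancherel for the inverse Fourier integral. -/
lemma memLp_fourierInv {u : ℝ → ℂ} (h1 : Integrable u) (h2 : MemLp u 2) :
    MemLp (𝓕⁻ u) 2 ∧ ∫ x, ‖𝓕⁻ u x‖ ^ 2 = ‖h2.toLp u‖ ^ 2 := by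
  have hae := fourierInv_ae_eq h1 h2
  have hm : MemLp (𝓕⁻ u) 2 := (memLp_congr_ae hae).1 (Lp.memLp _)
  refine ⟨hm, ?_⟩
  have hn := Lp.norm_fourier_eq (𝓕⁻ (h2.toLp u : Lp (α := ℝ) ℂ 2))
  rw [FourierTransform.fourier_fourierInv_eq] at hn
  rw [hn, ← integral_norm_sq_Lp]
  refine integral_congr_ae ?_
  filter_upwards [hae] with x hx
  rw [hx]

/-! ### The bounded representative -/

/-- The inverse transform of `f₃` is the reflection of `f₃hat`, which has the same norm. As `L^∞`
embeds injectively into distributions, the chosen representative is that reflection. -/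
lemma norm_linftyRep_le {f₃ : 𝓢'(ℝ, ℂ)} {f₃hat : Lp (α := ℝ) ℂ ∞}
    (h : 𝓕 f₃ = (f₃hat : 𝓢'(ℝ, ℂ))) :
    StronglyMeasurable (linftyRep (𝓕⁻ f₃)) ∧ ∀ᵐ x, ‖linftyRep (𝓕⁻ f₃) x‖ ≤ ‖f₃hat‖ := by
  unfold linftyRep
  split_ifs with hex
  swap
  · exact ⟨stronglyMeasurable_zero, Filter.Eventually.of_forall fun x => by simp⟩
  refine ⟨Lp.stronglyMeasurable _, ?_⟩
  have hg := hex.choose_spec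
  set g : Lp (α := ℝ) ℂ ∞ := hex.choose
  have hmp := Measure.measurePreserving_neg (volume : Measure ℝ)
  set r : Lp (α := ℝ) ℂ ∞ := Lp.compMeasurePreserving (Neg.neg : ℝ → ℝ) hmp f₃hat with hr
  have hf : f₃ = 𝓕⁻ (f₃hat : 𝓢'(ℝ, ℂ)) := by rw [← h, FourierTransform.fourierInv_fourier_eq]
  have hgr : (g : 𝓢'(ℝ, ℂ)) = (r : 𝓢'(ℝ, ℂ)) := by
    rw [hg, hf]
    ext s
    rw [TemperedDistribution.fourierInv_apply, TemperedDistribution.fourierInv_apply,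
      Lp.toTemperedDistribution_apply, Lp.toTemperedDistribution_apply]
    have h1 : ∀ x, (𝓕⁻ (𝓕⁻ s)) x = s (-x) := fun x => by
      rw [SchwartzMap.fourierInv_coe, Real.fourierInv_eq_fourier_neg, ← SchwartzMap.fourier_coe,
        FourierTransform.fourier_fourierInv_eq]
    have h2 : ∫ x, s x • r x = ∫ x, s x • f₃hat (-x) := by
      refine integral_congr_ae ?_
      filter_upwards [Lp.coeFn_compMeasurePreserving f₃hat hmp] with x hx
      rw [hr, hx]; rfl
    rw [h2, ← integral_neg_eq_self]
    simp [h1]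
  have hgr' : g = r := by
    have hk := Lp.ker_toTemperedDistributionCLM_eq_bot (F := ℂ) (μ := (volume : Measure ℝ)) (p := ∞)
    exact LinearMap.ker_eq_bot.1 hk hgr
  have hn : ‖g‖ = ‖f₃hat‖ := by rw [hgr', hr, Lp.norm_compMeasurePreserving]
  rw [← hn]
  have hlt := (Lp.memLp g).eLpNorm_lt_top
  filter_upwards [ae_le_eLpNormEssSup (f := g) (μ := volume)] with x hx
  rw [Lp.norm_def, ← toReal_enorm]
  rw [← eLpNorm_exponent_top] at hx
  exact ENNReal.toReal_mono hlt.ne hx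

/-! ### The spatial truncation -/

lemma integral_spaceCutoff {φ : 𝓢(ℝ, ℝ)} (hφ : IsSpaceCutoff φ) : ∫ x, φ x = 1 := by
  have h := hφ.2.2
  rw [Real.fourier_eq'] at h
  simp only [inner_zero_right, mul_zero, Complex.ofReal_zero, zero_mul, Complex.exp_zero,
    one_smul] at h
  rw [integral_complex_ofReal] at h
  exact_mod_cast h

lemma integrable_dilate (φ : 𝓢(ℝ, ℝ)) (k : ℤ) : Integrable (dilate φ k) :=
  (φ.integrable.comp_mul_left' (by positivity)).const_mul _

lemma integral_dilate {φ : 𝓢(ℝ, ℝ)} (hφ : IsSpaceCutoff φ) (k : ℤ) : ∫ x, dilate φ k x = 1 := by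
  unfold dilate
  have h2 : (0 : ℝ) < 2 ^ (-k) := by positivity
  rw [integral_const_mul, Measure.integral_comp_mul_left (fun x => φ x), integral_spaceCutoff hφ,
    smul_eq_mul, mul_one, abs_of_pos (by positivity), mul_inv_cancel₀ h2.ne']

lemma dilate_nonneg {φ : 𝓢(ℝ, ℝ)} (hφ : IsSpaceCutoff φ) (k : ℤ) (x : ℝ) : 0 ≤ dilate φ k x :=
  mul_nonneg (by positivity) (hφ.1 _)

lemma smoothInd_nonneg {φ : 𝓢(ℝ, ℝ)} (hφ : IsSpaceCutoff φ) (k n : ℤ) (x : ℝ) :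
    0 ≤ smoothInd φ k n x :=
  integral_nonneg fun _ => dilate_nonneg hφ _ _

lemma smoothInd_le_one {φ : 𝓢(ℝ, ℝ)} (hφ : IsSpaceCutoff φ) (k n : ℤ) (x : ℝ) :
    smoothInd φ k n x ≤ 1 := by
  have h1 : ∫ y, dilate φ k (x - y) = 1 := by
    rw [integral_sub_left_eq_self (dilate φ k), integral_dilate hφ]
  rw [← h1]
  exact setIntegral_le_integral ((integrable_dilate φ k).comp_sub_left x)
    (Filter.Eventually.of_forall fun y => dilate_nonneg hφ _ _)

/-- Convolution with a function of mass one preserves the mass of the indicator. For `k = (d - 1) j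
+ m` this mass is `M / δ`. -/
lemma integral_smoothInd {φ : 𝓢(ℝ, ℝ)} (hφ : IsSpaceCutoff φ) (k n : ℤ) :
    Integrable (smoothInd φ k n) ∧ ∫ x, smoothInd φ k n x = 2 ^ k := by
  set I : Set ℝ := Icc ((2 : ℝ) ^ k * n) ((2 : ℝ) ^ k * (n + 1)) with hI
  have hi : Integrable (I.indicator fun _ => (1 : ℝ)) :=
    (integrable_indicator_iff measurableSet_Icc).2 (integrableOn_const (by simp))
  have heq : smoothInd φ k n =
      convolution (I.indicator fun _ => (1 : ℝ)) (dilate φ k) (ContinuousLinearMap.lsmul ℝ ℝ)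
        volume := by
    ext x
    simp only [smoothInd, convolution, ContinuousLinearMap.lsmul_apply, smul_eq_mul]
    rw [← integral_indicator measurableSet_Icc]
    refine integral_congr_ae (Filter.Eventually.of_forall fun y => ?_)
    by_cases hy : y ∈ I
    · exact (indicator_of_mem hy _).trans (by simp [indicator_of_mem hy])
    · simp only [indicator_of_notMem hy, zero_mul]
      exact indicator_of_notMem hy _
  rw [heq]
  refine ⟨hi.integrable_convolution _ (integrable_dilate φ k), ?_⟩
  rw [integral_convolution _ hi (integrable_dilate φ k), integral_dilate hφ,
    integral_indicator measurableSet_Icc]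
  have : (0 : ℝ) < 2 ^ k := by positivity
  simp [Real.volume_real_Icc]
  ring_nf
  rw [max_eq_left this.le]

/-! ### The two input functions -/

/-- The frequency cutoff in the variable `r = |ξ|^{1/n}`. -/
def freqProfile (n : ℕ) (Φ₁ : 𝓢(ℝ, ℂ)) (σ r : ℝ) : ℂ := 𝓕 Φ₁ (σ * r ^ n)

lemma contDiff_freqProfile (n : ℕ) (Φ₁ : 𝓢(ℝ, ℂ)) (σ : ℝ) :
    ContDiff ℝ ∞ (freqProfile n Φ₁ σ) :=
  ((𝓕 Φ₁).smooth ⊤).comp (contDiff_const.mul (contDiff_id.pow n))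

lemma freqProfile_eq_zero {n : ℕ} {Φ₁ : 𝓢(ℝ, ℂ)} (hΦ₁ : IsFreqCutoff Φ₁) {σ r : ℝ}
    (h : ¬(1 / 8 ≤ |σ * r ^ n| ∧ |σ * r ^ n| ≤ 19 / 8)) : freqProfile n Φ₁ σ r = 0 := by
  by_contra hne
  exact h (hΦ₁.2 _ hne)

lemma fourierRestrict_fourierInv (Φ : 𝓢(ℝ, ℂ)) (f : Lp (α := ℝ) ℂ 2) :
    fourierRestrict Φ (𝓕⁻ f) = 𝓕⁻ (fun ξ : ℝ => f ξ * 𝓕 Φ ξ) := by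
  unfold fourierRestrict
  rw [FourierTransform.fourier_fourierInv_eq]

lemma setIntegral_freqInterval {I : Set ℝ} (hI : IsFreqInterval I) :
    ∃ σ : ℝ, (σ = 1 ∨ σ = -1) ∧ ∀ g : ℝ → ℂ,
      ∫ x in I, g x = ∫ x in (1 / 16 : ℝ)..(39 / 16), g (σ * x) := by
  rcases hI with rfl | rfl
  · refine ⟨1, Or.inl rfl, fun g => ?_⟩
    rw [intervalIntegral.integral_of_le (by norm_num), integral_Icc_eq_integral_Ioc]
    simp
  · refine ⟨-1, Or.inr rfl, fun g => ?_⟩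
    simp only [neg_one_mul]
    rw [intervalIntegral.integral_comp_neg, intervalIntegral.integral_of_le (by norm_num),
      integral_Icc_eq_integral_Ioc]

/-- Putting `ξ = σ r ^ n` makes `|ξ| ^ ((n + 1) / n)` the monomial `r ^ (n + 1)`, so the phase
becomes polynomial. The sign `σ` depends only on the interval and is chosen before `a`, `b` and `f`.
-/
lemma fourierRestrict_eq_waveFn {n : ℕ} (hn : 1 ≤ n) (Φ₁ : 𝓢(ℝ, ℂ)) {r₁ r₂ : ℝ} (h₁ : 0 ≤ r₁)
    (h₂ : r₁ ≤ r₂) (hr₁ : r₁ ^ n = 1 / 16) (hr₂ : r₂ ^ n = 39 / 16) {I : Set ℝ}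
    (hI : IsFreqInterval I) : ∃ σ : ℝ, (σ = 1 ∨ σ = -1) ∧ ∀ (a b : ℝ) (f : Lp (α := ℝ) ℂ 2),
      f =ᵐ[volume] I.indicator (fun ξ => Complex.exp (Complex.I *
        ((a * |ξ| ^ ((n + 1 : ℝ) / n) + b * ξ : ℝ) : ℂ))) →
      fourierRestrict Φ₁ (𝓕⁻ f) =
        waveFn n (freqProfile n Φ₁ σ) r₁ r₂ (a / n) (b * σ) (2 * Real.pi * σ) := by
  obtain ⟨σ, hσ, hint⟩ := setIntegral_freqInterval hI
  refine ⟨σ, hσ, fun a b f hf => ?_⟩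
  have hIm : MeasurableSet I := by rcases hI with rfl | rfl <;> exact measurableSet_Icc
  have hn0 : (n : ℝ) ≠ 0 := by exact_mod_cast (by omega : n ≠ 0)
  have hσa : |σ| = 1 := by rcases hσ with rfl | rfl <;> simp
  ext y
  rw [fourierRestrict_fourierInv, Real.fourierInv_eq']
  set g : ℝ → ℂ := fun ξ => Complex.exp (((2 * Real.pi * (y * ξ) : ℝ) : ℂ) * Complex.I) *
    (Complex.exp (Complex.I * ((a * |ξ| ^ ((n + 1 : ℝ) / n) + b * ξ : ℝ) : ℂ)) * 𝓕 Φ₁ ξ) with hg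
  have e1 : ∫ v, Complex.exp (((2 * Real.pi * inner ℝ v y : ℝ) : ℂ) * Complex.I) •
      (f v * 𝓕 Φ₁ v) = ∫ v in I, g v := by
    rw [← integral_indicator hIm]
    refine integral_congr_ae ?_
    filter_upwards [hf] with v hv
    rw [hv]
    by_cases h : v ∈ I
    · rw [indicator_of_mem h, indicator_of_mem h]
      simp [hg]
    · rw [indicator_of_notMem h, indicator_of_notMem h]
      simp
  rw [e1, hint, ← hr₁, ← hr₂]
  have e2 := intervalIntegral.integral_deriv_smul_comp_of_deriv_nonneg (a := r₁) (b := r₂)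
    (f := fun r => r ^ n) (f' := fun r => n * r ^ (n - 1)) (g := fun x => g (σ * x))
    (by fun_prop) (fun r _ => hasDerivAt_pow n r) (fun r hr => by
      rw [min_eq_left h₂] at hr
      have : 0 ≤ r := h₁.trans hr.1.le
      positivity)
  rw [← e2]
  unfold waveFn
  apply intervalIntegral.integral_congr
  intro r hr
  rw [uIcc_of_le h₂] at hr
  have hr0 : 0 ≤ r := h₁.trans hr.1
  have e3 : |σ * r ^ n| ^ ((n + 1 : ℝ) / n) = r ^ (n + 1) := by
    rw [abs_mul, hσa, one_mul, abs_of_nonneg (by positivity), ← Real.rpow_natCast,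
      ← Real.rpow_mul hr0, mul_div_cancel₀ _ hn0, ← Real.rpow_natCast]
    norm_cast
  simp only [Function.comp, hg, Complex.real_smul, freqProfile, e3]
  rw [← mul_assoc (Complex.exp _) (Complex.exp _), ← Complex.exp_add]
  have e4 : ((2 * Real.pi * (y * (σ * r ^ n)) : ℝ) : ℂ) * Complex.I +
      Complex.I * ((a * r ^ (n + 1) + b * (σ * r ^ n) : ℝ) : ℂ) =
      Complex.I * ((a / n * n * r ^ (n + 1) + (b * σ + 2 * Real.pi * σ * y) * r ^ n : ℝ) : ℂ) := by
    rw [div_mul_cancel₀ _ hn0]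
    push_cast
    ring
  rw [e4]
  push_cast
  ring

/-- The profile is a product of two `L²` functions, hence integrable, which gives continuity and
boundedness. The quantitative bound is Plancherel with the supremum of `𝓕 Φ`. -/
lemma exists_fourierRestrict_bound (Φ : 𝓢(ℝ, ℂ)) :
    ∃ C : ℝ, 0 ≤ C ∧ ∀ f : Lp (α := ℝ) ℂ 2, Continuous (fourierRestrict Φ (𝓕⁻ f)) ∧
      (∃ g : ℝ, ∀ x, ‖fourierRestrict Φ (𝓕⁻ f) x‖ ≤ g) ∧ MemLp (fourierRestrict Φ (𝓕⁻ f)) 2 ∧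
      ∫ x, ‖fourierRestrict Φ (𝓕⁻ f) x‖ ^ 2 ≤ (C * ‖f‖) ^ 2 := by
  obtain ⟨C, hC⟩ : ∃ C : ℝ, ∀ ξ, ‖𝓕 Φ ξ‖ ≤ C :=
    ⟨_, fun ξ => (𝓕 Φ).toBoundedContinuousFunction.norm_coe_le_norm ξ⟩
  have hC0 : 0 ≤ C := (norm_nonneg _).trans (hC 0)
  refine ⟨C, hC0, fun f => ?_⟩
  rw [fourierRestrict_fourierInv]
  set u : ℝ → ℂ := fun ξ => f ξ * 𝓕 Φ ξ with hu
  have h1 : Integrable u := (Lp.memLp f).integrable_mul ((𝓕 Φ).memLp 2)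
  have h2 : MemLp u 2 := by
    refine (Lp.memLp f).of_le_mul (c := C) h1.1 (Filter.Eventually.of_forall fun ξ => ?_)
    rw [hu]
    simp only
    rw [norm_mul, mul_comm]
    exact mul_le_mul_of_nonneg_right (hC ξ) (norm_nonneg _)
  obtain ⟨h3, h4⟩ := memLp_fourierInv h1 h2
  have hco := Real.Lp.fourierTransformInv_toLp (memLp_one_iff_integrable.2 h1)
  refine ⟨?_, ⟨‖Real.Lp.fourierTransformInv (memLp_one_iff_integrable.2 h1).toLp‖, fun x => ?_⟩,
    h3, ?_⟩
  · rw [← hco]; exact (Real.Lp.fourierTransformInv _).continuous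
  · rw [← hco]; exact BoundedContinuousFunction.norm_coe_le_norm _ x
  · rw [h4]
    gcongr
    refine Lp.norm_le_mul_norm_of_ae_le_mul ?_
    filter_upwards [h2.coeFn_toLp] with ξ hξ
    rw [hξ, hu]
    simp only
    rw [norm_mul, mul_comm]
    exact mul_le_mul_of_nonneg_right (hC ξ) (norm_nonneg _)

/-! ### The trilinear form -/

/-- The outer `√δ` normalises the operator and `M` comes from `dx = M dU`; `M⁻¹ (M / δ)` is the mass
of the truncation in `U`, and `M⁻¹ S` is the squared norm of the rescaled `G`. What survives is `M ^
(-1/4)`. -/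
lemma scaling_identity {M δ S : ℝ} (hM : 0 < M) (hδ : 0 < δ) :
    Real.sqrt δ * (M * Real.sqrt (1 / (M * Real.sqrt M) * (M⁻¹ * (M / δ) + δ⁻¹) * (M⁻¹ * S))) =
      Real.sqrt 2 * Real.sqrt S / Real.sqrt (Real.sqrt M) := by
  have hs : 0 < Real.sqrt M := Real.sqrt_pos.2 hM
  have h1 : 1 / (M * Real.sqrt M) * (M⁻¹ * (M / δ) + δ⁻¹) * (M⁻¹ * S) =
      (2 * S / Real.sqrt M) * (δ * M ^ 2)⁻¹ := by
    field_simp; ring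
  have h2 : Real.sqrt (δ * M ^ 2)⁻¹ = (Real.sqrt δ * M)⁻¹ := by
    rw [Real.sqrt_inv, Real.sqrt_mul hδ.le, Real.sqrt_sq hM.le]
  have h3 : 0 < Real.sqrt δ := Real.sqrt_pos.2 hδ
  rw [h1, Real.sqrt_mul' _ (by positivity), h2, Real.sqrt_div' _ hs.le, Real.sqrt_mul (by norm_num)]
  field_simp

lemma decayExp_le {ε : ℝ} (hε : 0 < ε) {ℓ : ℕ} (hℓ : 1 ≤ ℓ) : decayExp ε ℓ ≤ 1 / 2 := by
  unfold decayExp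
  have h : (1 : ℝ) ≤ ℓ := by exact_mod_cast hℓ
  split_ifs
  · exact one_div_le_one_div_of_le (by norm_num) (by linarith)
  · exact one_div_le_one_div_of_le (by norm_num) (by linarith)

/-- A bound for the paired bilinear operator, in the original coordinates. -/
theorem exists_paired_bound {n : ℕ} (hn : 1 ≤ n) {χ : ℝ → ℂ} (hχ : ContDiff ℝ ∞ χ)
    {r₁ r₂ : ℝ} (h0 : 0 < r₁) (hr : r₁ ≤ r₂) (hχ₁ : χ r₁ = 0) (hχ₂ : χ r₂ = 0)
    {ρ₁ : ℝ → ℝ} (hρ : IsBump ρ₁) {c₁ c₂ : ℝ} (hc₁ : 0 < c₁) (hc₂ : 0 < c₂) :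
    ∃ C : ℝ, 0 ≤ C ∧ ∀ {M c B e δ g K : ℝ} {W : ℝ → ℝ} {h G : ℝ → ℂ}, 0 < M → c₁ * M ≤ |c| →
      |c| ≤ c₂ * M → |e| = 2 * Real.pi → 0 < δ → Integrable W → (∫ x, W x = M / δ) →
      (∀ x, 0 ≤ W x) → (∀ x, W x ≤ 1) → StronglyMeasurable h → (∀ᵐ x, ‖h x‖ ≤ K) →
      0 ≤ K → Continuous G → (∀ x, ‖G x‖ ≤ g) → MemLp G 2 →
      ‖∫ x, (Real.sqrt δ : ℂ) * (∫ t, waveFn n χ r₁ r₂ c B e (δ * x - M * t) *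
        G (x - M * t ^ (n + 1)) * (oddBump ρ₁ t : ℂ)) * (W x : ℂ) * conj (h x)‖ ≤
      C * (1 / Real.sqrt (Real.sqrt M)) * Real.sqrt (∫ x, ‖G x‖ ^ 2) * K := by
  obtain ⟨C, hC, hmain⟩ := exists_scaled_oddBump_estimate hn hχ h0 hr hχ₁ hχ₂ hρ hc₁ hc₂
  refine ⟨C * Real.sqrt 2, by positivity, ?_⟩
  intro M c B e δ g K W h G hM hcl hcu he hδ hW hWI hW0 hW1 hhm hhK hK hGc hGb hG
  -- a representative that is bounded everywhere
  set h' : ℝ → ℂ := {x | ‖h x‖ ≤ K}.indicator h with hh'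
  have hh'm : StronglyMeasurable h' :=
    hhm.indicator (measurableSet_le hhm.norm.measurable measurable_const)
  have hh'K : ∀ x, ‖h' x‖ ≤ K := fun x => by
    by_cases hx : x ∈ {x | ‖h x‖ ≤ K}
    · rw [hh', indicator_of_mem hx]; exact hx
    · rw [hh', indicator_of_notMem hx, norm_zero]; exact hK
  have hhae : ∀ᵐ x, h x = h' x := by
    filter_upwards [hhK] with x hx
    rw [hh', indicator_of_mem (show x ∈ {x | ‖h x‖ ≤ K} from hx)]
  set T : ℝ → ℂ := fun x => ∫ t, waveFn n χ r₁ r₂ c B e (δ * x - M * t) *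
        G (x - M * t ^ (n + 1)) * (oddBump ρ₁ t : ℂ) with hT
  -- Division by `K` normalises `H` to be dominated by the truncation. If `K = 0` then `h'`
  -- vanishes, and the quotient is `0` by convention.
  set H : ℝ → ℂ := fun x => (W (M * x) : ℂ) * (conj (h' (M * x)) / K) with hH
  have e1 : ∫ x, (Real.sqrt δ : ℂ) * T x * (W x : ℂ) * conj (h x) =
      (Real.sqrt δ * K * M : ℝ) * ∫ U, H U * T (M * U) := by
    have s1 : ∫ x, (Real.sqrt δ : ℂ) * T x * (W x : ℂ) * conj (h x) =
        ∫ x, (Real.sqrt δ * K : ℝ) * ((W x : ℂ) * (conj (h' x) / K) * T x) := by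
      refine integral_congr_ae ?_
      filter_upwards [hhae] with x hx
      rw [hx]
      rcases hK.eq_or_lt with hK0 | hK0
      · have : h' x = 0 := norm_le_zero_iff.1 (hK0 ▸ hh'K x)
        simp [this]
      · have : (K : ℂ) ≠ 0 := by exact_mod_cast hK0.ne'
        push_cast
        field_simp
    have s2 := Measure.integral_comp_mul_left
      (fun x => (W x : ℂ) * (conj (h' x) / K) * T x) M
    rw [s1, integral_const_mul]
    simp only [hH]
    rw [s2, abs_inv, abs_of_pos hM, Complex.real_smul]
    have : (M : ℂ) ≠ 0 := by exact_mod_cast hM.ne'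
    push_cast
    field_simp
  have e2 : ∀ U, T (M * U) = ∫ t, waveFn n χ r₁ r₂ c B e (M * (δ * U - t)) *
      (fun X => G (M * X)) (U - t ^ (n + 1)) * (oddBump ρ₁ t : ℂ) := fun U => by
    simp only [hT]
    congr 1
    funext t
    ring_nf
  have hWM : Integrable fun x => W (M * x) := hW.comp_mul_left' hM.ne'
  have hmul : Measurable fun x : ℝ => M * x := measurable_const_mul M
  have hGM : MemLp (fun X => G (M * X)) 2 := by
    rw [memLp_two_iff_integrable_sq_norm (by fun_prop : Continuous fun X =>
      G (M * X)).aestronglyMeasurable]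
    exact ((memLp_two_iff_integrable_sq_norm hGc.aestronglyMeasurable).1 hG).comp_mul_left' hM.ne'
  have e3 := hmain (B := B) (W := fun x => W (M * x)) (H := H) (G := fun X => G (M * X)) (g := g)
    hM hcl hcu he hδ.ne' hWM (fun x => hW1 _) ?_ (fun x => ?_) (by fun_prop) (fun x => hGb _) hGM
  · have s1 : ∫ x, W (M * x) = M⁻¹ * (M / δ) := by
      rw [Measure.integral_comp_mul_left, hWI, abs_inv, abs_of_pos hM, smul_eq_mul]
    have s2 : ∫ x, ‖G (M * x)‖ ^ 2 = M⁻¹ * ∫ x, ‖G x‖ ^ 2 := by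
      rw [Measure.integral_comp_mul_left (fun x => ‖G x‖ ^ 2), abs_inv, abs_of_pos hM, smul_eq_mul]
    simp only [← e2] at e3
    rw [s1, s2, abs_of_pos hδ] at e3
    rw [e1, norm_mul, Complex.norm_real, Real.norm_of_nonneg (by positivity)]
    have s3 := scaling_identity (S := ∫ x, ‖G x‖ ^ 2) hM hδ
    calc _ ≤ Real.sqrt δ * K * M * (C * Real.sqrt (1 / (M * Real.sqrt M) *
          (M⁻¹ * (M / δ) + δ⁻¹) * (M⁻¹ * ∫ x, ‖G x‖ ^ 2))) := by gcongr
      _ = C * K * (Real.sqrt δ * (M * Real.sqrt (1 / (M * Real.sqrt M) *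
          (M⁻¹ * (M / δ) + δ⁻¹) * (M⁻¹ * ∫ x, ‖G x‖ ^ 2)))) := by ring
      _ = _ := by rw [s3]; ring
  · refine AEStronglyMeasurable.mul ?_ ?_
    · exact Complex.continuous_ofReal.comp_aestronglyMeasurable hWM.1
    · have : StronglyMeasurable fun x => conj (h' (M * x)) :=
        Complex.continuous_conj.comp_stronglyMeasurable (hh'm.comp_measurable hmul)
      simp only [div_eq_mul_inv]
      exact (this.mul_const _).aestronglyMeasurable
  · simp only [hH]
    rw [norm_mul, norm_div, Complex.norm_real, Complex.norm_real, Real.norm_of_nonneg hK,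
      RCLike.norm_conj, Real.norm_of_nonneg (hW0 _)]
    exact mul_le_of_le_one_right (hW0 _) (div_le_one_of_le₀ (hh'K _) hK)

end CurveBHT

end

theorem mainTheorem8 (d : ℕ) (hd : 2 ≤ d)
    (ρ₁ : ℝ → ℝ) (hρ₁ : CurveBHT.IsBump ρ₁)
    (Φ₁ : 𝓢(ℝ, ℂ)) (hΦ₁ : CurveBHT.IsFreqCutoff Φ₁)
    (φ : 𝓢(ℝ, ℝ)) (hφ : CurveBHT.IsSpaceCutoff φ)
    (ε : ℝ) (hε : 0 < ε) :
    ∃ C : ℝ, ∀ (j m : ℕ) (n : ℤ), 0 < j →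
      ∀ I₁ I₂ : Set ℝ, CurveBHT.IsFreqInterval I₁ → CurveBHT.IsFreqInterval I₂ →
      ∀ q₁ ∈ CurveBHT.phasesQ₁ d m,
      -- `f₁` is the element of `L²(I₁)` given by `exp (i q₁)`
      ∀ f₁ : Lp (α := ℝ) ℂ 2,
        f₁ =ᵐ[volume] I₁.indicator (fun ξ => Complex.exp (Complex.I * (q₁ ξ : ℂ))) →
      -- `f₂` belongs to `L²(I₂)`
      ∀ f₂ : Lp (α := ℝ) ℂ 2, (∀ᵐ ξ : ℝ, ξ ∉ I₂ → f₂ ξ = 0) →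
      -- the Fourier transform of `f₃` is the function `f₃hat` in `L^∞`
      ∀ (f₃ : 𝓢'(ℝ, ℂ)) (f₃hat : Lp (α := ℝ) ℂ ∞), 𝓕 f₃ = (f₃hat : 𝓢'(ℝ, ℂ)) →
        ‖CurveBHT.trilinΛ d ρ₁ Φ₁ φ j m n f₁ f₂ f₃‖ ≤
          C * (2 : ℝ) ^ (-(CurveBHT.decayExp ε (d - 1) * m / 2)) * ‖f₂‖ * ‖f₃hat‖ := by
  obtain ⟨N, rfl⟩ : ∃ N, d = N + 1 := ⟨d - 1, by omega⟩
  have hN : 1 ≤ N := by omega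
  have hN0 : (0 : ℝ) < N := by exact_mod_cast hN
  set r₁ : ℝ := (1 / 16 : ℝ) ^ ((N : ℝ)⁻¹) with hr₁
  set r₂ : ℝ := (39 / 16 : ℝ) ^ ((N : ℝ)⁻¹) with hr₂
  have h₁ : 0 < r₁ := by positivity
  have h₂ : r₁ ≤ r₂ := Real.rpow_le_rpow (by norm_num) (by norm_num) (by positivity)
  have hp₁ : r₁ ^ N = 1 / 16 := Real.rpow_inv_natCast_pow (by norm_num) (by omega)
  have hp₂ : r₂ ^ N = 39 / 16 := Real.rpow_inv_natCast_pow (by norm_num) (by omega)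
  -- The profile vanishes at both endpoints because `1/16 < 1/8` and `39/16 > 19/8`. The constants
  -- `c₁`, `c₂` come from the range of `|a|` and `c = a / N`.
  have hmain : ∀ σ : ℝ, (σ = 1 ∨ σ = -1) → _ := fun σ hσ => by
    have hσa : |σ| = 1 := by rcases hσ with rfl | rfl <;> simp
    exact CurveBHT.exists_paired_bound hN (CurveBHT.contDiff_freqProfile N Φ₁ σ) h₁ h₂
      (CurveBHT.freqProfile_eq_zero hΦ₁ (by rw [hp₁, abs_mul, hσa]; norm_num [abs_of_pos]))
      (CurveBHT.freqProfile_eq_zero hΦ₁ (by rw [hp₂, abs_mul, hσa]; norm_num [abs_of_pos]))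
      hρ₁ (c₁ := 2 ^ (-100 : ℤ) / N) (c₂ := 2 ^ (100 : ℤ) / N) (by positivity) (by positivity)
  obtain ⟨Ca, hCa, hA⟩ := hmain 1 (Or.inl rfl)
  obtain ⟨Cb, hCb, hB⟩ := hmain (-1) (Or.inr rfl)
  obtain ⟨CΦ, hCΦ, hG⟩ := CurveBHT.exists_fourierRestrict_bound Φ₁
  -- The sign `σ` is determined by `I₁`, which is introduced only later, so the constants for both
  -- signs are added.
  refine ⟨(Ca + Cb) * CΦ, ?_⟩
  intro j m n hj I₁ I₂ hI₁ hI₂ q₁ hq₁ f₁ hf₁ f₂ hf₂ f₃ f₃hat hf₃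
  obtain ⟨a, b, ha₁, ha₂, rfl⟩ := hq₁
  obtain ⟨σ, hσ, hwave⟩ := CurveBHT.fourierRestrict_eq_waveFn hN Φ₁ h₁.le h₂ hp₁ hp₂ hI₁
  have hF := hwave a b f₁ (by
    have : ((N + 1 : ℕ) : ℝ) / (((N + 1 : ℕ) : ℝ) - 1) = (N + 1 : ℝ) / N := by push_cast; ring
    simp only [this] at hf₁
    exact hf₁)
  obtain ⟨hGc, ⟨g, hGb⟩, hGm, hGn⟩ := hG f₂
  obtain ⟨hhm, hhK⟩ := CurveBHT.norm_linftyRep_le hf₃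
  set M : ℝ := 2 ^ m with hM
  have hM0 : 0 < M := by positivity
  set δ : ℝ := (2 : ℝ) ^ (-((((N + 1 : ℕ) : ℤ) - 1) * j)) with hδ
  have hδ0 : 0 < δ := by positivity
  have hδs : (2 : ℝ) ^ (-((((N + 1 : ℕ) : ℝ) - 1) * j / 2)) = Real.sqrt δ := by
    rw [Real.sqrt_eq_rpow, hδ, ← Real.rpow_intCast, ← Real.rpow_mul (by norm_num)]
    congr 1
    push_cast
    ring
  set k : ℤ := (((N + 1 : ℕ) : ℤ) - 1) * j + m with hk
  have hkM : (2 : ℝ) ^ k = M / δ := by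
    rw [hk, hδ, hM, zpow_add₀ (by norm_num), zpow_neg, zpow_natCast]
    field_simp
  obtain ⟨hWi, hWI⟩ := CurveBHT.integral_smoothInd hφ k n
  rw [hkM] at hWI
  have hca : |a / N| = |a| / N := by rw [abs_div, abs_of_pos hN0]
  have hc₁ : 2 ^ (-100 : ℤ) / N * M ≤ |a / N| := by
    rw [hca, div_mul_eq_mul_div]
    gcongr
    refine le_trans (le_of_eq ?_) ha₁
    rw [hM, ← zpow_natCast, ← zpow_add₀ (by norm_num)]
    congr 1
  have hc₂ : |a / N| ≤ 2 ^ (100 : ℤ) / N * M := by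
    rw [hca, div_mul_eq_mul_div]
    gcongr
    refine ha₂.trans (le_of_eq ?_)
    rw [hM, ← zpow_natCast, ← zpow_add₀ (by norm_num)]
    congr 1; ring
  have he : |2 * Real.pi * σ| = 2 * Real.pi := by
    rw [abs_mul, abs_of_pos (by positivity : 0 < 2 * Real.pi)]
    rcases hσ with rfl | rfl <;> simp
  have hbound : ‖CurveBHT.trilinΛ (N + 1) ρ₁ Φ₁ φ j m n f₁ f₂ f₃‖ ≤ (Ca + Cb) *
      (1 / Real.sqrt (Real.sqrt M)) *
      Real.sqrt (∫ x, ‖CurveBHT.fourierRestrict Φ₁ (𝓕⁻ f₂) x‖ ^ 2) * ‖f₃hat‖ := by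
    unfold CurveBHT.trilinΛ CurveBHT.bilinB
    rw [hF, hδs]
    rcases hσ with rfl | rfl
    · refine (hA hM0 hc₁ hc₂ he hδ0 hWi hWI (CurveBHT.smoothInd_nonneg hφ k n)
        (CurveBHT.smoothInd_le_one hφ k n) hhm hhK (norm_nonneg _) hGc hGb hGm).trans ?_
      gcongr
      linarith
    · refine (hB hM0 hc₁ hc₂ he hδ0 hWi hWI (CurveBHT.smoothInd_nonneg hφ k n)
        (CurveBHT.smoothInd_le_one hφ k n) hhm hhK (norm_nonneg _) hGc hGb hGm).trans ?_
      gcongr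
      linarith
  -- The bound obtained is `2 ^ (-m / 4)`, and half the decay exponent is at most `1/4`.
  have hdec : 1 / Real.sqrt (Real.sqrt M) ≤
      (2 : ℝ) ^ (-(CurveBHT.decayExp ε (N + 1 - 1) * m / 2)) := by
    have h1 : 1 / Real.sqrt (Real.sqrt M) = (2 : ℝ) ^ (-((m : ℝ) / 4)) := by
      rw [Real.sqrt_eq_rpow, Real.sqrt_eq_rpow, hM, ← Real.rpow_natCast,
        ← Real.rpow_mul (by norm_num), ← Real.rpow_mul (by norm_num), Real.rpow_neg (by norm_num),
        one_div]
      congr 2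
      ring
    rw [h1]
    apply Real.rpow_le_rpow_of_exponent_le (by norm_num)
    have h2 := CurveBHT.decayExp_le hε hN
    rw [Nat.add_sub_cancel]
    nlinarith [(Nat.cast_nonneg m : (0 : ℝ) ≤ m)]
  have hS : Real.sqrt (∫ x, ‖CurveBHT.fourierRestrict Φ₁ (𝓕⁻ f₂) x‖ ^ 2) ≤ CΦ * ‖f₂‖ :=
    Real.sqrt_le_iff.2 ⟨by positivity, hGn⟩
  calc _ ≤ _ := hbound
    _ ≤ (Ca + Cb) * (2 : ℝ) ^ (-(CurveBHT.decayExp ε (N + 1 - 1) * m / 2)) * (CΦ * ‖f₂‖) *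
        ‖f₃hat‖ := by gcongr
    _ = _ := by ring
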